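/- **Conventions.** Problems are languages over $\{0,1\}$ and $N$ is the input length. $\mathsf{L}$ and $\mathsf{NL}$ are the classes of languages decided in space $O(\log N)$ by deterministic, resp. nondeterministic, Turing machines with a read-only input tape and a read/write work tape. A language $B$ is *$\mathsf{L}$-hard* if every $A\in\mathsf{L}$ is $\mathsf{NC}^1$ reducible to $B$, i.e. decided by a logspace-uniform family of polynomial-size, depth-$O(\log n)$ Boolean circuits with gates AND, OR, NOT of fan-in at most two and oracle gates for $B$, where an oracle gate with $k$ inputs counts $\lceil\log_2(k+1)\rceil$ towards the depth. $B$ is *$\mathsf{NL}$-hard* if every $A\in\mathsf{NL}$ is reducible to $B$ by a log-space computable many-one reduction, and *$\mathsf{NL}$-complete* if moreover $B\in\mathsf{NL}$. In the (deterministic, uniform) MPC model, $p$ machines with local memories of $s$ words of $O(\log N)$ bits each compute in synchronous rounds. The input is distributed adversarially over the machines; in each round a machine performs a local computation on its memory and then sends words to other machines, and no machine may store, send or receive more than $s$ words. One computable algorithm serves all input sizes. For $f\colon\mathbb N\to\mathbb R^+$, a problem *can be solved in $O(f(N))$ MPC rounds* if for every constant $\varepsilon\in(0,1)$ there is such an algorithm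 that decides it in $O(f(N))$ rounds with $s=O(N^{1-\varepsilon})$ and a total memory $p\cdot s$ that is at least $N$, is $\Omega(N^{2(1-\varepsilon)})$, and is $O(N^{1+\gamma})$ for some constant $\gamma\ge 0$ (the implied constants and $\gamma$ may depend on the problem and on $\varepsilon$). **Theorem.** Let $f\colon\mathbb N\to\mathbb R^+$ be a function such that for every $k\in\mathbb N$ there is a constant $C_k$ with $$\min\{f(m),\ \log(N+2)\}\le C_k\, f(N)\qquad\text{for all } N \text{ and all } m\le (N+2)^k .$$ (This holds, for instance, if $f$ is constant, if $f(N)=\Omega(\log(N+2))$, or if $f$ is nondecreasing and $f((N+2)^k)=O(f(N))$ for every constant $k$.) Suppose that some $\mathsf{L}$-hard problem can be solved in $O(f(N))$ MPC rounds. Then: 1. either all $\mathsf{NL}$-complete problems can be solved in $O(f(N))$ MPC rounds, or none of them can; 2. if moreover some $\mathsf{NL}$-hard problem can be solved in $O(f(N))$ MPC rounds, then all problems in $\mathsf{NL}$ can be solved in $O(f(N))$ MPC rounds. -/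

import Mathlib

namespace MPCSpace

/-! ### Two-tape Turing machines and logarithmic space -/

/-- Symbols on the read-only input tape: the input bits between two end markers. -/
inductive InSym where
  | leftEnd
  | bit (b : Bool)
  | rightEnd

/-- Head movements. -/
inductive Move where
  | left
  | stay
  | right

/-- A (nondeterministic) Turing machine with a read-only input tape and one read/write work tape.
A configuration without applicable transition is halting. -/
structure TuringMachine where
  State : Type
  Sym : Type
  finite_state : Finite State
  finite_sym : Finite Sym
  blank : Sym
  start : State
  accept : State
  /-- `(q', b', d, d') ∈ trans q a b`: in state `q`, reading `a` on the input tape and `b` on the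
  work tape, the machine may go to `q'`, write `b'` on the work tape, and move its input head by
  `d` and its work head by `d'`. -/
  trans : State → InSym → Sym → Set (State × Sym × Move × Move)

namespace TuringMachine

/-- Configurations; the work tape is one-way infinite. -/
structure Config (M : TuringMachine) where
  state : M.State
  inputHead : ℕ
  tape : ℕ → M.Sym
  workHead : ℕ

/-- Cell `0` of the input tape holds the left marker, cells `1, …, |x|` hold the bits of `x`, and
cell `|x| + 1` holds the right marker. -/
def inputSymbol (x : List Bool) (h : ℕ) : InSym :=
  if h = 0 then InSym.leftEnd
  else match x[h - 1]? with
    | some b => InSym.bit b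
    | none => InSym.rightEnd

/-- The input head never leaves the cells `0, …, n + 1`. -/
def moveInput (n : ℕ) : Move → ℕ → ℕ
  | Move.left, h => h - 1
  | Move.stay, h => h
  | Move.right, h => min (h + 1) (n + 1)

/-- The work head stays in place when told to move left from cell `0`. -/
def moveWork : Move → ℕ → ℕ
  | Move.left, h => h - 1
  | Move.stay, h => h
  | Move.right, h => h + 1

/-- The initial configuration. -/
def initial (M : TuringMachine) : M.Config where
  state := M.start
  inputHead := 0
  tape := fun _ => M.blank
  workHead := 0

/-- One computation step on input `x`. -/
def Step (M : TuringMachine) (x : List Bool) (c c' : M.Config) : Prop :=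
  ∃ q b d e, (q, b, d, e) ∈ M.trans c.state (inputSymbol x c.inputHead) (c.tape c.workHead) ∧
    c' = { state := q
           inputHead := moveInput x.length d c.inputHead
           tape := Function.update c.tape c.workHead b
           workHead := moveWork e c.workHead }

/-- `c` occurs in some computation on input `x`. -/
def Reachable (M : TuringMachine) (x : List Bool) (c : M.Config) : Prop :=
  Relation.ReflTransGen (M.Step x) M.initial c

/-- At most one transition is applicable in every situation. -/
def Deterministic (M : TuringMachine) : Prop :=
  ∀ q a b, (M.trans q a b).Subsingleton

/-- `M` decides `A` in logarithmic space: on every input all computations halt and scan only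
`O(log |x|)` cells of the work tape, and `x ∈ A` iff some computation reaches the accepting
state. -/
def DecidesInLogSpace (M : TuringMachine) (A : Language Bool) : Prop :=
  (∃ c : ℕ, ∀ x, ∀ k, M.Reachable x k → k.workHead < c * Nat.log 2 (x.length + 2)) ∧
  (∀ x, ¬ ∃ k : ℕ → M.Config, k 0 = M.initial ∧ ∀ t, M.Step x (k t) (k (t + 1))) ∧
  (∀ x, x ∈ A ↔ ∃ k, M.Reachable x k ∧ k.state = M.accept)

end TuringMachine

/-- The class `L`. -/
def InL (A : Language Bool) : Prop :=
  ∃ M : TuringMachine, M.Deterministic ∧ M.DecidesInLogSpace A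

/-- The class `NL`. -/
def InNL (A : Language Bool) : Prop :=
  ∃ M : TuringMachine, M.DecidesInLogSpace A

/-! ### Log-space computable functions and log-space reductions -/

/-- The pair `⟨x, i⟩`, with the index `i` written in unary. -/
def pairIndex (x : List Bool) (i : ℕ) : List Bool :=
  List.replicate i true ++ false :: x

/-- `g` is (implicitly) log-space computable: `|g x|` is polynomially bounded in `|x|`, and the
languages `{⟨x, i⟩ | i < |g x|}` and `{⟨x, i⟩ | the i-th bit of g x is 1}` are in `L`. -/
def LogSpaceComputable (g : List Bool → List Bool) : Prop :=
  (∃ c : ℕ, ∀ x, (g x).length ≤ (x.length + 2) ^ c) ∧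
  InL {y | ∃ x i, y = pairIndex x i ∧ i < (g x).length} ∧
  InL {y | ∃ x i, y = pairIndex x i ∧ (g x)[i]? = some true}

/-- `A` is log-space (many-one) reducible to `B`. -/
def LogSpaceReducible (A B : Language Bool) : Prop :=
  ∃ g : List Bool → List Bool, LogSpaceComputable g ∧ ∀ x, x ∈ A ↔ g x ∈ B

/-- `B` is `NL`-hard (under log-space reductions). -/
def NLHard (B : Language Bool) : Prop :=
  ∀ A, InNL A → LogSpaceReducible A B

/-- `B` is `NL`-complete. -/
def NLComplete (B : Language Bool) : Prop :=
  InNL B ∧ NLHard B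

/-! ### Boolean oracle circuits and `NC¹` reductions -/

/-- Nodes of a Boolean circuit with oracle gates; arguments are indices of earlier nodes. -/
inductive Gate where
  | input (i : ℕ)
  | const (b : Bool)
  | not (j : ℕ)
  | and (j k : ℕ)
  | or (j k : ℕ)
  | oracle (js : List ℕ)

namespace Gate

/-- The nodes with an edge into this node. -/
def args : Gate → List ℕ
  | input _ => []
  | const _ => []
  | not j => [j]
  | and j k => [j, k]
  | or j k => [j, k]
  | oracle js => js

/-- The value of a node on input `x`, with oracle `B`, given the values of all earlier nodes. -/
noncomputable def eval (B : Language Bool) (x : List Bool) (vals : List Bool) : Gate → Bool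
  | input i => x.getD i false
  | const b => b
  | not j => !(vals.getD j false)
  | and j k => vals.getD j false && vals.getD k false
  | or j k => vals.getD j false || vals.getD k false
  | oracle js => by
      classical exact decide ((js.map fun j => vals.getD j false) ∈ B)

/-- The contribution of a node to the depth: an oracle gate with `k` inputs (and one output)
counts `⌈log₂ (k + 1)⌉`. -/
def weight : Gate → ℕ
  | input _ => 0
  | const _ => 0
  | not _ => 1
  | and _ _ => 1
  | or _ _ => 1
  | oracle js => Nat.clog 2 (js.length + 1)

/-- The depth of a node, given the depths of all earlier nodes. -/
def depth (ds : List ℕ) (g : Gate) : ℕ :=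
  g.weight + (g.args.map fun j => ds.getD j 0).foldr max 0

/-- A self-delimiting code for natural numbers. -/
def encodeNat (n : ℕ) : List Bool :=
  List.replicate n true ++ [false]

/-- A self-delimiting code for nodes. -/
def encode : Gate → List Bool
  | input i => encodeNat 0 ++ encodeNat i
  | const b => encodeNat 1 ++ encodeNat b.toNat
  | not j => encodeNat 2 ++ encodeNat j
  | and j k => encodeNat 3 ++ encodeNat j ++ encodeNat k
  | or j k => encodeNat 4 ++ encodeNat j ++ encodeNat k
  | oracle js => encodeNat 5 ++ encodeNat js.length ++ js.flatMap encodeNat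

end Gate

/-- A circuit is given by its nodes in a topological order; the last node is the output. -/
abbrev Circuit := List Gate

namespace Circuit

/-- `C` is a circuit with one output on `n` inputs: it has a node, every input node refers to one
of the `n` inputs, and every edge comes from an earlier node. -/
def WellFormed (C : Circuit) (n : ℕ) : Prop :=
  C ≠ [] ∧ (∀ i, Gate.input i ∈ C → i < n) ∧
    ∀ (t : ℕ) (g : Gate), C[t]? = some g → ∀ j ∈ g.args, j < t

/-- The values of all nodes, in order. -/
noncomputable def values (B : Language Bool) (x : List Bool) (C : Circuit) : List Bool :=
  C.foldl (fun vals g => vals ++ [g.eval B x vals]) []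

/-- The output on input `x` with oracle `B`. -/
noncomputable def output (B : Language Bool) (x : List Bool) (C : Circuit) : Bool :=
  (C.values B x).getLastD false

/-- The depths of all nodes, in order. -/
def depths (C : Circuit) : List ℕ :=
  C.foldl (fun ds g => ds ++ [g.depth ds]) []

/-- The description of a circuit as a bit string. -/
def encode (C : Circuit) : List Bool :=
  C.flatMap Gate.encode

end Circuit

/-- `A` is `NC¹` reducible to `B`: it is decided by a logspace-uniform family of circuits with
oracle gates for `B`, of polynomial size, fan-in at most two (except at oracle gates), and depth
`O(log n)`. -/
def NC1Reducible (A B : Language Bool) : Prop :=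
  ∃ C : ℕ → Circuit,
    (∀ n, (C n).WellFormed n) ∧
    (∃ g, LogSpaceComputable g ∧ ∀ n, g (List.replicate n true) = (C n).encode) ∧
    (∃ c : ℕ, ∀ n, (C n).length ≤ (n + 2) ^ c) ∧
    (∃ c : ℕ, ∀ n, ∀ d ∈ (C n).depths, d ≤ c * Nat.log 2 (n + 2)) ∧
    (∀ x, x ∈ A ↔ (C x.length).output B x = true)

/-- `B` is `L`-hard (under `NC¹` reductions). -/
def LHard (B : Language Bool) : Prop :=
  ∀ A, InL A → NC1Reducible A B

/-! ### Massively parallel computation -/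

/-- A uniform (deterministic) MPC algorithm: one algorithm for inputs of all sizes `N`. Machines are
numbered `0, …, machines N - 1`; words are natural numbers, and a memory is a list of words.
* `capacity N` is the size, in words, of the local memory of each machine;
* `rounds N` is the number of rounds on inputs of size `N`;
* `step N r i m` is what machine `i` does in round `r` when its memory is `m`: the first component
  is what it keeps, the second one is the list of messages `(j, w)`, sending the word `w` to
  machine `j`;
* `answer N m` is the answer given at the end by machine `0`, when its memory is `m`. -/
structure MPCAlgorithm where
  machines : ℕ → ℕ
  capacity : ℕ → ℕ
  rounds : ℕ → ℕ
  step : ℕ → ℕ → ℕ → List ℕ → List ℕ × List (ℕ × ℕ)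
  answer : ℕ → List ℕ → Bool
  computable_machines : Computable machines
  computable_capacity : Computable capacity
  computable_rounds : Computable rounds
  computable_step : Computable fun q : ℕ × ℕ × ℕ × List ℕ => step q.1 q.2.1 q.2.2.1 q.2.2.2
  computable_answer : Computable fun q : ℕ × List ℕ => answer q.1 q.2

namespace MPCAlgorithm

/-- The words that machine `i` receives in round `r`, if `mem j` is the memory of machine `j`. -/
def received (P : MPCAlgorithm) (N r : ℕ) (mem : ℕ → List ℕ) (i : ℕ) : List ℕ :=
  (List.range (P.machines N)).flatMap fun j =>
    ((P.step N r j (mem j)).2.filter fun msg => msg.1 = i).map Prod.snd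

/-- The memory of machine `i` after `r` rounds, if the computation starts from `mem`. -/
def memory (P : MPCAlgorithm) (N : ℕ) (mem : ℕ → List ℕ) : ℕ → ℕ → List ℕ
  | 0, i => mem i
  | r + 1, i =>
      (P.step N r i (P.memory N mem r i)).1 ++ P.received N r (P.memory N mem r) i

/-- The input as a list of words; the word of the `j`-th bit `b` encodes the pair `(j, b)`. -/
def inputWords (x : List Bool) : List ℕ :=
  x.zipIdx.map fun q => 2 * q.2 + q.1.toNat

/-- `mem` is a possible initial distribution of the input `x` over the machines, chosen by an
adversary subject only to the memory size. -/
def IsDistribution (P : MPCAlgorithm) (x : List Bool) (mem : ℕ → List ℕ) : Prop :=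
  ((List.range (P.machines x.length)).flatMap mem).Perm (inputWords x) ∧
    ∀ i < P.machines x.length, (mem i).length ≤ P.capacity x.length

/-- The computation from `mem` obeys the restrictions of the model: no machine ever stores (hence
keeps or receives) or sends more than `capacity N` words, all of them of `O(log N)` bits, namely
smaller than `(N + 2) ^ c`. -/
def ObeysLimits (P : MPCAlgorithm) (c N : ℕ) (mem : ℕ → List ℕ) : Prop :=
  (∀ r ≤ P.rounds N, ∀ i < P.machines N,
    (P.memory N mem r i).length ≤ P.capacity N ∧
    ∀ w ∈ P.memory N mem r i, w < (N + 2) ^ c) ∧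
  (∀ r < P.rounds N, ∀ i < P.machines N,
    (P.step N r i (P.memory N mem r i)).2.length ≤ P.capacity N)

/-- `P` decides `A` correctly, whatever the initial distribution of the input, within the
restrictions of the model. -/
def Decides (P : MPCAlgorithm) (A : Language Bool) : Prop :=
  ∃ c : ℕ, ∀ x mem, P.IsDistribution x mem →
    P.ObeysLimits c x.length mem ∧
    (x ∈ A ↔ P.answer x.length (P.memory x.length mem (P.rounds x.length) 0) = true)

/-- The machines have local memories of `O(N^(1-ε))` words; the total memory is sufficient to hold
the input, is `Ω(N^(2(1-ε)))`, and is `O(N^(1+γ))` for some constant `γ ≥ 0`. -/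
def MemoryRegime (P : MPCAlgorithm) (ε : ℝ) : Prop :=
  (∀ N, 0 < P.machines N ∧ N ≤ P.machines N * P.capacity N) ∧
  (∃ C : ℝ, ∀ N : ℕ, (P.capacity N : ℝ) ≤ C * ((N : ℝ) + 1) ^ (1 - ε)) ∧
  (∃ c : ℝ, 0 < c ∧ ∀ N : ℕ,
    c * ((N : ℝ) + 1) ^ (2 * (1 - ε)) ≤ (P.machines N : ℝ) * P.capacity N) ∧
  (∃ γ : ℝ, 0 ≤ γ ∧ ∃ C : ℝ, ∀ N : ℕ,
    (P.machines N : ℝ) * P.capacity N ≤ C * ((N : ℝ) + 1) ^ (1 + γ))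

end MPCAlgorithm

/-- The problem `A` can be solved in `O(f(N))` MPC rounds: for every constant `ε ∈ (0, 1)` (the
choice of `ε` is up to the user) there is a uniform MPC algorithm with local memories of size
`O(N^(1-ε))` and polynomial total memory that decides `A` in `O(f(N))` rounds. -/
def SolvableInRounds (f : ℕ → ℝ) (A : Language Bool) : Prop :=
  ∀ ε : ℝ, 0 < ε → ε < 1 →
    ∃ P : MPCAlgorithm, P.MemoryRegime ε ∧ P.Decides A ∧
      ∃ C : ℝ, ∀ N : ℕ, (P.rounds N : ℝ) ≤ C * f N

/-- Replacing the input size by a polynomially related one does not change the order of magnitude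
of `f`, except possibly where `f` is at least logarithmic. -/
def PolyStableBelowLog (f : ℕ → ℝ) : Prop :=
  ∀ k : ℕ, ∃ C : ℝ, ∀ N m : ℕ, m ≤ (N + 2) ^ k →
    min (f m) (Real.log ((N : ℝ) + 2)) ≤ C * f N

end MPCSpace

/-!
The proof reduces everything to one simulation. A *network* is a uniform family of polynomially
many Boolean cells which are updated synchronously; the new value of a cell is either a computable
function of at most about `N ^ (1 / d)` other cells, or the answer of an oracle to a query made up
of polynomially many cells. If MPC algorithms for the oracles are given, then an iteration of a
network is simulated in a constant number of rounds plus the number of rounds needed for the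
queries: every cell gets its own polynomial-size group of machines, copies of the values of all
cells are made by a broadcast along trees with branching factor `fan d N`, the copies are sent to
the cells that need them, and the group of each cell runs the algorithm for the oracle on what it
has received (`Implementation.alg_decides`, `Network.Decides.exists_alg`). Local work is only
required to be computable in this model.

Three kinds of problems are solved in this way.

* Disjunctions are evaluated in `O(1)` rounds. With disjunctions as oracle, repeated squaring of
  the reachability relation in the configuration graph of a Turing machine shows that every
  problem in `NL` can be solved in `O(log N)` rounds (`InNL.solvable_log`).
* If a problem in `L` is `NC¹` reducible to a problem that can be solved in `O(f(N))` rounds, then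
  it can be solved in `O(f(N))` rounds itself (`NC1Reducible.solvable`). The circuit is cut into
  constantly many blocks of depth `log₂ N / d`. The oracle gates all of whose arguments come from
  lower blocks become queries. Any other gate depends on at most `fan d N` values from lower
  blocks, queries and inputs, since a gate of weight `w` has at most `2 ^ w` arguments
  (`Circuit.length_frontier_le`); its value is computed locally, for which a decision procedure
  for the oracle is used instead of queries. Hence a constant number of iterations suffices.
* If `A` in `NL` is reducible to `B`, then the bits of the instance of `B` are given by languages
  in `L`. These are solvable in `O(f(N))` rounds by the previous item if some `L`-hard problem is,
  and one query to `B` for each possible length of the instance remains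
  (`LogSpaceReducible.solvable`).

Queries have polynomial length `m`, so they take `O(f(m))` rounds, which may be more than
`O(f(N))`. The algorithm can compute the number of rounds that it would need. If that exceeds
`log₂ N`, it uses the algorithm with `O(log N)` rounds instead. In this way the number of rounds
is `O(min {f(m), log N})`, which is `O(f(N))` by assumption (`solvable_of_networks`).
-/

namespace MPCSpace

/-! ### Computable functions -/

/- With these attributes and the lemmas of this section, `fun_prop` proves the computability of
functions that are given by explicit terms. -/
attribute [fun_prop] Computable ComputablePred

section Computability

variable {α β γ σ : Type*} [Primcodable α] [Primcodable β] [Primcodable γ] [Primcodable σ]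

@[fun_prop] theorem computable_id : Computable fun a : α => a := Computable.id

@[fun_prop] theorem computable_const (s : σ) : Computable fun _ : α => s := Computable.const s

@[fun_prop] theorem computable_comp {f : β → σ} {g : α → β} (hf : Computable f)
    (hg : Computable g) : Computable fun a => f (g a) := hf.comp hg

@[fun_prop] theorem computable_pair {f : α → β} {g : α → γ} (hf : Computable f)
    (hg : Computable g) : Computable fun a => (f a, g a) := hf.pair hg

@[fun_prop] theorem computable_fst : Computable fun a : α × β => a.1 := Computable.fst

@[fun_prop] theorem computable_snd : Computable fun a : α × β => a.2 := Computable.snd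

@[fun_prop] theorem computable_add : Computable fun a : ℕ × ℕ => a.1 + a.2 :=
  Primrec.nat_add.to_comp

@[fun_prop] theorem computable_sub : Computable fun a : ℕ × ℕ => a.1 - a.2 :=
  Primrec.nat_sub.to_comp

@[fun_prop] theorem computable_mul : Computable fun a : ℕ × ℕ => a.1 * a.2 :=
  Primrec.nat_mul.to_comp

@[fun_prop] theorem computable_div : Computable fun a : ℕ × ℕ => a.1 / a.2 :=
  Primrec.nat_div.to_comp

@[fun_prop] theorem computable_mod : Computable fun a : ℕ × ℕ => a.1 % a.2 :=
  Primrec.nat_mod.to_comp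

@[fun_prop] theorem computable_max : Computable fun a : ℕ × ℕ => max a.1 a.2 :=
  Primrec.nat_max.to_comp

@[fun_prop] theorem computable_min : Computable fun a : ℕ × ℕ => min a.1 a.2 :=
  Primrec.nat_min.to_comp

@[fun_prop] theorem computable_natRec {f : α → ℕ} {g : α → σ} {h : α → ℕ → σ → σ}
    (hf : Computable f) (hg : Computable g)
    (hh : Computable fun p : α × ℕ × σ => h p.1 p.2.1 p.2.2) :
    Computable fun a => Nat.rec (motive := fun _ => σ) (g a) (h a) (f a) :=
  Computable.nat_rec (h := fun a p => h a p.1 p.2) hf hg hh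

@[fun_prop] theorem computable_pow : Computable fun a : ℕ × ℕ => a.1 ^ a.2 := by
  have : Computable fun a : ℕ × ℕ =>
      Nat.rec (motive := fun _ => ℕ) 1 (fun _ s => s * a.1) a.2 := by fun_prop
  refine this.of_eq fun a => ?_
  induction a.2 with
  | zero => simp
  | succ n ih => rw [pow_succ, ← ih]

@[fun_prop] theorem computable_decide {p : α → Prop} [∀ a, Decidable (p a)]
    (hp : ComputablePred p) : Computable fun a => decide (p a) := by
  obtain ⟨_, h⟩ := hp
  exact h.of_eq fun a => by by_cases h : p a <;> simp [h]

theorem computablePred_of_decide {p : α → Prop} [i : ∀ a, Decidable (p a)]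
    (hp : Computable fun a => decide (p a)) : ComputablePred p := ⟨i, hp⟩

theorem computablePred_of_bool {p : α → Prop} {b : α → Bool} (hb : Computable b)
    (h : ∀ a, b a = true ↔ p a) : ComputablePred p := by
  classical
  exact computablePred_of_decide (hb.of_eq fun a => by rw [Bool.eq_iff_iff]; simp [h])

@[fun_prop] theorem computablePred_lt {f g : α → ℕ} (hf : Computable f) (hg : Computable g) :
    ComputablePred fun a => f a < g a :=
  computablePred_of_decide (Primrec.nat_lt.decide.to_comp.comp hf hg)

@[fun_prop] theorem computablePred_le {f g : α → ℕ} (hf : Computable f) (hg : Computable g) :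
    ComputablePred fun a => f a ≤ g a :=
  computablePred_of_decide (Primrec.nat_le.decide.to_comp.comp hf hg)

@[fun_prop] theorem computablePred_eq {f g : α → β} (hf : Computable f) (hg : Computable g) :
    ComputablePred fun a => f a = g a := by
  classical
  exact computablePred_of_decide ((Primrec.eq (α := β)).decide.to_comp.comp hf hg)

@[fun_prop] theorem computable_cond {c : α → Bool} {f g : α → σ} (hc : Computable c)
    (hf : Computable f) (hg : Computable g) : Computable fun a => bif c a then f a else g a :=
  Computable.cond hc hf hg

@[fun_prop] theorem computable_ite {c : α → Prop} [∀ a, Decidable (c a)] {f g : α → σ}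
    (hc : ComputablePred c) (hf : Computable f) (hg : Computable g) :
    Computable fun a => if c a then f a else g a :=
  (Computable.cond (computable_decide hc) hf hg).of_eq fun a => by by_cases h : c a <;> simp [h]

@[fun_prop] theorem computable_and {f g : α → Bool} (hf : Computable f) (hg : Computable g) :
    Computable fun a => f a && g a :=
  Primrec.and.to_comp.comp hf hg

@[fun_prop] theorem computable_or {f g : α → Bool} (hf : Computable f) (hg : Computable g) :
    Computable fun a => f a || g a :=
  Primrec.or.to_comp.comp hf hg

@[fun_prop] theorem computable_not {f : α → Bool} (hf : Computable f) :
    Computable fun a => !f a :=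
  Primrec.not.to_comp.comp hf

@[fun_prop] theorem computablePred_and {p q : α → Prop} (hp : ComputablePred p)
    (hq : ComputablePred q) : ComputablePred fun a => p a ∧ q a := by
  classical
  exact computablePred_of_bool (computable_and (computable_decide hp) (computable_decide hq))
    fun a => by simp

@[fun_prop] theorem computablePred_or {p q : α → Prop} (hp : ComputablePred p)
    (hq : ComputablePred q) : ComputablePred fun a => p a ∨ q a := by
  classical
  exact computablePred_of_bool (computable_or (computable_decide hp) (computable_decide hq))
    fun a => by simp

@[fun_prop] theorem computable_toNat : Computable Bool.toNat :=
  (Primrec.dom_finite _).to_comp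

@[fun_prop] theorem computable_optionGetD {f : α → Option β} {g : α → β} (hf : Computable f)
    (hg : Computable g) : Computable fun a => (f a).getD (g a) :=
  Computable.option_getD hf hg

@[fun_prop] theorem computable_optionElim {o : α → Option β} {f : α → σ} {g : α → β → σ}
    (ho : Computable o) (hf : Computable f) (hg : Computable fun p : α × β => g p.1 p.2) :
    Computable fun a => (o a).elim (f a) (g a) :=
  (Computable.option_casesOn (g := g) ho hf hg).of_eq fun a => by cases o a <;> rfl

@[fun_prop] theorem computable_cons {f : α → β} {g : α → List β} (hf : Computable f)
    (hg : Computable g) : Computable fun a => f a :: g a :=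
  Computable.list_cons.comp hf hg

@[fun_prop] theorem computable_append {f g : α → List β} (hf : Computable f)
    (hg : Computable g) : Computable fun a => f a ++ g a :=
  Computable.list_append.comp hf hg

@[fun_prop] theorem computable_length : Computable (List.length : List α → ℕ) :=
  Computable.list_length

@[fun_prop] theorem computable_range : Computable List.range :=
  Primrec.list_range.to_comp

@[fun_prop] theorem computable_getElem? {f : α → List β} {g : α → ℕ} (hf : Computable f)
    (hg : Computable g) : Computable fun a => (f a)[g a]? :=
  Computable.list_getElem?.comp hf hg

@[fun_prop] theorem computable_getD {f : α → List β} {g : α → ℕ} {h : α → β} (hf : Computable f)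
    (hg : Computable g) (hh : Computable h) : Computable fun a => (f a).getD (g a) (h a) := by
  have : Computable fun a => ((f a)[g a]?).getD (h a) := by fun_prop
  exact this.of_eq fun a => by simp [List.getD]

@[fun_prop] theorem computable_headD {f : α → List β} {h : α → β} (hf : Computable f)
    (hh : Computable h) : Computable fun a => (f a).headD (h a) := by
  have : Computable fun a => (f a).getD 0 (h a) := by fun_prop
  exact this.of_eq fun a => by cases f a <;> simp

@[fun_prop] theorem computable_set {f : α → List β} {g : α → ℕ} {h : α → β} (hf : Computable f)
    (hg : Computable g) (hh : Computable h) : Computable fun a => (f a).set (g a) (h a) :=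
  Primrec.list_set.to_comp.comp hf (hg.pair hh)

@[fun_prop] theorem computable_idxOf [i : BEq β] [LawfulBEq β] {f : α → List β} {g : α → β}
    (hf : Computable f) (hg : Computable g) : Computable fun a => (f a).idxOf (g a) := by
  classical
  have hi : i = instBEqOfDecidableEq := lawful_beq_subsingleton _ _
  subst hi
  exact Primrec.list_idxOf.to_comp.comp hg hf

@[fun_prop] theorem computable_foldl {f : α → List β} {g : α → σ} {h : α → σ → β → σ}
    (hf : Computable f) (hg : Computable g)
    (hh : Computable fun p : α × σ × β => h p.1 p.2.1 p.2.2) :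
    Computable fun a => (f a).foldl (h a) (g a) := by
  have : Computable fun a => Nat.rec (motive := fun _ => σ) (g a)
      (fun n s => ((f a)[n]?).elim s fun b => h a s b) (f a).length := by
    refine computable_natRec (h := fun a n s => ((f a)[n]?).elim s fun b => h a s b)
      (by fun_prop) hg ?_
    fun_prop
  refine this.of_eq fun a => ?_
  have key : ∀ n, n ≤ (f a).length → Nat.rec (motive := fun _ => σ) (g a)
      (fun n s => ((f a)[n]?).elim s fun b => h a s b) n = ((f a).take n).foldl (h a) (g a) := by
    intro n
    induction n with
    | zero => simp
    | succ n ih =>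
      intro hn
      have hn' : n < (f a).length := hn
      simp only [ih hn'.le]
      rw [List.take_succ_eq_append_getElem hn', List.foldl_append]
      simp [hn']
  rw [key _ le_rfl, List.take_length]

@[fun_prop] theorem computable_map {f : α → List β} {g : α → β → σ} (hf : Computable f)
    (hg : Computable fun p : α × β => g p.1 p.2) : Computable fun a => (f a).map (g a) := by
  have : Computable fun a => (f a).foldl (fun s b => s ++ [g a b]) [] := by fun_prop
  refine this.of_eq fun a => ?_
  have key : ∀ (l : List β) (s : List σ),
      l.foldl (fun s b => s ++ [g a b]) s = s ++ l.map (g a) := by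
    intro l
    induction l with
    | nil => simp
    | cons b l ih => intro s; simp [ih]
  simp [key]

@[fun_prop] theorem computable_flatMap {f : α → List β} {g : α → β → List σ} (hf : Computable f)
    (hg : Computable fun p : α × β => g p.1 p.2) : Computable fun a => (f a).flatMap (g a) := by
  have : Computable fun a => (f a).foldl (fun s b => s ++ g a b) [] := by fun_prop
  refine this.of_eq fun a => ?_
  have key : ∀ (l : List β) (s : List σ),
      l.foldl (fun s b => s ++ g a b) s = s ++ l.flatMap (g a) := by
    intro l
    induction l with
    | nil => simp
    | cons b l ih => intro s; simp [ih]
  simp [key]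

@[fun_prop] theorem computable_filter {f : α → List β} {g : α → β → Bool} (hf : Computable f)
    (hg : Computable fun p : α × β => g p.1 p.2) : Computable fun a => (f a).filter (g a) := by
  have : Computable fun a => (f a).flatMap (fun b => bif g a b then [b] else []) := by fun_prop
  refine this.of_eq fun a => ?_
  induction f a with
  | nil => simp
  | cons b l ih => rw [List.flatMap_cons, ih]; cases h : g a b <;> simp [h]

@[fun_prop] theorem computable_any {f : α → List β} {g : α → β → Bool} (hf : Computable f)
    (hg : Computable fun p : α × β => g p.1 p.2) : Computable fun a => (f a).any (g a) := by
  have : Computable fun a => (f a).foldl (fun s b => s || g a b) false := by fun_prop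
  refine this.of_eq fun a => ?_
  have key : ∀ (l : List β) (s : Bool), l.foldl (fun s b => s || g a b) s = (s || l.any (g a)) := by
    intro l
    induction l with
    | nil => simp
    | cons b l ih => intro s; simp [ih, Bool.or_assoc]
  simp [key]

@[fun_prop] theorem computablePred_mem {f : α → β} {g : α → List β} (hf : Computable f)
    (hg : Computable g) : ComputablePred fun a => f a ∈ g a := by
  classical
  refine computablePred_of_bool (b := fun a => (g a).any fun b => decide (f a = b))
    (by fun_prop) fun a => ?_
  simp only [List.any_eq_true, decide_eq_true_eq]
  exact ⟨fun ⟨b, hb, e⟩ => e ▸ hb, fun h => ⟨_, h, rfl⟩⟩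

@[fun_prop] theorem computable_foldr_max {f : α → List ℕ} (hf : Computable f) :
    Computable fun a => (f a).foldr max 0 := by
  have : Computable fun a => (f a).foldl (fun s b => max s b) 0 := by fun_prop
  refine this.of_eq fun a => ?_
  exact List.foldl_eq_foldr

@[fun_prop] theorem computable_replicate {f : α → ℕ} {g : α → β} (hf : Computable f)
    (hg : Computable g) : Computable fun a => List.replicate (f a) (g a) := by
  have : Computable fun a => (List.range (f a)).map fun _ => g a := by fun_prop
  exact this.of_eq fun a => by simp

/-- A function with a computable graph is computable: search for the value. -/
theorem computable_of_graph {f : α → σ} {c : α → σ → Bool}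
    (hc : Computable fun p : α × σ => c p.1 p.2) (h : ∀ a s, c a s = true ↔ s = f a) :
    Computable f := by
  have h1 : Computable₂ fun (a : α) (n : ℕ) =>
      (Encodable.decode (α := σ) n).bind fun s => bif c a s then some s else none := by
    refine Computable.option_bind (Computable.decode.comp Computable.snd) ?_
    have : Computable fun p : (α × ℕ) × σ => bif c p.1.1 p.2 then some p.2 else none :=
      Computable.cond (hc.comp ((Computable.fst.comp Computable.fst).pair Computable.snd))
        (Computable.option_some.comp Computable.snd) (Computable.const none)
    exact this
  refine (Partrec.rfindOpt h1).of_eq_tot fun a => ?_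
  have hdom : (Nat.rfindOpt fun n =>
      (Encodable.decode (α := σ) n).bind fun s => bif c a s then some s else none).Dom := by
    rw [Nat.rfindOpt_dom]
    refine ⟨Encodable.encode (f a), f a, ?_⟩
    simp [(h a (f a)).2 rfl]
  obtain ⟨n, hn⟩ := Nat.rfindOpt_spec (Part.get_mem hdom)
  have hval : (Nat.rfindOpt fun n =>
      (Encodable.decode (α := σ) n).bind fun s => bif c a s then some s else none).get hdom
      = f a := by
    simp only [Option.mem_def, Option.bind_eq_some_iff] at hn
    obtain ⟨s, -, hs⟩ := hn
    cases hcs : c a s with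
    | false => simp [hcs] at hs
    | true =>
      simp only [hcs, cond_true, Option.some.injEq] at hs
      rw [← hs]
      exact (h a s).1 hcs
  rw [← hval]
  exact Part.get_mem hdom

@[fun_prop] theorem computable_log2 : Computable fun n : ℕ => Nat.log 2 n := by
  refine computable_of_graph (c := fun n k =>
    decide ((n = 0 ∧ k = 0) ∨ (2 ^ k ≤ n ∧ n < 2 ^ (k + 1)))) (by fun_prop) fun n k => ?_
  rw [decide_eq_true_iff]
  constructor
  · rintro (⟨rfl, rfl⟩ | ⟨h1, h2⟩)
    · simp
    · exact (Nat.log_eq_of_pow_le_of_lt_pow h1 h2).symm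
  · rintro rfl
    rcases Nat.eq_zero_or_pos n with rfl | hn
    · simp
    · exact Or.inr ⟨Nat.pow_log_le_self 2 hn.ne', Nat.lt_pow_succ_log_self (by norm_num) n⟩

@[fun_prop] theorem computable_clog2 : Computable fun n : ℕ => Nat.clog 2 n := by
  refine computable_of_graph (c := fun n k =>
    decide (n ≤ 2 ^ k ∧ (k = 0 ∨ 2 ^ (k - 1) < n))) (by fun_prop) fun n k => ?_
  rw [decide_eq_true_iff]
  constructor
  · rintro ⟨h1, h2⟩
    refine le_antisymm ?_ ((Nat.clog_le_iff_le_pow (by norm_num)).2 h1)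
    rcases h2 with rfl | h2
    · simp
    · have := (Nat.lt_clog_iff_pow_lt (b := 2) (by norm_num)).2 h2
      omega
  · rintro rfl
    refine ⟨Nat.le_pow_clog (by norm_num) n, ?_⟩
    rcases Nat.eq_zero_or_pos (Nat.clog 2 n) with h | h
    · exact Or.inl h
    · exact Or.inr ((Nat.lt_clog_iff_pow_lt (by norm_num)).1 (by omega))

end Computability

/-! ### Distributions of the input and sequential simulation -/

namespace MPCAlgorithm

theorem inputWords_eq (x : List Bool) :
    inputWords x = (List.range x.length).map fun j => 2 * j + (x.getD j false).toNat := by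
  apply List.ext_getElem?
  intro i
  simp only [inputWords, List.getElem?_map, List.getElem?_zipIdx]
  by_cases h : i < x.length <;> simp [h]

theorem mem_inputWords {x : List Bool} {w : ℕ} :
    w ∈ inputWords x ↔ ∃ j < x.length, w = 2 * j + (x.getD j false).toNat := by
  simp only [inputWords_eq, List.mem_map, List.mem_range]
  exact ⟨fun ⟨j, h, e⟩ => ⟨j, h, e.symm⟩, fun ⟨j, h, e⟩ => ⟨j, h, e.symm⟩⟩

theorem toNat_le_one (b : Bool) : b.toNat ≤ 1 := by cases b <;> simp

theorem word_div (j : ℕ) (b : Bool) : (2 * j + b.toNat) / 2 = j := by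
  have := toNat_le_one b
  omega

theorem word_mod (j : ℕ) (b : Bool) : (2 * j + b.toNat) % 2 = b.toNat := by
  have := toNat_le_one b
  omega

theorem nodup_inputWords (x : List Bool) : (inputWords x).Nodup := by
  rw [inputWords_eq]
  refine List.Nodup.map_on (fun i _ j _ h => ?_) List.nodup_range
  have := congrArg (· / 2) h
  simpa only [word_div] using this

/-- The bits of the input can be read off from any permutation of its words. -/
theorem read_bits {x : List Bool} {m : List ℕ} (h : m.Perm (inputWords x)) :
    (List.range x.length).map (fun a => decide (2 * a + 1 ∈ m)) = x := by
  apply List.ext_getElem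
  · simp
  · intro i h1 h2
    simp only [List.getElem_map, List.getElem_range, h.mem_iff, mem_inputWords]
    rw [Bool.eq_iff_iff, decide_eq_true_iff]
    constructor
    · rintro ⟨j, hj, e⟩
      have hb := toNat_le_one (x.getD j false)
      have : i = j := by omega
      subst this
      have : (x.getD i false).toNat = 1 := by omega
      simpa [h2] using this
    · intro h
      exact ⟨i, h2, by simp [h2, h]⟩

end MPCAlgorithm

/-- Splitting a list according to the value of `f` and concatenating the parts gives a
permutation of the list. -/
theorem flatMap_filter_perm {α : Type*} (l : List α) (f : α → ℕ) (n : ℕ)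
    (h : ∀ a ∈ l, f a < n) :
    ((List.range n).flatMap fun i => l.filter fun a => f a = i).Perm l := by
  classical
  rw [List.perm_iff_count]
  intro a
  rw [List.count_flatMap]
  by_cases ha : a ∈ l
  · have hfa := h a ha
    have : (List.count a ∘ fun i => l.filter fun a => f a = i)
        = fun i => if i = f a then l.count a else 0 := by
      funext i
      simp only [Function.comp]
      split_ifs with hi
      · exact List.count_filter (by simp [hi])
      · exact List.count_eq_zero.2 (by simp [Ne.symm hi])
    rw [this, ← List.sum_toFinset _ List.nodup_range]
    simp [Finset.sum_ite_eq', hfa]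
  · rw [List.count_eq_zero.2 ha]
    simp only [List.sum_eq_zero_iff, List.mem_map, forall_exists_index, and_imp]
    rintro _ i - rfl
    exact List.count_eq_zero.2 (by simp [ha])

/-- The words with indices in a block of `cap` consecutive numbers. -/
theorem length_filter_inputWords_le (x : List Bool) (cap i : ℕ) (hcap : 0 < cap) :
    ((MPCAlgorithm.inputWords x).filter fun w => w / 2 / cap = i).length ≤ cap := by
  have hsub : ((MPCAlgorithm.inputWords x).filter fun w => w / 2 / cap = i) ⊆
      (List.range cap).map fun a => 2 * (i * cap + a) + (x.getD (i * cap + a) false).toNat := by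
    intro w hw
    simp only [List.mem_filter, MPCAlgorithm.mem_inputWords, decide_eq_true_eq] at hw
    obtain ⟨⟨j, -, rfl⟩, h⟩ := hw
    rw [MPCAlgorithm.word_div] at h
    simp only [List.mem_map, List.mem_range]
    refine ⟨j % cap, Nat.mod_lt _ hcap, ?_⟩
    have : i * cap + j % cap = j := by rw [← h]; exact Nat.div_add_mod' j cap
    rw [this]
  have := (List.subperm_of_subset ((MPCAlgorithm.nodup_inputWords x).filter _) hsub).length_le
  simpa using this

namespace MPCAlgorithm

/-- The distribution that gives each machine `capacity N` consecutive input bits. -/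
theorem isDistribution_filter (P : MPCAlgorithm) (x : List Bool)
    (hp : x.length ≤ P.machines x.length * P.capacity x.length)
    (hc : 0 < P.capacity x.length) :
    P.IsDistribution x fun i => (inputWords x).filter fun w => w / 2 / P.capacity x.length = i := by
  refine ⟨flatMap_filter_perm _ (fun w => w / 2 / P.capacity x.length) _ ?_, fun i _ =>
    length_filter_inputWords_le x _ i hc⟩
  intro w hw
  obtain ⟨j, hj, rfl⟩ := mem_inputWords.1 hw
  rw [word_div]
  exact Nat.div_lt_of_lt_mul (by rw [mul_comm]; omega)

/-- The memories of all machines after `r` rounds, as a list. -/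
def memoryList (P : MPCAlgorithm) (N : ℕ) (st : List (List ℕ)) (r : ℕ) : List (List ℕ) :=
  Nat.rec st (fun r st => (List.range (P.machines N)).map fun i =>
    (P.step N r i (st.getD i [])).1 ++ (List.range (P.machines N)).flatMap fun j =>
      ((P.step N r j (st.getD j [])).2.filter fun msg => msg.1 = i).map Prod.snd) r

theorem memoryList_eq (P : MPCAlgorithm) (N : ℕ) (mem : ℕ → List ℕ) (r : ℕ) :
    P.memoryList N ((List.range (P.machines N)).map mem) r =
      (List.range (P.machines N)).map (P.memory N mem r) := by
  induction r with
  | zero => rfl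
  | succ r ih =>
    change (List.range (P.machines N)).map (fun i =>
      (P.step N r i ((P.memoryList N _ r).getD i [])).1 ++ (List.range (P.machines N)).flatMap
        fun j => ((P.step N r j ((P.memoryList N _ r).getD j [])).2.filter
          fun msg => msg.1 = i).map Prod.snd) = _
    rw [ih]
    have hget : ∀ j < P.machines N,
        ((List.range (P.machines N)).map (P.memory N mem r)).getD j [] = P.memory N mem r j := by
      intro j hj
      simp [hj]
    refine List.map_congr_left fun i hi => ?_
    rw [List.mem_range] at hi
    rw [hget i hi]
    simp only [memory, received]
    congr 1
    refine List.flatMap_congr fun j hj => ?_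
    rw [hget j (List.mem_range.1 hj)]

theorem computable_inputWords : Computable inputWords := by
  have : Computable fun x : List Bool =>
      (List.range x.length).map fun j => 2 * j + (x.getD j false).toNat := by fun_prop
  exact this.of_eq fun x => (inputWords_eq x).symm

/-- A problem decided by an MPC algorithm is decidable. -/
theorem Decides.exists_computable {P : MPCAlgorithm} {A : Language Bool} (h : P.Decides A)
    (hp : ∀ N, N ≤ P.machines N * P.capacity N) (hc : ∀ N, 0 < P.capacity N)
    (hm : ∀ N, 0 < P.machines N) :
    ∃ dec : List Bool → Bool, Computable dec ∧ ∀ x, x ∈ A ↔ dec x = true := by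
  obtain ⟨c, hc'⟩ := h
  have h1 := P.computable_machines
  have h2 := P.computable_capacity
  have h3 := P.computable_rounds
  have h4 := P.computable_step
  have h5 := P.computable_answer
  have h6 := computable_inputWords
  refine ⟨fun x => P.answer x.length ((P.memoryList x.length
    ((List.range (P.machines x.length)).map fun i =>
      (inputWords x).filter fun w => w / 2 / P.capacity x.length = i)
    (P.rounds x.length)).getD 0 []), ?_, fun x => ?_⟩
  · unfold memoryList
    fun_prop
  · rw [(hc' x _ (P.isDistribution_filter x (hp _) (hc _))).2]
    beta_reduce
    rw [memoryList_eq]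
    simp [hm x.length]

end MPCAlgorithm

/-! ### Networks of cells -/

/-- A family of MPC algorithms all of whose components are computable as functions of the index,
too. -/
structure UniformlyComputable (Q : ℕ → MPCAlgorithm) : Prop where
  machines : Computable fun q : ℕ × ℕ => (Q q.1).machines q.2
  capacity : Computable fun q : ℕ × ℕ => (Q q.1).capacity q.2
  rounds : Computable fun q : ℕ × ℕ => (Q q.1).rounds q.2
  step : Computable fun q : ℕ × ℕ × ℕ × ℕ × List ℕ =>
    (Q q.1).step q.2.1 q.2.2.1 q.2.2.2.1 q.2.2.2.2
  answer : Computable fun q : ℕ × ℕ × List ℕ => (Q q.1).answer q.2.1 q.2.2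

/-- A uniform family of synchronous networks of Boolean cells. On inputs of size `N` there are
cells `0, …, size N - 1`, all of which are updated in each of `iters N` iterations. The new value
of cell `v` depends on the values of the cells listed in `deps N v`: it is computed by `loc N v`
if `kind N v = 0`, and by a query to oracle number `k` if `kind N v = k + 1`. -/
structure Network where
  size : ℕ → ℕ
  deps : ℕ → ℕ → List ℕ
  kind : ℕ → ℕ → ℕ
  loc : ℕ → ℕ → List Bool → Bool
  iters : ℕ → ℕ
  computable_size : Computable size
  computable_deps : Computable fun q : ℕ × ℕ => deps q.1 q.2
  computable_kind : Computable fun q : ℕ × ℕ => kind q.1 q.2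
  computable_loc : Computable fun q : ℕ × ℕ × List Bool => loc q.1 q.2.1 q.2.2
  computable_iters : Computable iters

namespace Network

open Classical in
/-- The value of cell `v` if the cells in `deps N v` have the values `bits`. -/
noncomputable def cell (G : Network) (O : ℕ → Language Bool) (N v : ℕ) (bits : List Bool) : Bool :=
  if G.kind N v = 0 then G.loc N v bits else decide (bits ∈ O (G.kind N v - 1))

/-- The value of cell `v` after `t` iterations on input `x`. Initially cell `j + 1` holds the
`j`-th input bit; the value of cell `0` is the output in the end. -/
noncomputable def val (G : Network) (O : ℕ → Language Bool) (x : List Bool) : ℕ → ℕ → Bool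
  | 0, v => (false :: x).getD v false
  | t + 1, v => G.cell O x.length v ((G.deps x.length v).map (G.val O x t))

end Network

/-- The branching factor `2 ^ (⌊log₂ (N + 2) / d⌋ + 1)`, of order `N ^ (1 / d)`. -/
def fan (d N : ℕ) : ℕ := 2 ^ (Nat.log 2 (N + 2) / d + 1)

theorem computable_fan (d : ℕ) : Computable (fan d) := by
  unfold fan
  fun_prop

/-- The one-machine algorithm without communication that applies `F` to its input. -/
def localAlg (cap : ℕ) (F : List Bool → Bool) (hF : Computable F) : MPCAlgorithm where
  machines _ := 1
  capacity _ := cap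
  rounds _ := 0
  step _ _ _ m := (m, [])
  answer k m := F ((List.range k).map fun a => decide (2 * a + 1 ∈ m))
  computable_machines := by fun_prop
  computable_capacity := by fun_prop
  computable_rounds := by fun_prop
  computable_step := by fun_prop
  computable_answer := by fun_prop

/-- A network, MPC algorithms for its oracles, and parameters with which it can be simulated by
an MPC algorithm: each cell gets `fan d N ^ J` machines, which suffice to make a copy of its value
for each of the at most `(N + 2) ^ e` arguments of each cell, and to answer a query. -/
structure Implementation where
  net : Network
  oracle : ℕ → Language Bool
  solver : ℕ → MPCAlgorithm
  d : ℕ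
  J : ℕ
  e : ℕ
  c : ℕ
  uniform : UniformlyComputable solver
  lt_size : ∀ N, N < net.size N
  deps_lt : ∀ N, ∀ v < net.size N, ∀ u ∈ net.deps N v, u < net.size N
  length_deps_le_fan : ∀ N, ∀ v < net.size N, net.kind N v = 0 →
    (net.deps N v).length ≤ fan d N
  length_deps_le : ∀ N, ∀ v < net.size N, (net.deps N v).length ≤ (N + 2) ^ e
  le_width : ∀ N, net.size N * (N + 2) ^ e ≤ fan d N ^ J
  machines_le : ∀ N, ∀ v < net.size N, ∀ k,
    (solver k).machines (net.deps N v).length ≤ fan d N ^ J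
  two_le : 2 ≤ c
  decides : ∀ k x mem, (solver k).IsDistribution x mem →
    (solver k).ObeysLimits c x.length mem ∧ (x ∈ oracle k ↔ (solver k).answer x.length
      ((solver k).memory x.length mem ((solver k).rounds x.length) 0) = true)
  machines_pos : ∀ k N, 0 < (solver k).machines N
  capacity_pos : ∀ k N, 0 < (solver k).capacity N
  le_mul : ∀ k N, N ≤ (solver k).machines N * (solver k).capacity N

namespace Implementation

variable (K : Implementation)

/-- The number of machines of a cell. -/
def width (N : ℕ) : ℕ := fan K.d N ^ K.J

/-- The number of arguments of a cell. -/
def arity (N v : ℕ) : ℕ := (K.net.deps N v).length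

/-- The algorithm that computes the value of a cell from its arguments. -/
def cellAlg (N v : ℕ) : MPCAlgorithm :=
  if K.net.kind N v = 0 then localAlg (fan K.d N) (K.net.loc N v) (by
    have := K.net.computable_loc
    fun_prop)
  else K.solver (K.net.kind N v - 1)

/-- The number of machines that the algorithm of cell `v` uses. -/
def cellMachines (N v : ℕ) : ℕ := (K.cellAlg N v).machines (K.arity N v)

/-- The size of the local memories in the algorithm of cell `v`. -/
def cellCapacity (N v : ℕ) : ℕ := (K.cellAlg N v).capacity (K.arity N v)

/-- The number of rounds of the algorithm of cell `v`. -/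
def cellRounds (N v : ℕ) : ℕ := (K.cellAlg N v).rounds (K.arity N v)

/-- What machine `c` of cell `v` does in round `r` of the algorithm of the cell. -/
def cellStep (N v r c : ℕ) (m : List ℕ) : List ℕ × List (ℕ × ℕ) :=
  (K.cellAlg N v).step (K.arity N v) r c m

/-- The answer of the algorithm of cell `v`. -/
def cellAnswer (N v : ℕ) (m : List ℕ) : Bool := (K.cellAlg N v).answer (K.arity N v) m

/-- The number of rounds reserved for the queries of one iteration. -/
def runs (N : ℕ) : ℕ := ((List.range (K.net.size N)).map (K.cellRounds N)).foldr max 0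

/-- Local memories suffice for the broadcast and for the algorithms of all cells. -/
def capacity (N : ℕ) : ℕ :=
  max (fan K.d N) (((List.range (K.net.size N)).map (K.cellCapacity N)).foldr max 0)

/-- The number of rounds of one iteration: broadcasting the values, sending them to where they are
needed, answering the queries, and evaluating the answers. -/
def period (N : ℕ) : ℕ := K.J + 1 + K.runs N + 1

/-- Each input bit is sent to the first machine of its cell; the first machines of the other cells
store `0`. -/
def initStep (N i : ℕ) (m : List ℕ) : List ℕ × List (ℕ × ℕ) :=
  (if i % K.width N = 0 ∧ (i / K.width N = 0 ∨ N < i / K.width N) then [0] else [],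
    m.map fun w => ((w / 2 + 1) * K.width N, w % 2))

/-- A machine sends its words to `fan d N` machines of the same cell. -/
def broadcastStep (N i : ℕ) (m : List ℕ) : List ℕ × List (ℕ × ℕ) :=
  ([], m.flatMap fun w => (List.range (fan K.d N)).map fun a =>
    (i / K.width N * K.width N + (i % K.width N * fan K.d N + a), w))

/-- Machine number `v * (N + 2) ^ e + a` of cell `u` delivers the value of `u` to cell `v`, if `u`
is its `a`-th argument. -/
def dispatchStep (N i : ℕ) (m : List ℕ) : List ℕ × List (ℕ × ℕ) :=
  ([], if i % K.width N / (N + 2) ^ K.e < K.net.size N ∧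
      i % K.width N % (N + 2) ^ K.e < K.arity N (i % K.width N / (N + 2) ^ K.e) ∧
      (K.net.deps N (i % K.width N / (N + 2) ^ K.e)).getD (i % K.width N % (N + 2) ^ K.e) 0 =
        i / K.width N then
    [(i % K.width N / (N + 2) ^ K.e * K.width N + i % K.width N % (N + 2) ^ K.e /
      K.cellCapacity N (i % K.width N / (N + 2) ^ K.e),
      2 * (i % K.width N % (N + 2) ^ K.e) + m.headD 0)] else [])

/-- The machines of each cell execute round `r` of its algorithm. -/
def runStep (N r i : ℕ) (m : List ℕ) : List ℕ × List (ℕ × ℕ) :=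
  if r < K.cellRounds N (i / K.width N) ∧ i % K.width N < K.cellMachines N (i / K.width N) then
    ((K.cellStep N (i / K.width N) r (i % K.width N) m).1,
      ((K.cellStep N (i / K.width N) r (i % K.width N) m).2.filter
        fun msg => msg.1 < K.cellMachines N (i / K.width N)).map
        fun msg => (i / K.width N * K.width N + msg.1, msg.2))
  else (m, [])

/-- The first machine of each cell stores the value of the cell. -/
def finishStep (N i : ℕ) (m : List ℕ) : List ℕ × List (ℕ × ℕ) :=
  (if i % K.width N = 0 then
    [(K.cellAnswer N (i / K.width N) m).toNat] else [], [])

/-- The rounds of the simulation. Machine `v * width N + c` is machine `c` of cell `v`; after the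
initial round, the phases of the iterations follow in periods of length `period N`. -/
def step (N r i : ℕ) (m : List ℕ) : List ℕ × List (ℕ × ℕ) :=
  if r = 0 then K.initStep N i m
  else if (r - 1) % K.period N < K.J then K.broadcastStep N i m
  else if (r - 1) % K.period N = K.J then K.dispatchStep N i m
  else if (r - 1) % K.period N < K.J + 1 + K.runs N then
    K.runStep N ((r - 1) % K.period N - (K.J + 1)) i m
  else K.finishStep N i m

theorem computable_width : Computable K.width := by
  have := computable_fan K.d
  unfold width
  fun_prop

theorem computable_arity : Computable fun q : ℕ × ℕ => K.arity q.1 q.2 := by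
  have := K.net.computable_deps
  unfold arity
  fun_prop

theorem computable_cellMachines : Computable fun q : ℕ × ℕ => K.cellMachines q.1 q.2 := by
  have h1 := K.net.computable_kind
  have h2 := K.computable_arity
  have h3 := K.uniform.machines.comp
    (g := fun q : ℕ × ℕ => (K.net.kind q.1 q.2 - 1, K.arity q.1 q.2)) (by fun_prop)
  refine (computable_ite (c := fun q : ℕ × ℕ => K.net.kind q.1 q.2 = 0)
    (f := fun q => 1) (by fun_prop) (by fun_prop) h3).of_eq fun q => ?_
  unfold cellMachines cellAlg
  split_ifs <;> rfl

theorem computable_cellCapacity : Computable fun q : ℕ × ℕ => K.cellCapacity q.1 q.2 := by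
  have h1 := K.net.computable_kind
  have h2 := K.computable_arity
  have h4 := computable_fan K.d
  have h3 := K.uniform.capacity.comp
    (g := fun q : ℕ × ℕ => (K.net.kind q.1 q.2 - 1, K.arity q.1 q.2)) (by fun_prop)
  refine (computable_ite (c := fun q : ℕ × ℕ => K.net.kind q.1 q.2 = 0)
    (f := fun q => fan K.d q.1) (by fun_prop) (by fun_prop) h3).of_eq fun q => ?_
  unfold cellCapacity cellAlg
  split_ifs <;> rfl

theorem computable_cellRounds : Computable fun q : ℕ × ℕ => K.cellRounds q.1 q.2 := by
  have h1 := K.net.computable_kind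
  have h2 := K.computable_arity
  have h3 := K.uniform.rounds.comp
    (g := fun q : ℕ × ℕ => (K.net.kind q.1 q.2 - 1, K.arity q.1 q.2)) (by fun_prop)
  refine (computable_ite (c := fun q : ℕ × ℕ => K.net.kind q.1 q.2 = 0)
    (f := fun q => 0) (by fun_prop) (by fun_prop) h3).of_eq fun q => ?_
  unfold cellRounds cellAlg
  split_ifs <;> rfl

theorem computable_cellStep : Computable fun q : ℕ × ℕ × ℕ × ℕ × List ℕ =>
    K.cellStep q.1 q.2.1 q.2.2.1 q.2.2.2.1 q.2.2.2.2 := by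
  have h1 := K.net.computable_kind
  have h2 := K.computable_arity
  have h3 := K.uniform.step.comp (g := fun q : ℕ × ℕ × ℕ × ℕ × List ℕ =>
    (K.net.kind q.1 q.2.1 - 1, K.arity q.1 q.2.1, q.2.2.1, q.2.2.2.1, q.2.2.2.2)) (by fun_prop)
  refine (computable_ite (c := fun q : ℕ × ℕ × ℕ × ℕ × List ℕ => K.net.kind q.1 q.2.1 = 0)
    (f := fun q => (q.2.2.2.2, [])) (by fun_prop) (by fun_prop) h3).of_eq fun q => ?_
  unfold cellStep cellAlg
  split_ifs <;> rfl

theorem computable_cellAnswer :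
    Computable fun q : ℕ × ℕ × List ℕ => K.cellAnswer q.1 q.2.1 q.2.2 := by
  have h1 := K.net.computable_kind
  have h2 := K.computable_arity
  have h4 := K.net.computable_loc
  have h3 := K.uniform.answer.comp (g := fun q : ℕ × ℕ × List ℕ =>
    (K.net.kind q.1 q.2.1 - 1, K.arity q.1 q.2.1, q.2.2)) (by fun_prop)
  refine (computable_ite (c := fun q : ℕ × ℕ × List ℕ => K.net.kind q.1 q.2.1 = 0)
    (f := fun q => K.net.loc q.1 q.2.1
      ((List.range (K.arity q.1 q.2.1)).map fun a => decide (2 * a + 1 ∈ q.2.2)))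
    (by fun_prop) (by fun_prop) h3).of_eq fun q => ?_
  unfold cellAnswer cellAlg
  split_ifs <;> rfl

theorem computable_runs : Computable K.runs := by
  have h1 := K.computable_cellRounds
  have h2 := K.net.computable_size
  unfold runs
  fun_prop

theorem computable_capacity : Computable K.capacity := by
  have h1 := K.computable_cellCapacity
  have h2 := K.net.computable_size
  have h4 := computable_fan K.d
  unfold capacity
  fun_prop

theorem computable_period : Computable K.period := by
  have h1 := K.computable_runs
  unfold period
  fun_prop

theorem computable_step : Computable fun q : ℕ × ℕ × ℕ × List ℕ =>
    K.step q.1 q.2.1 q.2.2.1 q.2.2.2 := by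
  have h1 := K.computable_period
  have h2 := K.computable_runs
  have h3 := K.computable_width
  have h4 := K.computable_arity
  have h5 := K.computable_cellMachines
  have h6 := K.computable_cellCapacity
  have h7 := K.computable_cellRounds
  have h8 := K.computable_cellStep
  have h9 := K.computable_cellAnswer
  have h10 := K.net.computable_size
  have h11 := K.net.computable_deps
  have h12 := computable_fan K.d
  have hi : Computable fun q : ℕ × ℕ × List ℕ => K.initStep q.1 q.2.1 q.2.2 := by
    unfold initStep
    fun_prop
  have hb : Computable fun q : ℕ × ℕ × List ℕ => K.broadcastStep q.1 q.2.1 q.2.2 := by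
    unfold broadcastStep
    fun_prop
  have hd : Computable fun q : ℕ × ℕ × List ℕ => K.dispatchStep q.1 q.2.1 q.2.2 := by
    unfold dispatchStep
    fun_prop
  have hr : Computable fun q : ℕ × ℕ × ℕ × List ℕ => K.runStep q.1 q.2.1 q.2.2.1 q.2.2.2 := by
    unfold runStep
    fun_prop
  have hf : Computable fun q : ℕ × ℕ × List ℕ => K.finishStep q.1 q.2.1 q.2.2 := by
    unfold finishStep
    fun_prop
  unfold step
  fun_prop

/-- The MPC algorithm that simulates the network. -/
def alg : MPCAlgorithm where
  machines N := K.net.size N * K.width N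
  capacity := K.capacity
  rounds N := K.net.iters N * K.period N + 1
  step := K.step
  answer _ m := decide (m.headD 0 = 1)
  computable_machines := by
    have h1 := K.net.computable_size
    have h2 := K.computable_width
    fun_prop
  computable_capacity := K.computable_capacity
  computable_rounds := by
    have h1 := K.net.computable_iters
    have h2 := K.computable_period
    fun_prop
  computable_step := K.computable_step
  computable_answer := by fun_prop

end Implementation

/-! ### Exchanging messages -/

theorem flatMap_range_eq_single {α : Type*} {n j₀ : ℕ} {g : ℕ → List α} (hj : j₀ < n)
    (h : ∀ j < n, j ≠ j₀ → g j = []) : (List.range n).flatMap g = g j₀ := by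
  induction n with
  | zero => omega
  | succ n ih =>
    rw [List.range_succ, List.flatMap_append]
    rcases Nat.lt_succ_iff_lt_or_eq.1 hj with hj' | rfl
    · rw [ih hj' fun j hjn => h j (by omega)]
      simp [h n (by omega) (by omega)]
    · have : (List.range j₀).flatMap g = [] := by
        rw [List.flatMap_eq_nil_iff]
        intro j hj
        rw [List.mem_range] at hj
        exact h j (by omega) (by omega)
      simp [this]

theorem flatMap_range_mul {α : Type*} (S W : ℕ) (g : ℕ → List α) :
    (List.range (S * W)).flatMap g =
      (List.range S).flatMap fun v => (List.range W).flatMap fun c => g (v * W + c) := by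
  induction S with
  | zero => simp
  | succ S ih =>
    rw [Nat.succ_mul, List.range_add, List.flatMap_append, ih, List.range_succ]
    simp [List.flatMap_map]

theorem flatMap_range_of_le {α : Type*} {M W : ℕ} {g : ℕ → List α} (h : M ≤ W)
    (hg : ∀ c, M ≤ c → g c = []) : (List.range W).flatMap g = (List.range M).flatMap g := by
  obtain ⟨k, rfl⟩ := Nat.exists_eq_add_of_le h
  rw [List.range_add, List.flatMap_append, List.flatMap_map]
  simp [hg]

theorem mul_add_div_of_lt {v W c : ℕ} (hc : c < W) : (v * W + c) / W = v := by
  rw [mul_comm, Nat.mul_add_div (by omega), Nat.div_eq_of_lt hc, add_zero]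

theorem mul_add_mod_of_lt {v W c : ℕ} (hc : c < W) : (v * W + c) % W = c := by
  rw [mul_comm, Nat.mul_add_mod, Nat.mod_eq_of_lt hc]

theorem mul_add_lt {v S W c : ℕ} (hv : v < S) (hc : c < W) : v * W + c < S * W := by
  calc v * W + c < v * W + W := by omega
    _ = (v + 1) * W := by ring
    _ ≤ S * W := Nat.mul_le_mul_right _ hv

/-- Messages with consecutive addresses: at most one reaches a given machine. -/
theorem filter_consecutive (base n i w : ℕ) :
    ((((List.range n).map fun a => (base + a, w)).filter fun msg => msg.1 = i).map Prod.snd) =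
      if base ≤ i ∧ i < base + n then [w] else [] := by
  induction n with
  | zero =>
    rw [if_neg (by omega)]
    simp
  | succ n ih =>
    rw [List.range_succ, List.map_append, List.filter_append, List.map_append, ih]
    by_cases h : base + n = i
    · subst h
      simp
    · by_cases h' : base ≤ i ∧ i < base + n
      · rw [if_pos h', if_pos (by omega)]
        simp [h]
      · rw [if_neg h', if_neg (by omega)]
        simp [h]

/-- The memory of machine `i` after one round in which `p` machines with memories `mem` act as
described by `st`. -/
def exchange (st : ℕ → List ℕ → List ℕ × List (ℕ × ℕ)) (p : ℕ) (mem : ℕ → List ℕ) (i : ℕ) :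
    List ℕ :=
  (st i (mem i)).1 ++ (List.range p).flatMap fun j =>
    ((st j (mem j)).2.filter fun msg => msg.1 = i).map Prod.snd

theorem MPCAlgorithm.memory_succ (P : MPCAlgorithm) (N : ℕ) (mem : ℕ → List ℕ) (r : ℕ) :
    P.memory N mem (r + 1) = exchange (P.step N r) (P.machines N) (P.memory N mem r) := rfl

theorem le_foldr_max {l : List ℕ} {a : ℕ} (h : a ∈ l) : a ≤ l.foldr max 0 := by
  induction l with
  | nil => simp at h
  | cons b l ih =>
    rcases List.mem_cons.1 h with rfl | h
    · exact le_max_left _ _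
    · exact (ih h).trans (le_max_right _ _)

theorem fan_pos (d N : ℕ) : 0 < fan d N := by
  unfold fan
  positivity

namespace Implementation

variable (K : Implementation)

theorem width_pos (N : ℕ) : 0 < K.width N := pow_pos (fan_pos _ _) _

theorem cellMachines_pos (N v : ℕ) : 0 < K.cellMachines N v := by
  unfold cellMachines cellAlg
  split_ifs
  · exact Nat.one_pos
  · exact K.machines_pos _ _

theorem cellCapacity_pos (N v : ℕ) : 0 < K.cellCapacity N v := by
  unfold cellCapacity cellAlg
  split_ifs
  · exact fan_pos _ _
  · exact K.capacity_pos _ _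

theorem cellMachines_le {N v : ℕ} (hv : v < K.net.size N) : K.cellMachines N v ≤ K.width N := by
  unfold cellMachines cellAlg
  split_ifs
  · exact K.width_pos N
  · exact K.machines_le N v hv _

theorem arity_le_mul {N v : ℕ} (hv : v < K.net.size N) :
    K.arity N v ≤ K.cellMachines N v * K.cellCapacity N v := by
  unfold cellMachines cellCapacity cellAlg
  split_ifs with h
  · exact (K.length_deps_le_fan N v hv h).trans (Nat.one_mul _).ge
  · exact K.le_mul _ _

theorem cellCapacity_le {N v : ℕ} (hv : v < K.net.size N) : K.cellCapacity N v ≤ K.capacity N :=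
  le_max_of_le_right (le_foldr_max (List.mem_map_of_mem (List.mem_range.2 hv)))

theorem fan_le_capacity (N : ℕ) : fan K.d N ≤ K.capacity N := le_max_left _ _

theorem cellRounds_le {N v : ℕ} (hv : v < K.net.size N) : K.cellRounds N v ≤ K.runs N :=
  le_foldr_max (List.mem_map_of_mem (List.mem_range.2 hv))

/-- `mem` is a distribution of the arguments `bits` of cell `v` among its machines. -/
def IsCellDistribution (N v : ℕ) (bits : List Bool) (mem : ℕ → List ℕ) : Prop :=
  ((List.range (K.cellMachines N v)).flatMap mem).Perm (MPCAlgorithm.inputWords bits) ∧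
    ∀ i < K.cellMachines N v, (mem i).length ≤ K.cellCapacity N v

/-- Each cell is evaluated correctly by its algorithm. -/
theorem cellAlg_spec {N v : ℕ} (hv : v < K.net.size N) {bits : List Bool} {mem : ℕ → List ℕ}
    (hb : bits.length = K.arity N v) (hmem : K.IsCellDistribution N v bits mem) :
    (K.cellAlg N v).ObeysLimits K.c (K.arity N v) mem ∧
      K.cellAnswer N v ((K.cellAlg N v).memory (K.arity N v) mem (K.cellRounds N v) 0) =
        K.net.cell K.oracle N v bits := by
  by_cases h : K.net.kind N v = 0
  · have hlen := K.length_deps_le_fan N v hv h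
    have hdist := hmem
    unfold IsCellDistribution cellMachines cellCapacity at hdist
    unfold cellAnswer cellRounds Network.cell
    rw [if_pos h]
    unfold cellAlg at *
    rw [if_pos h] at hdist ⊢
    simp only [localAlg, List.range_one, List.flatMap_cons, List.flatMap_nil,
      List.append_nil] at hdist
    refine ⟨⟨fun r hr i hi => ?_, fun r hr => ?_⟩, ?_⟩
    · have hr0 : r = 0 := by simpa [localAlg] using hr
      have hi0 : i = 0 := by simpa [localAlg] using hi
      subst hr0 hi0
      refine ⟨hdist.2 0 (by simp), fun w hw => ?_⟩
      obtain ⟨j, hj, rfl⟩ := MPCAlgorithm.mem_inputWords.1 (hdist.1.mem_iff.1 hw)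
      have h1 := MPCAlgorithm.toNat_le_one (bits.getD j false)
      have h2 : (K.arity N v + 2) ^ 2 ≤ (K.arity N v + 2) ^ K.c :=
        Nat.pow_le_pow_right (by omega) K.two_le
      have h3 : 2 * j + 1 < (K.arity N v + 2) ^ 2 := by nlinarith
      omega
    · simp [localAlg] at hr
    · simp only [localAlg, MPCAlgorithm.memory]
      rw [← hb, MPCAlgorithm.read_bits hdist.1]
  · have hdist := hmem
    unfold IsCellDistribution cellMachines cellCapacity at hdist
    unfold cellAnswer cellRounds Network.cell
    rw [if_neg h]
    unfold cellAlg at *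
    rw [if_neg h] at hdist ⊢
    rw [← hb] at hdist ⊢
    have := K.decides (K.net.kind N v - 1) bits mem hdist
    refine ⟨this.1, ?_⟩
    classical
    rw [Bool.eq_iff_iff, decide_eq_true_iff]
    exact this.2.symm

/-- In the course of the broadcast of the values `b`, they are known to the first `D ^ j` machines
of each cell, where `D` is the branching factor. -/
def Broadcasting (N j : ℕ) (b : ℕ → Bool) (mem : ℕ → List ℕ) : Prop :=
  ∀ v < K.net.size N, ∀ c < K.width N,
    mem (v * K.width N + c) = if c < fan K.d N ^ j then [(b v).toNat] else []

/-- The algorithms of the cells, run on the arguments given by the values `b`, have completed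
`r` rounds (or all their rounds). -/
def Running (N r : ℕ) (b : ℕ → Bool) (mem : ℕ → List ℕ) : Prop :=
  ∀ v < K.net.size N, ∃ m₀, K.IsCellDistribution N v ((K.net.deps N v).map b) m₀ ∧
    ∀ c < K.width N, mem (v * K.width N + c) = if c < K.cellMachines N v then
      (K.cellAlg N v).memory (K.arity N v) m₀ (min r (K.cellRounds N v)) c else []

theorem machine_cases {S W j : ℕ} (hW : 0 < W) (hj : j < S * W) :
    ∃ v < S, ∃ c < W, j = v * W + c :=
  ⟨j / W, Nat.div_lt_of_lt_mul (by rwa [mul_comm] at hj), j % W, Nat.mod_lt _ hW,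
    (Nat.div_add_mod' j W).symm⟩

theorem broadcasting_succ {N j : ℕ} {b : ℕ → Bool} {mem : ℕ → List ℕ} (hj : j < K.J)
    (h : K.Broadcasting N j b mem) :
    K.Broadcasting N (j + 1) b
      (exchange (K.broadcastStep N) (K.net.size N * K.width N) mem) := by
  intro v hv c hc
  have hD := fan_pos K.d N
  have hDW : fan K.d N ^ (j + 1) ≤ K.width N := Nat.pow_le_pow_right hD hj
  -- the messages that a given machine sends to the machine under consideration
  have hsend : ∀ v' < K.net.size N, ∀ c' < K.width N,
      (((K.broadcastStep N (v' * K.width N + c') (mem (v' * K.width N + c'))).2.filter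
        fun msg => msg.1 = v * K.width N + c).map Prod.snd) =
      if v' = v ∧ c' = c / fan K.d N ∧ c < fan K.d N ^ (j + 1) then [(b v).toNat] else [] := by
    intro v' hv' c' hc'
    have e := h v' hv' c' hc'
    simp only [broadcastStep, e, mul_add_div_of_lt hc', mul_add_mod_of_lt hc']
    by_cases hcj : c' < fan K.d N ^ j
    · have hlt : c' * fan K.d N + fan K.d N ≤ fan K.d N ^ (j + 1) := by
        rw [pow_succ]
        nlinarith
      simp only [hcj, if_true, List.flatMap_cons, List.flatMap_nil, List.append_nil]
      simp only [← Nat.add_assoc]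
      rw [filter_consecutive]
      by_cases hcond : v' * K.width N + c' * fan K.d N ≤ v * K.width N + c ∧
          v * K.width N + c < v' * K.width N + c' * fan K.d N + fan K.d N
      · obtain ⟨a, ha⟩ := Nat.exists_eq_add_of_le hcond.1
        have haD : a < fan K.d N := by omega
        have hin : c' * fan K.d N + a < K.width N := by omega
        have hv2 : v = v' := by
          rw [← mul_add_div_of_lt (v := v) hc, ha, add_assoc, mul_add_div_of_lt hin]
        have hc2 : c = c' * fan K.d N + a := by
          rw [← mul_add_mod_of_lt (v := v) hc, ha, add_assoc, mul_add_mod_of_lt hin]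
        have hc3 : c' = c / fan K.d N := by rw [hc2, mul_add_div_of_lt haD]
        rw [if_pos hcond, if_pos ⟨hv2.symm, hc3, by omega⟩, hv2]
      · rw [if_neg hcond, if_neg]
        rintro ⟨rfl, rfl, -⟩
        apply hcond
        have h1 := Nat.div_add_mod' c (fan K.d N)
        have h2 := Nat.mod_lt c hD
        omega
    · rw [if_neg hcj]
      rw [if_neg]
      · simp
      · rintro ⟨-, rfl, hlt⟩
        apply hcj
        rw [pow_succ] at hlt
        exact Nat.div_lt_of_lt_mul (by rwa [mul_comm] at hlt)
  unfold exchange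
  have hkeep : (K.broadcastStep N (v * K.width N + c) (mem (v * K.width N + c))).1 = [] := rfl
  rw [hkeep, List.nil_append]
  by_cases hcj : c < fan K.d N ^ (j + 1)
  · have hcW : c / fan K.d N < K.width N := (Nat.div_le_self _ _).trans_lt hc
    rw [flatMap_range_eq_single (mul_add_lt hv hcW), hsend v hv _ hcW]
    · simp [hcj]
    · intro i hi hne
      obtain ⟨v', hv', c', hc', rfl⟩ := machine_cases (K.width_pos N) hi
      rw [hsend v' hv' c' hc', if_neg]
      rintro ⟨rfl, rfl, -⟩
      exact hne rfl
  · rw [if_neg hcj, List.flatMap_eq_nil_iff]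
    intro i hi
    obtain ⟨v', hv', c', hc', rfl⟩ := machine_cases (K.width_pos N) (List.mem_range.1 hi)
    rw [hsend v' hv' c' hc', if_neg]
    exact fun h => hcj h.2.2

/-! ### Delivering the arguments of the cells -/

/-- After the dispatch, the machines of each cell hold a distribution of its arguments. -/
theorem running_zero {N : ℕ} {b : ℕ → Bool} {mem : ℕ → List ℕ}
    (h : K.Broadcasting N K.J b mem) :
    K.Running N 0 b (exchange (K.dispatchStep N) (K.net.size N * K.width N) mem) := by
  have hmem : ∀ u < K.net.size N, ∀ c < K.width N,
      mem (u * K.width N + c) = [(b u).toNat] := by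
    intro u hu c hc
    rw [h u hu c hc]
    exact if_pos hc
  have hport : 0 < (N + 2) ^ K.e := by positivity
  have hS : K.net.size N * (N + 2) ^ K.e ≤ K.width N := K.le_width N
  intro v hv
  have hM := K.cellMachines_le hv
  have hcap := K.cellCapacity_pos N v
  have harity : K.arity N v ≤ (N + 2) ^ K.e := K.length_deps_le N v hv
  set bits := (K.net.deps N v).map b with hbits
  have hblen : bits.length = K.arity N v := by simp [hbits, arity]
  -- the message sent by machine `v' * (N + 2) ^ e + a` of cell `u`
  have hsend : ∀ u < K.net.size N, ∀ v' a, a < (N + 2) ^ K.e →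
      v' * (N + 2) ^ K.e + a < K.width N →
      (K.dispatchStep N (u * K.width N + (v' * (N + 2) ^ K.e + a))
        (mem (u * K.width N + (v' * (N + 2) ^ K.e + a)))).2 =
      if v' < K.net.size N ∧ a < K.arity N v' ∧ (K.net.deps N v').getD a 0 = u then
        [(v' * K.width N + a / K.cellCapacity N v', 2 * a + (b u).toNat)] else [] := by
    intro u hu v' a ha hc
    simp only [dispatchStep, hmem u hu _ hc, mul_add_div_of_lt hc, mul_add_mod_of_lt hc,
      mul_add_div_of_lt ha, mul_add_mod_of_lt ha, List.headD_cons]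
  -- such a message is destined for a machine of cell `v` if and only if `v' = v`
  have htarget : ∀ v' < K.net.size N, ∀ a < K.arity N v', ∀ c < K.width N,
      v' * K.width N + a / K.cellCapacity N v' = v * K.width N + c →
      v' = v ∧ a / K.cellCapacity N v' = c := by
    intro v' hv' a ha c hc e
    have hlt : a / K.cellCapacity N v' < K.width N := by
      refine lt_of_lt_of_le (Nat.div_lt_of_lt_mul ?_) (K.cellMachines_le hv')
      rw [mul_comm]
      exact ha.trans_le (K.arity_le_mul hv')
    constructor
    · rw [← mul_add_div_of_lt (v := v') hlt, e, mul_add_div_of_lt hc]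
    · rw [← mul_add_mod_of_lt (v := v') hlt, e, mul_add_mod_of_lt hc]
  set mem' := exchange (K.dispatchStep N) (K.net.size N * K.width N) mem with hmem'
  have hmem'_eq : ∀ i, mem' i = (List.range (K.net.size N * K.width N)).flatMap fun j =>
      ((K.dispatchStep N j (mem j)).2.filter fun msg => msg.1 = i).map Prod.snd := fun i => rfl
  have hdecomp : ∀ j < K.net.size N * K.width N, ∃ u < K.net.size N, ∃ v' a, a < (N + 2) ^ K.e ∧
      v' * (N + 2) ^ K.e + a < K.width N ∧ j = u * K.width N + (v' * (N + 2) ^ K.e + a) := by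
    intro j hj
    obtain ⟨u, hu, c, hc, rfl⟩ := machine_cases (K.width_pos N) hj
    exact ⟨u, hu, c / (N + 2) ^ K.e, c % (N + 2) ^ K.e, Nat.mod_lt _ hport,
      by rwa [Nat.div_add_mod'], by rw [Nat.div_add_mod']⟩
  have hword : ∀ a < K.arity N v, (b ((K.net.deps N v).getD a 0)).toNat
      = (bits.getD a false).toNat := by
    intro a ha
    have ha' : a < (K.net.deps N v).length := ha
    simp [hbits, ha']
  -- what a machine receives from another one
  have hrecv : ∀ c < K.width N, ∀ j < K.net.size N * K.width N, ∀ w,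
      w ∈ ((K.dispatchStep N j (mem j)).2.filter fun msg => msg.1 = v * K.width N + c).map
        Prod.snd ↔ ∃ a < K.arity N v, a / K.cellCapacity N v = c ∧
          j = (K.net.deps N v).getD a 0 * K.width N + (v * (N + 2) ^ K.e + a) ∧
          w = 2 * a + (bits.getD a false).toNat := by
    intro c hc j hj w
    obtain ⟨u, hu, v', a, ha, hlt, rfl⟩ := hdecomp j hj
    rw [hsend u hu v' a ha hlt]
    constructor
    · intro hw
      split_ifs at hw with hcond
      · obtain ⟨hv', ha', rfl⟩ := hcond
        simp only [List.mem_map, List.mem_filter, List.mem_singleton, decide_eq_true_eq] at hw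
        obtain ⟨msg, ⟨rfl, hmsg⟩, rfl⟩ := hw
        obtain ⟨rfl, rfl⟩ := htarget v' hv' a ha' c hc hmsg
        exact ⟨a, ha', rfl, rfl, by rw [hword a ha']⟩
      · simp at hw
    · rintro ⟨a', ha', rfl, hj', rfl⟩
      have hlt' : v * (N + 2) ^ K.e + a' < K.width N :=
        (mul_add_lt hv (ha'.trans_le harity)).trans_le hS
      have hu' : u = (K.net.deps N v).getD a' 0 := by
        rw [← mul_add_div_of_lt (v := u) hlt, hj', mul_add_div_of_lt hlt']
      have hc' : v' * (N + 2) ^ K.e + a = v * (N + 2) ^ K.e + a' := by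
        rw [← mul_add_mod_of_lt (v := u) hlt, hj', mul_add_mod_of_lt hlt']
      have hv' : v' = v := by
        rw [← mul_add_div_of_lt (v := v') ha, hc', mul_add_div_of_lt (ha'.trans_le harity)]
      have haa : a = a' := by
        rw [← mul_add_mod_of_lt (v := v') ha, hc', mul_add_mod_of_lt (ha'.trans_le harity)]
      subst hv' haa
      rw [if_pos ⟨hv, ha', hu'.symm⟩]
      rw [← hword a ha', ← hu']
      simp
  have hmem'_mem : ∀ c < K.width N, ∀ w, w ∈ mem' (v * K.width N + c) ↔
      ∃ a < K.arity N v, a / K.cellCapacity N v = c ∧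
        w = 2 * a + (bits.getD a false).toNat := by
    intro c hc w
    rw [hmem'_eq, List.mem_flatMap]
    constructor
    · rintro ⟨j, hj, hw⟩
      obtain ⟨a, ha, h1, -, h3⟩ := (hrecv c hc j (List.mem_range.1 hj) w).1 hw
      exact ⟨a, ha, h1, h3⟩
    · rintro ⟨a, ha, h1, h3⟩
      have hu : (K.net.deps N v).getD a 0 < K.net.size N := by
        have ha' : a < (K.net.deps N v).length := ha
        rw [List.getD_eq_getElem _ _ ha']
        exact K.deps_lt N v hv _ (List.getElem_mem ha')
      have hj := mul_add_lt hu ((mul_add_lt hv (ha.trans_le harity)).trans_le hS)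
      exact ⟨_, List.mem_range.2 hj, (hrecv c hc _ hj w).2 ⟨a, ha, h1, rfl, h3⟩⟩
  have hnodup : ∀ c < K.width N, (mem' (v * K.width N + c)).Nodup := by
    intro c hc
    rw [hmem'_eq, List.nodup_flatMap]
    constructor
    · intro j hj
      obtain ⟨u, hu, v', a, ha, hlt, rfl⟩ := hdecomp j (List.mem_range.1 hj)
      rw [hsend u hu v' a ha hlt]
      refine List.Nodup.map_on ?_ (List.Nodup.filter _ ?_)
      · intro x hx y hy _
        split_ifs at hx hy with hcond
        · simp only [List.mem_filter, List.mem_singleton] at hx hy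
          rw [hx.1, hy.1]
        · simp at hx
      · split_ifs <;> simp
    · refine List.Nodup.pairwise_of_forall_ne List.nodup_range fun i hi j hj hij => ?_
      rw [Function.onFun, List.disjoint_left]
      intro w hw1 hw2
      obtain ⟨a, ha, -, rfl, h1⟩ := (hrecv c hc i (List.mem_range.1 hi) w).1 hw1
      obtain ⟨a', ha', -, rfl, h2⟩ := (hrecv c hc j (List.mem_range.1 hj) w).1 hw2
      have h3 := MPCAlgorithm.toNat_le_one (bits.getD a false)
      have h4 := MPCAlgorithm.toNat_le_one (bits.getD a' false)
      have : a = a' := by omega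
      subst this
      exact hij rfl
  have hperm : ∀ c < K.width N, (mem' (v * K.width N + c)).Perm
      ((MPCAlgorithm.inputWords bits).filter fun w => w / 2 / K.cellCapacity N v = c) := by
    intro c hc
    rw [List.perm_ext_iff_of_nodup (hnodup c hc) ((MPCAlgorithm.nodup_inputWords _).filter _)]
    intro w
    rw [hmem'_mem c hc, List.mem_filter, MPCAlgorithm.mem_inputWords, decide_eq_true_iff, hblen]
    constructor
    · rintro ⟨a, ha, h1, rfl⟩
      exact ⟨⟨a, ha, rfl⟩, by rw [MPCAlgorithm.word_div, h1]⟩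
    · rintro ⟨⟨a, ha, rfl⟩, h1⟩
      rw [MPCAlgorithm.word_div] at h1
      exact ⟨a, ha, h1, rfl⟩
  refine ⟨fun c => mem' (v * K.width N + c), ⟨?_, ?_⟩, ?_⟩
  · refine (List.Perm.flatMap_left (List.range (K.cellMachines N v)) fun c hc =>
      hperm c ((List.mem_range.1 hc).trans_le hM)).trans ?_
    refine flatMap_filter_perm _ (fun w => w / 2 / K.cellCapacity N v) _ fun w hw => ?_
    obtain ⟨a, ha, rfl⟩ := MPCAlgorithm.mem_inputWords.1 hw
    rw [MPCAlgorithm.word_div]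
    refine Nat.div_lt_of_lt_mul ?_
    rw [mul_comm]
    exact (hblen ▸ ha).trans_le (K.arity_le_mul hv)
  · intro c hc
    rw [(hperm c (hc.trans_le hM)).length_eq]
    exact length_filter_inputWords_le _ _ _ hcap
  · intro c hc
    split_ifs with hcM
    · simp [MPCAlgorithm.memory]
    · rw [List.eq_nil_iff_forall_not_mem]
      intro w hw
      obtain ⟨a, ha, rfl, -⟩ := (hmem'_mem c hc w).1 hw
      apply hcM
      refine Nat.div_lt_of_lt_mul ?_
      rw [mul_comm]
      exact ha.trans_le (K.arity_le_mul hv)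

/-! ### Evaluating the cells -/

theorem running_succ {N r : ℕ} {b : ℕ → Bool} {mem : ℕ → List ℕ} (h : K.Running N r b mem) :
    K.Running N (r + 1) b
      (exchange (K.runStep N r) (K.net.size N * K.width N) mem) := by
  intro v hv
  obtain ⟨m₀, hm₀, hmem⟩ := h v hv
  refine ⟨m₀, hm₀, fun c hc => ?_⟩
  have hM := K.cellMachines_le hv
  -- no messages are exchanged between the machines of different cells
  have hother : ∀ v' < K.net.size N, v' ≠ v → ∀ c' < K.width N,
      ((K.runStep N r (v' * K.width N + c') (mem (v' * K.width N + c'))).2.filter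
        fun msg => msg.1 = v * K.width N + c).map Prod.snd = [] := by
    intro v' hv' hne c' hc'
    have hM' := K.cellMachines_le hv'
    simp only [runStep, mul_add_div_of_lt hc', mul_add_mod_of_lt hc']
    split_ifs
    · rw [List.map_eq_nil_iff, List.filter_eq_nil_iff]
      intro msg hmsg
      simp only [List.mem_map, List.mem_filter, decide_eq_true_eq] at hmsg ⊢
      obtain ⟨msg', ⟨-, hlt⟩, rfl⟩ := hmsg
      intro e
      apply hne
      have hlt' : msg'.1 < K.width N := hlt.trans_le hM'
      rw [← mul_add_div_of_lt (v := v') hlt', ← mul_add_div_of_lt (v := v) hc]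
      exact congrArg (· / K.width N) e
    · rfl
  have hsame : ∀ c' < K.width N,
      ((K.runStep N r (v * K.width N + c') (mem (v * K.width N + c'))).2.filter
        fun msg => msg.1 = v * K.width N + c).map Prod.snd =
      if r < K.cellRounds N v ∧ c' < K.cellMachines N v ∧ c < K.cellMachines N v then
        (((K.cellAlg N v).step (K.arity N v) r c'
          ((K.cellAlg N v).memory (K.arity N v) m₀ r c')).2.filter fun msg => msg.1 = c).map
          Prod.snd
      else [] := by
    intro c' hc'
    simp only [runStep, mul_add_div_of_lt hc', mul_add_mod_of_lt hc', hmem c' hc', cellStep]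
    by_cases h1 : r < K.cellRounds N v ∧ c' < K.cellMachines N v
    · rw [if_pos h1, if_pos h1.2, min_eq_left h1.1.le]
      simp only [List.filter_map, List.filter_filter, List.map_map]
      by_cases h2 : c < K.cellMachines N v
      · rw [if_pos ⟨h1.1, h1.2, h2⟩]
        have hfil : ∀ msg : ℕ × ℕ, (((fun msg : ℕ × ℕ => decide (msg.1 = v * K.width N + c)) ∘
            fun msg => (v * K.width N + msg.1, msg.2)) msg &&
            decide (msg.1 < K.cellMachines N v)) = decide (msg.1 = c) := by
          intro msg
          rw [Bool.eq_iff_iff]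
          simp only [Function.comp, Bool.and_eq_true, decide_eq_true_eq]
          omega
        simp only [hfil]
        rfl
      · rw [if_neg (by tauto), List.map_eq_nil_iff, List.filter_eq_nil_iff]
        intro msg _
        simp only [Function.comp, Bool.and_eq_true, decide_eq_true_eq]
        omega
    · have h3 : ¬ (r < K.cellRounds N v ∧ c' < K.cellMachines N v ∧ c < K.cellMachines N v) :=
        fun h => h1 ⟨h.1, h.2.1⟩
      rw [if_neg h1, if_neg h3]
      rfl
  have hrecv : ((List.range (K.net.size N * K.width N)).flatMap fun j =>
      ((K.runStep N r j (mem j)).2.filter fun msg => msg.1 = v * K.width N + c).map Prod.snd) =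
      if r < K.cellRounds N v ∧ c < K.cellMachines N v then
        (K.cellAlg N v).received (K.arity N v) r
          ((K.cellAlg N v).memory (K.arity N v) m₀ r) c else [] := by
    rw [flatMap_range_mul, flatMap_range_eq_single hv]
    · have h1 : ((List.range (K.width N)).flatMap fun c' =>
          ((K.runStep N r (v * K.width N + c') (mem (v * K.width N + c'))).2.filter
            fun msg => msg.1 = v * K.width N + c).map Prod.snd) =
          (List.range (K.width N)).flatMap fun c' =>
            if r < K.cellRounds N v ∧ c' < K.cellMachines N v ∧ c < K.cellMachines N v then
              (((K.cellAlg N v).step (K.arity N v) r c'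
                ((K.cellAlg N v).memory (K.arity N v) m₀ r c')).2.filter
                fun msg => msg.1 = c).map Prod.snd
            else [] :=
        List.flatMap_congr fun c' hc' => hsame c' (List.mem_range.1 hc')
      rw [h1, flatMap_range_of_le hM fun c' hc' => if_neg (by omega)]
      by_cases h2 : r < K.cellRounds N v ∧ c < K.cellMachines N v
      · rw [if_pos h2]
        unfold MPCAlgorithm.received
        refine List.flatMap_congr fun c' hc' => ?_
        rw [if_pos ⟨h2.1, List.mem_range.1 hc', h2.2⟩]
      · rw [if_neg h2, List.flatMap_eq_nil_iff]
        intro c' _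
        exact if_neg (by tauto)
    · intro v' hv' hne
      rw [List.flatMap_eq_nil_iff]
      exact fun c' hc' => hother v' hv' hne c' (List.mem_range.1 hc')
  unfold exchange
  rw [hrecv]
  simp only [runStep, mul_add_div_of_lt hc, mul_add_mod_of_lt hc, hmem c hc, cellStep]
  by_cases h2 : c < K.cellMachines N v
  · by_cases h1 : r < K.cellRounds N v
    · have h12 : r < K.cellRounds N v ∧ c < K.cellMachines N v := ⟨h1, h2⟩
      simp only [h12, and_self, if_true, min_eq_left h1.le,
        min_eq_left (Nat.succ_le_of_lt h1)]
      rfl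
    · have h3 : K.cellRounds N v ≤ r := not_lt.1 h1
      simp only [h1, h2, false_and, if_true, if_false, List.append_nil, min_eq_right h3,
        min_eq_right (h3.trans (Nat.le_succ r))]
  · simp only [h2, and_false, if_false, List.append_nil]

theorem broadcasting_zero {N : ℕ} {b : ℕ → Bool} {mem : ℕ → List ℕ}
    (h : K.Running N (K.runs N) b mem) :
    K.Broadcasting N 0 (fun v => K.net.cell K.oracle N v ((K.net.deps N v).map b))
      (exchange (K.finishStep N) (K.net.size N * K.width N) mem) := by
  intro v hv c hc
  obtain ⟨m₀, hm₀, hmem⟩ := h v hv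
  have hrecv : ((List.range (K.net.size N * K.width N)).flatMap fun j =>
      ((K.finishStep N j (mem j)).2.filter fun msg => msg.1 = v * K.width N + c).map Prod.snd)
      = [] := by
    rw [List.flatMap_eq_nil_iff]
    intro j _
    rfl
  unfold exchange
  rw [hrecv, List.append_nil]
  simp only [finishStep, mul_add_div_of_lt hc, mul_add_mod_of_lt hc, hmem c hc, pow_zero,
    Nat.lt_one_iff]
  by_cases h0 : c = 0
  · subst h0
    rw [if_pos rfl, if_pos rfl, if_pos (K.cellMachines_pos N v), min_eq_right (K.cellRounds_le hv),
      (K.cellAlg_spec hv (by simp [arity]) hm₀).2]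
  · rw [if_neg h0, if_neg h0]

/-- After the first round, the first machine of each cell holds its initial value. -/
theorem broadcasting_init {x : List Bool} {mem : ℕ → List ℕ} (h : K.alg.IsDistribution x mem) :
    K.Broadcasting x.length 0 (fun v => (false :: x).getD v false)
      (exchange (K.initStep x.length) (K.net.size x.length * K.width x.length) mem) := by
  intro v hv c hc
  set W := K.width x.length with hW
  have hW0 : 0 < W := K.width_pos _
  have hkeep : (K.initStep x.length (v * W + c) (mem (v * W + c))).1 =
      if c = 0 ∧ (v = 0 ∨ x.length < v) then [0] else [] := by
    simp only [initStep, ← hW, mul_add_div_of_lt hc, mul_add_mod_of_lt hc]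
  have hrecv : ((List.range (K.net.size x.length * W)).flatMap fun j =>
      ((K.initStep x.length j (mem j)).2.filter fun msg => msg.1 = v * W + c).map Prod.snd).Perm
      (if c = 0 ∧ 0 < v ∧ v ≤ x.length then [(x.getD (v - 1) false).toNat] else []) := by
    have h1 : ∀ l : List ℕ, ((l.map fun w => ((w / 2 + 1) * W, w % 2)).filter
        fun msg => msg.1 = v * W + c).map Prod.snd =
        (l.filter fun w => (w / 2 + 1) * W = v * W + c).map (· % 2) := by
      intro l
      rw [List.filter_map, List.map_map]
      rfl
    have h2 : ((List.range (K.net.size x.length * W)).flatMap fun j =>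
        ((K.initStep x.length j (mem j)).2.filter fun msg => msg.1 = v * W + c).map Prod.snd) =
        ((((List.range (K.net.size x.length * W)).flatMap mem).filter
          fun w => (w / 2 + 1) * W = v * W + c).map (· % 2)) := by
      rw [List.filter_flatMap, List.map_flatMap]
      exact List.flatMap_congr fun j _ => h1 (mem j)
    rw [h2]
    refine ((h.1.filter _).map _).trans ?_
    rw [MPCAlgorithm.inputWords_eq, List.filter_map, List.map_map]
    have h3 : ∀ j, (j + 1) * W = v * W + c ↔ c = 0 ∧ v = j + 1 := by
      intro j
      constructor
      · intro e
        have e1 := congrArg (· % W) e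
        have e2 := congrArg (· / W) e
        simp only [Nat.mul_mod_left, mul_add_mod_of_lt hc] at e1
        simp only [Nat.mul_div_cancel _ hW0, mul_add_div_of_lt hc] at e2
        exact ⟨e1.symm, e2.symm⟩
      · rintro ⟨rfl, rfl⟩
        rfl
    have h4 : ∀ j, ((fun w => decide ((w / 2 + 1) * W = v * W + c)) ∘
        fun j => 2 * j + (x.getD j false).toNat) j = decide (c = 0 ∧ v = j + 1) := by
      intro j
      simp only [Function.comp, MPCAlgorithm.word_div, h3]
    rw [List.filter_congr fun j _ => h4 j]
    have h5 : ((List.range x.length).filter fun j => decide (c = 0 ∧ v = j + 1)) =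
        if c = 0 ∧ 0 < v ∧ v ≤ x.length then [v - 1] else [] := by
      have : ∀ n, ((List.range n).filter fun j => decide (c = 0 ∧ v = j + 1)) =
          if c = 0 ∧ 0 < v ∧ v ≤ n then [v - 1] else [] := by
        intro n
        induction n with
        | zero =>
          rw [if_neg (by omega)]
          rfl
        | succ n ih =>
          rw [List.range_succ, List.filter_append, ih]
          by_cases hc0 : c = 0 ∧ v = n + 1
          · rw [if_neg (by omega), if_pos (by omega)]
            simp [hc0]
          · by_cases hc1 : c = 0 ∧ 0 < v ∧ v ≤ n
            · rw [if_pos hc1, if_pos (by omega)]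
              simp [hc0]
            · rw [if_neg hc1, if_neg (by omega)]
              simp [hc0]
      exact this _
    rw [h5]
    split_ifs
    · simp only [List.map_cons, List.map_nil, Function.comp, MPCAlgorithm.word_mod]
      exact List.Perm.refl _
    · exact List.Perm.refl _
  unfold exchange
  rw [hkeep, pow_zero]
  simp only [Nat.lt_one_iff]
  by_cases hc0 : c = 0
  · by_cases hv0 : 0 < v ∧ v ≤ x.length
    · rw [if_pos ⟨hc0, hv0⟩] at hrecv
      rw [List.perm_singleton.1 hrecv, if_neg (by omega), if_pos hc0]
      obtain ⟨u, rfl⟩ := Nat.exists_eq_succ_of_ne_zero hv0.1.ne'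
      simp
    · rw [if_neg (by tauto)] at hrecv
      rw [hrecv.eq_nil, if_pos (by omega), if_pos hc0]
      rcases Nat.eq_zero_or_pos v with rfl | hpos
      · simp
      · rw [List.getD_eq_default]
        · rfl
        · simp only [List.length_cons]
          omega
  · rw [if_neg (by tauto)] at hrecv
    rw [hrecv.eq_nil, if_neg (by tauto), if_neg hc0]
    rfl

/-! ### Correctness of the simulation -/

theorem one_le_capacity (N : ℕ) : 1 ≤ K.capacity N := (fan_pos _ _).trans_le (K.fan_le_capacity N)

/-- The state of the machines during the iterations. -/
theorem memory_spec {x : List Bool} {mem : ℕ → List ℕ} (h : K.alg.IsDistribution x mem) (t : ℕ) :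
    (∀ j ≤ K.J, K.Broadcasting x.length j (K.net.val K.oracle x t)
      (K.alg.memory x.length mem (1 + t * K.period x.length + j))) ∧
    (∀ r ≤ K.runs x.length, K.Running x.length r (K.net.val K.oracle x t)
      (K.alg.memory x.length mem (1 + t * K.period x.length + (K.J + 1 + r)))) := by
  set N := x.length with hN
  have hper : K.period N = K.J + 1 + K.runs N + 1 := rfl
  have hphase : ∀ t q, q < K.period N → (1 + t * K.period N + q - 1) % K.period N = q := by
    intro t q hq
    rw [show 1 + t * K.period N + q - 1 = t * K.period N + q by omega, mul_add_mod_of_lt hq]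
  have main : ∀ t, K.Broadcasting N 0 (K.net.val K.oracle x t)
      (K.alg.memory N mem (1 + t * K.period N)) →
      (∀ j ≤ K.J, K.Broadcasting N j (K.net.val K.oracle x t)
        (K.alg.memory N mem (1 + t * K.period N + j))) ∧
      (∀ r ≤ K.runs N, K.Running N r (K.net.val K.oracle x t)
        (K.alg.memory N mem (1 + t * K.period N + (K.J + 1 + r)))) := by
    intro t h0
    have h1 : ∀ j ≤ K.J, K.Broadcasting N j (K.net.val K.oracle x t)
        (K.alg.memory N mem (1 + t * K.period N + j)) := by
      intro j
      induction j with
      | zero => exact fun _ => h0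
      | succ j ih =>
        intro hj
        have hst : K.alg.step N (1 + t * K.period N + j) = K.broadcastStep N := by
          funext i m
          change K.step _ _ _ _ = _
          unfold step
          rw [if_neg (by omega), hphase t j (by omega), if_pos (by omega)]
        rw [← Nat.add_assoc, MPCAlgorithm.memory_succ, hst]
        exact K.broadcasting_succ hj (ih (by omega))
    refine ⟨h1, fun r => ?_⟩
    induction r with
    | zero =>
      intro _
      have hst : K.alg.step N (1 + t * K.period N + K.J) = K.dispatchStep N := by
        funext i m
        change K.step _ _ _ _ = _
        unfold step
        rw [if_neg (by omega), hphase t K.J (by omega), if_neg (by omega), if_pos rfl]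
      rw [Nat.add_zero, ← Nat.add_assoc, MPCAlgorithm.memory_succ, hst]
      exact K.running_zero (h1 K.J le_rfl)
    | succ r ih =>
      intro hr
      have hst : K.alg.step N (1 + t * K.period N + (K.J + 1 + r)) = K.runStep N r := by
        funext i m
        change K.step _ _ _ _ = _
        unfold step
        rw [if_neg (by omega), hphase t (K.J + 1 + r) (by omega), if_neg (by omega),
          if_neg (by omega), if_pos (by omega), Nat.add_sub_cancel_left]
      rw [← Nat.add_assoc (K.J + 1), ← Nat.add_assoc (1 + t * K.period N),
        MPCAlgorithm.memory_succ, hst]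
      exact K.running_succ (ih (by omega))
  apply main
  induction t with
  | zero =>
    have hst : K.alg.step N 0 = K.initStep N := by
      funext i m
      change K.step N 0 i m = _
      unfold step
      rw [if_pos rfl]
    rw [Nat.zero_mul, Nat.add_zero, ← Nat.zero_add 1, MPCAlgorithm.memory_succ, hst]
    exact K.broadcasting_init h
  | succ t ih =>
    have hst : K.alg.step N (1 + t * K.period N + (K.J + 1 + K.runs N)) = K.finishStep N := by
      funext i m
      change K.step _ _ _ _ = _
      unfold step
      rw [if_neg (by omega), hphase t (K.J + 1 + K.runs N) (by omega), if_neg (by omega),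
        if_neg (by omega), if_neg (by omega)]
    have hsucc : 1 + (t + 1) * K.period N = 1 + t * K.period N + (K.J + 1 + K.runs N) + 1 := by
      rw [Nat.succ_mul, hper]
      omega
    rw [hsucc, MPCAlgorithm.memory_succ, hst]
    exact K.broadcasting_zero ((main t ih).2 _ le_rfl)

/-- The simulation of the network obeys the limits of the model. -/
theorem obeysLimits {x : List Bool} {mem : ℕ → List ℕ} (h : K.alg.IsDistribution x mem) :
    K.alg.ObeysLimits ((K.e + 2) * K.c) x.length mem := by
  set N := x.length with hN
  have hper : K.period N = K.J + 1 + K.runs N + 1 := rfl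
  have hc2 : (N + 2) ^ 2 ≤ (N + 2) ^ ((K.e + 2) * K.c) := by
    refine Nat.pow_le_pow_right (by omega) ?_
    have := K.two_le
    nlinarith
  have hbig : 2 * N + 2 < (N + 2) ^ 2 := by nlinarith
  have hword : ∀ v < K.net.size N, (K.arity N v + 2) ^ K.c ≤ (N + 2) ^ ((K.e + 2) * K.c) := by
    intro v hv
    rw [pow_mul]
    refine Nat.pow_le_pow_left ?_ _
    have h1 : K.arity N v ≤ (N + 2) ^ K.e := K.length_deps_le N v hv
    have h2 : 1 ≤ (N + 2) ^ K.e := Nat.one_le_pow _ _ (by omega)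
    rw [pow_add]
    nlinarith [Nat.zero_le N]
  have hround : ∀ r, r = 0 ∨ (∃ t j, j ≤ K.J ∧ r = 1 + t * K.period N + j) ∨
      ∃ t q, q ≤ K.runs N ∧ r = 1 + t * K.period N + (K.J + 1 + q) := by
    intro r
    rcases Nat.eq_zero_or_pos r with hr | hr
    · exact Or.inl hr
    · right
      have h1 := Nat.div_add_mod' (r - 1) (K.period N)
      have h2 := Nat.mod_lt (r - 1) (show 0 < K.period N by omega)
      by_cases h3 : (r - 1) % K.period N ≤ K.J
      · exact Or.inl ⟨(r - 1) / K.period N, (r - 1) % K.period N, h3, by omega⟩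
      · exact Or.inr ⟨(r - 1) / K.period N, (r - 1) % K.period N - (K.J + 1), by omega, by omega⟩
  have hphase : ∀ t q, q < K.period N → (1 + t * K.period N + q - 1) % K.period N = q := by
    intro t q hq
    rw [show 1 + t * K.period N + q - 1 = t * K.period N + q by omega, mul_add_mod_of_lt hq]
  have hcap := K.one_le_capacity N
  constructor
  · intro r _ i hi
    rcases hround r with rfl | ⟨t, j, hj, rfl⟩ | ⟨t, q, hq, rfl⟩
    · refine ⟨h.2 i hi, fun w hw => ?_⟩
      have hw' : w ∈ MPCAlgorithm.inputWords x :=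
        h.1.mem_iff.1 (List.mem_flatMap.2 ⟨i, List.mem_range.2 hi, hw⟩)
      obtain ⟨j, hj, rfl⟩ := MPCAlgorithm.mem_inputWords.1 hw'
      have := MPCAlgorithm.toNat_le_one (x.getD j false)
      omega
    · obtain ⟨v, hv, c, hc, rfl⟩ := machine_cases (K.width_pos N) hi
      rw [(K.memory_spec h t).1 j hj v hv c hc]
      split_ifs
      · refine ⟨hcap, fun w hw => ?_⟩
        rw [List.mem_singleton.1 hw]
        have := MPCAlgorithm.toNat_le_one (K.net.val K.oracle x t v)
        omega
      · simp
    · obtain ⟨v, hv, c, hc, rfl⟩ := machine_cases (K.width_pos N) hi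
      obtain ⟨m₀, hm₀, hmem⟩ := (K.memory_spec h t).2 q hq v hv
      rw [hmem c hc]
      split_ifs with hcM
      · have hlim := (K.cellAlg_spec hv (by simp [arity, hN]) hm₀).1.1 _
          (min_le_right q (K.cellRounds N v)) c hcM
        exact ⟨hlim.1.trans (K.cellCapacity_le hv), fun w hw => (hlim.2 w hw).trans_le (hword v hv)⟩
      · simp
  · intro r _ i hi
    change (K.step N r i _).2.length ≤ K.capacity N
    unfold step
    rcases hround r with rfl | ⟨t, j, hj, rfl⟩ | ⟨t, q, hq, rfl⟩
    · rw [if_pos rfl]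
      simp only [initStep, List.length_map]
      exact h.2 i hi
    · obtain ⟨v, hv, c, hc, rfl⟩ := machine_cases (K.width_pos N) hi
      rw [if_neg (by omega), hphase t j (by omega)]
      split_ifs with h1 h2 h3
      · simp only [broadcastStep]
        rw [(K.memory_spec h t).1 j hj v hv c hc]
        split_ifs
        · simpa using K.fan_le_capacity N
        · simp
      · simp only [dispatchStep]
        split_ifs
        · exact hcap
        · simp
      · omega
      · simp [finishStep]
    · obtain ⟨v, hv, c, hc, rfl⟩ := machine_cases (K.width_pos N) hi
      rw [if_neg (by omega), hphase t (K.J + 1 + q) (by omega), if_neg (by omega),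
        if_neg (by omega)]
      split_ifs with h1
      · rw [Nat.add_sub_cancel_left]
        obtain ⟨m₀, hm₀, hmem⟩ := (K.memory_spec h t).2 q hq v hv
        simp only [runStep, mul_add_div_of_lt hc, mul_add_mod_of_lt hc]
        split_ifs with h2
        · rw [hmem c hc, if_pos h2.2, min_eq_left h2.1.le, List.length_map]
          refine (List.length_filter_le _ _).trans (le_trans ?_ (K.cellCapacity_le hv))
          exact (K.cellAlg_spec hv (by simp [arity, hN]) hm₀).1.2 q h2.1 c h2.2
        · simp
      · simp [finishStep]

/-- The simulation computes the output of the network. -/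
theorem alg_decides {A : Language Bool}
    (hA : ∀ x, x ∈ A ↔ K.net.val K.oracle x (K.net.iters x.length) 0 = true) :
    K.alg.Decides A := by
  refine ⟨(K.e + 2) * K.c, fun x mem h => ⟨K.obeysLimits h, ?_⟩⟩
  have h0 : 0 < K.net.size x.length := (Nat.zero_le _).trans_lt (K.lt_size _)
  have := (K.memory_spec h (K.net.iters x.length)).1 0 (Nat.zero_le _) 0 h0 0 (K.width_pos _)
  rw [Nat.zero_mul, Nat.zero_add, Nat.add_zero, pow_zero, if_pos Nat.one_pos] at this
  have hr : K.alg.rounds x.length = 1 + K.net.iters x.length * K.period x.length := Nat.add_comm _ _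
  rw [hA, hr, this]
  simp [alg]

end Implementation

/-! ### Orders of growth -/

theorem lt_fan_pow {d : ℕ} (hd : 0 < d) (N : ℕ) : N + 2 ≤ fan d N ^ d := by
  have h1 : N + 2 < 2 ^ (Nat.log 2 (N + 2) + 1) := Nat.lt_pow_succ_log_self (by norm_num) _
  have h2 : Nat.log 2 (N + 2) + 1 ≤ (Nat.log 2 (N + 2) / d + 1) * d := by
    have := Nat.lt_div_mul_add hd (a := Nat.log 2 (N + 2))
    rw [Nat.succ_mul]
    omega
  unfold fan
  rw [← pow_mul]
  exact h1.le.trans (Nat.pow_le_pow_right (by norm_num) h2)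

theorem fan_le (d N : ℕ) : fan d N ≤ (N + 2) ^ 2 := by
  have h1 : 2 ^ (Nat.log 2 (N + 2) / d) ≤ N + 2 :=
    (Nat.pow_le_pow_right (by norm_num) (Nat.div_le_self _ _)).trans
      (Nat.pow_log_le_self 2 (by omega))
  unfold fan
  rw [pow_succ]
  nlinarith

theorem add_two_rpow_le {a : ℝ} (h0 : 0 ≤ a) (h1 : a ≤ 1) (N : ℕ) :
    ((N : ℝ) + 2) ^ a ≤ 2 * ((N : ℝ) + 1) ^ a := by
  have hN : (0 : ℝ) ≤ N := Nat.cast_nonneg N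
  calc ((N : ℝ) + 2) ^ a ≤ (2 * ((N : ℝ) + 1)) ^ a :=
        Real.rpow_le_rpow (by positivity) (by linarith) h0
    _ = 2 ^ a * ((N : ℝ) + 1) ^ a := Real.mul_rpow (by norm_num) (by positivity)
    _ ≤ 2 * ((N : ℝ) + 1) ^ a := by
        gcongr
        calc (2 : ℝ) ^ a ≤ 2 ^ (1 : ℝ) := Real.rpow_le_rpow_of_exponent_le (by norm_num) h1
          _ = 2 := Real.rpow_one 2

theorem fan_le_rpow {d : ℕ} (hd : 0 < d) {a : ℝ} (ha : 1 / (d : ℝ) ≤ a) (ha1 : a ≤ 1) (N : ℕ) :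
    (fan d N : ℝ) ≤ 4 * ((N : ℝ) + 1) ^ a := by
  have h0 : (0 : ℝ) ≤ 1 / (d : ℝ) := by positivity
  have h1 : ((2 : ℝ) ^ (Nat.log 2 (N + 2) / d)) ^ d ≤ (N : ℝ) + 2 := by
    have : (2 ^ (Nat.log 2 (N + 2) / d)) ^ d ≤ N + 2 := by
      rw [← pow_mul]
      exact (Nat.pow_le_pow_right (by norm_num) (Nat.div_mul_le_self _ _)).trans
        (Nat.pow_log_le_self 2 (by omega))
    exact_mod_cast this
  have h2 : (2 : ℝ) ^ (Nat.log 2 (N + 2) / d) ≤ ((N : ℝ) + 2) ^ a := by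
    calc (2 : ℝ) ^ (Nat.log 2 (N + 2) / d)
        = (((2 : ℝ) ^ (Nat.log 2 (N + 2) / d)) ^ d) ^ (1 / (d : ℝ)) := by
          rw [one_div, Real.pow_rpow_inv_natCast (by positivity) hd.ne']
      _ ≤ ((N : ℝ) + 2) ^ (1 / (d : ℝ)) := Real.rpow_le_rpow (by positivity) h1 h0
      _ ≤ ((N : ℝ) + 2) ^ a :=
          Real.rpow_le_rpow_of_exponent_le (by linarith [(Nat.cast_nonneg N : (0 : ℝ) ≤ N)]) ha
  have h3 := add_two_rpow_le (h0.trans ha) ha1 N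
  unfold fan
  rw [pow_succ]
  push_cast
  linarith

/-- Every real power is dominated by a natural one. -/
theorem exists_pow_bound (C a : ℝ) :
    ∃ e : ℕ, ∀ N : ℕ, C * ((N : ℝ) + 1) ^ a ≤ ((N : ℝ) + 2) ^ e := by
  obtain ⟨k, hk⟩ := pow_unbounded_of_one_lt C (by norm_num : (1 : ℝ) < 2)
  refine ⟨k + ⌈a⌉₊, fun N => ?_⟩
  have hN : (0 : ℝ) ≤ N := Nat.cast_nonneg N
  have h1 : ((N : ℝ) + 1) ^ a ≤ ((N : ℝ) + 2) ^ ⌈a⌉₊ := by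
    calc ((N : ℝ) + 1) ^ a ≤ ((N : ℝ) + 1) ^ (⌈a⌉₊ : ℝ) :=
          Real.rpow_le_rpow_of_exponent_le (by linarith) (Nat.le_ceil a)
      _ = ((N : ℝ) + 1) ^ ⌈a⌉₊ := Real.rpow_natCast _ _
      _ ≤ ((N : ℝ) + 2) ^ ⌈a⌉₊ := by gcongr; norm_num
  have h2 : C ≤ ((N : ℝ) + 2) ^ k :=
    hk.le.trans (pow_le_pow_left₀ (by norm_num) (by linarith) k)
  rw [pow_add]
  exact mul_le_mul h2 h1 (by positivity) (by positivity)

/-- Sufficient conditions for a memory regime: at least `(N + 1) ^ 2` machines provide enough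
total memory. -/
theorem memoryRegime_of {P : MPCAlgorithm} {ε : ℝ} (h0 : 0 < ε) (e : ℕ) (C : ℝ)
    (hm : ∀ N, (N + 1) ^ 2 ≤ P.machines N) (hm' : ∀ N, P.machines N ≤ (N + 2) ^ e)
    (hc : ∀ N, 1 ≤ P.capacity N) (hc' : ∀ N : ℕ, (P.capacity N : ℝ) ≤ C * ((N : ℝ) + 1) ^ (1 - ε)) :
    P.MemoryRegime ε := by
  have hmul : ∀ N, (N + 1) ^ 2 ≤ P.machines N * P.capacity N := fun N =>
    (hm N).trans (Nat.le_mul_of_pos_right _ (hc N))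
  refine ⟨fun N => ⟨?_, ?_⟩, ⟨C, hc'⟩, ⟨1, one_pos, fun N => ?_⟩, ?_⟩
  · exact lt_of_lt_of_le (by positivity) (hm N)
  · exact le_trans (by nlinarith) (hmul N)
  · have h1 : (((N + 1) ^ 2 : ℕ) : ℝ) ≤ ((P.machines N * P.capacity N : ℕ) : ℝ) :=
      Nat.cast_le.2 (hmul N)
    push_cast at h1
    rw [one_mul]
    refine le_trans ?_ h1
    rw [← Real.rpow_natCast]
    exact Real.rpow_le_rpow_of_exponent_le (by linarith [(Nat.cast_nonneg N : (0 : ℝ) ≤ N)])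
      (by push_cast; linarith)
  · obtain ⟨k, hk⟩ := exists_pow_bound C (1 - ε)
    refine ⟨(e + k : ℕ), by positivity, 2 ^ (e + k), fun N => ?_⟩
    have hN : (0 : ℝ) ≤ N := Nat.cast_nonneg N
    have h1 : (P.machines N : ℝ) ≤ ((N : ℝ) + 2) ^ e := by exact_mod_cast hm' N
    calc (P.machines N : ℝ) * P.capacity N ≤ ((N : ℝ) + 2) ^ e * ((N : ℝ) + 2) ^ k :=
          mul_le_mul h1 ((hc' N).trans (hk N)) (Nat.cast_nonneg _) (by positivity)
      _ = ((N : ℝ) + 2) ^ (e + k) := (pow_add _ _ _).symm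
      _ ≤ (2 * ((N : ℝ) + 1)) ^ (e + k) := by gcongr; linarith
      _ = 2 ^ (e + k) * ((N : ℝ) + 1) ^ (e + k) := mul_pow _ _ _
      _ ≤ 2 ^ (e + k) * ((N : ℝ) + 1) ^ (1 + ((e + k : ℕ) : ℝ)) := by
          gcongr
          rw [← Real.rpow_natCast]
          exact Real.rpow_le_rpow_of_exponent_le (by linarith) (by linarith)

/-! ### Families of solvers -/

/-- The algorithms `Q k` solve the problems `O k` within `O(f(N))` rounds and local memories of
`O(N ^ (1 - ε))` words, with the same constants for all `k`. -/
structure Solves (f : ℕ → ℝ) (ε : ℝ) (O : ℕ → Language Bool) (Q : ℕ → MPCAlgorithm) : Prop where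
  uniform : UniformlyComputable Q
  decides : ∃ c, ∀ k x mem, (Q k).IsDistribution x mem →
    (Q k).ObeysLimits c x.length mem ∧ (x ∈ O k ↔ (Q k).answer x.length
      ((Q k).memory x.length mem ((Q k).rounds x.length) 0) = true)
  machines_pos : ∀ k N, 0 < (Q k).machines N
  capacity_pos : ∀ k N, 0 < (Q k).capacity N
  le_mul : ∀ k N, N ≤ (Q k).machines N * (Q k).capacity N
  capacity_le : ∃ C : ℝ, ∀ k N, ((Q k).capacity N : ℝ) ≤ C * ((N : ℝ) + 1) ^ (1 - ε)
  machines_le : ∃ e : ℕ, ∀ k N, (Q k).machines N ≤ (N + 2) ^ e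
  rounds_le : ∃ C : ℝ, ∀ k N, ((Q k).rounds N : ℝ) ≤ C * f N

theorem MPCAlgorithm.MemoryRegime.capacity_pos {P : MPCAlgorithm} {ε : ℝ} (h : P.MemoryRegime ε)
    (N : ℕ) : 0 < P.capacity N := by
  obtain ⟨-, -, ⟨c, hc, h⟩, -⟩ := h
  by_contra h0
  have h1 := h N
  rw [Nat.eq_zero_of_not_pos h0, Nat.cast_zero, mul_zero] at h1
  have : (0 : ℝ) < c * ((N : ℝ) + 1) ^ (2 * (1 - ε)) := by positivity
  linarith

/-- A larger exponent of `N + 2` makes the bound on the size of words weaker. -/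
theorem MPCAlgorithm.ObeysLimits.mono {P : MPCAlgorithm} {c c' N : ℕ} {mem : ℕ → List ℕ}
    (h : P.ObeysLimits c N mem) (hc : c ≤ c') : P.ObeysLimits c' N mem :=
  ⟨fun r hr i hi => ⟨(h.1 r hr i hi).1, fun w hw => ((h.1 r hr i hi).2 w hw).trans_le
    (Nat.pow_le_pow_right (by omega) hc)⟩, h.2⟩

theorem SolvableInRounds.solves {f : ℕ → ℝ} {A : Language Bool} (h : SolvableInRounds f A) {ε : ℝ}
    (h0 : 0 < ε) (h1 : ε < 1) : ∃ Q, Solves f ε (fun _ => A) Q := by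
  obtain ⟨P, hreg, ⟨c, hdec⟩, hrounds⟩ := h ε h0 h1
  have hcap := hreg.capacity_pos
  obtain ⟨hpos, ⟨C, hC⟩, -, ⟨γ, -, C', hC'⟩⟩ := hreg
  obtain ⟨e, he⟩ := exists_pow_bound C' (1 + γ)
  have c1 := P.computable_machines
  have c2 := P.computable_capacity
  have c3 := P.computable_rounds
  have c4 := P.computable_step
  have c5 := P.computable_answer
  refine ⟨fun _ => P, ⟨by fun_prop, by fun_prop, by fun_prop, by fun_prop, by fun_prop⟩,
    ⟨c, fun _ => hdec⟩, fun _ N => (hpos N).1, fun _ => hcap, fun _ N => (hpos N).2,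
    ⟨C, fun _ => hC⟩, ⟨e, fun _ N => ?_⟩, hrounds.imp fun _ h _ => h⟩
  have h2 : ((P.machines N * P.capacity N : ℕ) : ℝ) ≤ (((N + 2) ^ e : ℕ) : ℝ) := by
    push_cast
    exact (hC' N).trans (he N)
  exact (Nat.le_mul_of_pos_right _ (hcap N)).trans (Nat.cast_le.1 h2)

/-- Putting one more element in front of a sequence. -/
def consSeq {α : Sort*} (a : α) (s : ℕ → α) : ℕ → α
  | 0 => a
  | k + 1 => s k

theorem Solves.cons {f : ℕ → ℝ} {ε : ℝ} {O : ℕ → Language Bool} {Q : ℕ → MPCAlgorithm}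
    {A : Language Bool} (hf : ∀ N, 0 < f N) (h : Solves f ε O Q) {Q' : ℕ → MPCAlgorithm}
    (h' : Solves f ε (fun _ => A) Q') : Solves f ε (consSeq A O) (consSeq (Q' 0) Q) := by
  obtain ⟨c, hc⟩ := h.decides
  obtain ⟨c', hc'⟩ := h'.decides
  obtain ⟨C, hC⟩ := h.capacity_le
  obtain ⟨C', hC'⟩ := h'.capacity_le
  obtain ⟨e, he⟩ := h.machines_le
  obtain ⟨e', he'⟩ := h'.machines_le
  obtain ⟨R, hR⟩ := h.rounds_le
  obtain ⟨R', hR'⟩ := h'.rounds_le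
  have hN : ∀ N : ℕ, (0 : ℝ) ≤ N := fun N => Nat.cast_nonneg N
  refine ⟨⟨?_, ?_, ?_, ?_, ?_⟩, ⟨max c c', ?_⟩, ?_, ?_, ?_, ⟨max C C', ?_⟩, ⟨max e e', ?_⟩,
    ⟨max R R', ?_⟩⟩
  · refine (computable_ite (c := fun q : ℕ × ℕ => q.1 = 0) (by fun_prop)
      (h'.uniform.machines.comp (g := fun q : ℕ × ℕ => (0, q.2)) (by fun_prop))
      (h.uniform.machines.comp (g := fun q : ℕ × ℕ => (q.1 - 1, q.2)) (by fun_prop))).of_eq ?_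
    rintro ⟨_ | k, q⟩ <;> rfl
  · refine (computable_ite (c := fun q : ℕ × ℕ => q.1 = 0) (by fun_prop)
      (h'.uniform.capacity.comp (g := fun q : ℕ × ℕ => (0, q.2)) (by fun_prop))
      (h.uniform.capacity.comp (g := fun q : ℕ × ℕ => (q.1 - 1, q.2)) (by fun_prop))).of_eq ?_
    rintro ⟨_ | k, q⟩ <;> rfl
  · refine (computable_ite (c := fun q : ℕ × ℕ => q.1 = 0) (by fun_prop)
      (h'.uniform.rounds.comp (g := fun q : ℕ × ℕ => (0, q.2)) (by fun_prop))
      (h.uniform.rounds.comp (g := fun q : ℕ × ℕ => (q.1 - 1, q.2)) (by fun_prop))).of_eq ?_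
    rintro ⟨_ | k, q⟩ <;> rfl
  · refine (computable_ite (c := fun q : ℕ × ℕ × ℕ × ℕ × List ℕ => q.1 = 0) (by fun_prop)
      (h'.uniform.step.comp (g := fun q : ℕ × ℕ × ℕ × ℕ × List ℕ => (0, q.2)) (by fun_prop))
      (h.uniform.step.comp (g := fun q : ℕ × ℕ × ℕ × ℕ × List ℕ => (q.1 - 1, q.2))
        (by fun_prop))).of_eq ?_
    rintro ⟨_ | k, q⟩ <;> rfl
  · refine (computable_ite (c := fun q : ℕ × ℕ × List ℕ => q.1 = 0) (by fun_prop)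
      (h'.uniform.answer.comp (g := fun q : ℕ × ℕ × List ℕ => (0, q.2)) (by fun_prop))
      (h.uniform.answer.comp (g := fun q : ℕ × ℕ × List ℕ => (q.1 - 1, q.2))
        (by fun_prop))).of_eq ?_
    rintro ⟨_ | k, q⟩ <;> rfl
  · rintro (_ | k) x mem hmem
    · exact ⟨(hc' 0 x mem hmem).1.mono (le_max_right _ _), (hc' 0 x mem hmem).2⟩
    · exact ⟨(hc k x mem hmem).1.mono (le_max_left _ _), (hc k x mem hmem).2⟩
  · rintro (_ | k)
    exacts [h'.machines_pos 0, h.machines_pos k]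
  · rintro (_ | k)
    exacts [h'.capacity_pos 0, h.capacity_pos k]
  · rintro (_ | k)
    exacts [h'.le_mul 0, h.le_mul k]
  · rintro (_ | k) N
    · refine (hC' 0 N).trans ?_
      have := hN N
      gcongr
      exact le_max_right _ _
    · refine (hC k N).trans ?_
      have := hN N
      gcongr
      exact le_max_left _ _
  · rintro (_ | k) N
    · exact (he' 0 N).trans (Nat.pow_le_pow_right (by omega) (le_max_right _ _))
    · exact (he k N).trans (Nat.pow_le_pow_right (by omega) (le_max_left _ _))
  · rintro (_ | k) N
    · exact (hR' 0 N).trans (mul_le_mul_of_nonneg_right (le_max_right _ _) (hf N).le)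
    · exact (hR k N).trans (mul_le_mul_of_nonneg_right (le_max_left _ _) (hf N).le)

/-! ### From networks to MPC algorithms -/

/-- For every `ε < 1` there is an admissible branching factor. -/
theorem exists_one_div_le {ε : ℝ} (h1 : ε < 1) : ∃ d : ℕ, 0 < d ∧ 1 / (d : ℝ) ≤ 1 - ε := by
  obtain ⟨d, hd⟩ := exists_nat_gt (1 / (1 - ε))
  have h2 := sub_pos.2 h1
  have hd0 : (0 : ℝ) < d := lt_trans (by positivity) hd
  refine ⟨d, by exact_mod_cast hd0, ?_⟩
  rw [div_le_iff₀ hd0]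
  rw [div_lt_iff₀ h2] at hd
  linarith

/-- The network `G` with oracles `O` decides `A`, has at most `(N + 2) ^ e` cells with at most
`(N + 2) ^ e` arguments, and the cells without oracle have at most `fan d N` arguments. -/
structure Network.Decides (G : Network) (O : ℕ → Language Bool) (d e : ℕ) (A : Language Bool) :
    Prop where
  lt_size : ∀ N, N < G.size N
  size_le : ∀ N, G.size N ≤ (N + 2) ^ e
  deps_lt : ∀ N, ∀ v < G.size N, ∀ u ∈ G.deps N v, u < G.size N
  length_deps_le_fan : ∀ N, ∀ v < G.size N, G.kind N v = 0 → (G.deps N v).length ≤ fan d N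
  length_deps_le : ∀ N, ∀ v < G.size N, (G.deps N v).length ≤ (N + 2) ^ e
  mem_iff : ∀ x, x ∈ A ↔ G.val O x (G.iters x.length) 0 = true

theorem foldr_max_le {l : List ℕ} {B : ℝ} (hB : 0 ≤ B) (h : ∀ a ∈ l, (a : ℝ) ≤ B) :
    ((l.foldr max 0 : ℕ) : ℝ) ≤ B := by
  induction l with
  | nil => simpa using hB
  | cons a l ih =>
    rw [List.foldr_cons, Nat.cast_max]
    exact max_le (h a (by simp)) (ih fun b hb => h b (by simp [hb]))

/-- If the local memories of the solvers are small enough, then a network with oracles can be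
simulated by an MPC algorithm in memory regime `ε`. Each iteration takes a constant number of
rounds in addition to the number `ρ` of rounds needed for the queries. -/
theorem Network.Decides.exists_alg {f : ℕ → ℝ} (hf : ∀ N, 0 < f N) {ε : ℝ} (h0 : 0 < ε)
    (h1 : ε < 1) {d : ℕ} (hd : 0 < d) (hdε : 1 / (d : ℝ) ≤ 1 - ε) {G : Network}
    {O : ℕ → Language Bool} {e : ℕ} {A : Language Bool} (hG : G.Decides O d e A)
    (hO : ∀ ε' : ℝ, 0 < ε' → ε' < 1 → ∃ Q, Solves f ε' O Q) :
    ∃ P : MPCAlgorithm, P.MemoryRegime ε ∧ P.Decides A ∧ ∃ (J : ℕ) (ρ : ℕ → ℕ), Computable ρ ∧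
      (∀ N, P.rounds N = G.iters N * (J + 1 + ρ N + 1) + 1) ∧
      ∃ (C : ℝ) (k : ℕ), 0 ≤ C ∧ ∀ N, ∃ m ≤ (N + 2) ^ k, (ρ N : ℝ) ≤ C * f m := by
  -- the queries have length at most `(N + 2) ^ e`, so solvers whose local memories have the order
  -- of magnitude `m ^ ((1 - ε) / (e + 1))` on inputs of length `m` fit into `N ^ (1 - ε)` words
  obtain ⟨Q, hQ⟩ := hO (1 - (1 - ε) / (e + 1))
    (by
      have : (1 - ε) / ((e : ℝ) + 1) < 1 := by
        rw [div_lt_one (by positivity)]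
        linarith [(Nat.cast_nonneg e : (0 : ℝ) ≤ e)]
      linarith)
    (by
      have : 0 < (1 - ε) / ((e : ℝ) + 1) := div_pos (by linarith) (by positivity)
      linarith)
  obtain ⟨c, hc⟩ := hQ.decides
  obtain ⟨e₁, he₁⟩ := hQ.machines_le
  obtain ⟨C, hC⟩ := hQ.capacity_le
  obtain ⟨R, hR⟩ := hQ.rounds_le
  have hpow' : ∀ N a : ℕ, (N + 2) ^ a ≤ fan d N ^ (d * a) := by
    intro N a
    rw [pow_mul]
    exact Nat.pow_le_pow_left (lt_fan_pow hd N) a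
  have hJ : ∀ N a : ℕ, a ≤ 2 * e + (e + 2) * e₁ →
      (N + 2) ^ a ≤ fan d N ^ (d * (2 * e + (e + 2) * e₁)) := fun N a ha =>
    (Nat.pow_le_pow_right (by omega) ha).trans (hpow' N _)
  let K : Implementation :=
    { net := G
      oracle := O
      solver := Q
      d := d
      J := d * (2 * e + (e + 2) * e₁)
      e := e
      c := max 2 c
      uniform := hQ.uniform
      lt_size := hG.lt_size
      deps_lt := hG.deps_lt
      length_deps_le_fan := hG.length_deps_le_fan
      length_deps_le := hG.length_deps_le
      le_width := fun N => by
        refine le_trans ?_ (hJ N (2 * e) (by omega))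
        rw [two_mul, pow_add]
        exact Nat.mul_le_mul_right _ (hG.size_le N)
      machines_le := fun N v hv k => by
        refine le_trans (he₁ k _) (le_trans ?_ (hJ N ((e + 2) * e₁) (by omega)))
        rw [pow_mul]
        refine Nat.pow_le_pow_left ?_ _
        have h2 := hG.length_deps_le N v hv
        have h3 : 1 ≤ (N + 2) ^ e := Nat.one_le_pow _ _ (by omega)
        have h4 : (N + 2) ^ e * 4 ≤ (N + 2) ^ e * (N + 2) ^ 2 :=
          Nat.mul_le_mul_left _ (Nat.pow_le_pow_left (by omega : 2 ≤ N + 2) 2)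
        rw [pow_add]
        omega
      two_le := le_max_left _ _
      decides := fun k x mem hmem =>
        ⟨(hc k x mem hmem).1.mono (le_max_right _ _), (hc k x mem hmem).2⟩
      machines_pos := hQ.machines_pos
      capacity_pos := hQ.capacity_pos
      le_mul := hQ.le_mul }
  have hcell : ∀ N, ∀ v < G.size N, (K.cellCapacity N v : ℝ) ≤
      max 4 (2 * max C 0) * ((N : ℝ) + 1) ^ (1 - ε) := by
    intro N v hv
    have hN : (0 : ℝ) ≤ N := Nat.cast_nonneg N
    unfold Implementation.cellCapacity Implementation.cellAlg
    split_ifs with hk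
    · refine (fan_le_rpow hd hdε (by linarith) N).trans ?_
      gcongr
      exact le_max_left _ _
    · refine (hC _ _).trans ?_
      have h2 : ((K.arity N v : ℝ) + 1) ≤ ((N : ℝ) + 2) ^ (e + 1) := by
        have h3 : K.arity N v ≤ (N + 2) ^ e := hG.length_deps_le N v hv
        have h4 : 1 ≤ (N + 2) ^ e := Nat.one_le_pow _ _ (by omega)
        have : K.arity N v + 1 ≤ (N + 2) ^ (e + 1) := by
          rw [pow_succ]
          nlinarith [Nat.zero_le N]
        exact_mod_cast this
      have h5 : 0 ≤ (1 - ε) / ((e : ℝ) + 1) := div_nonneg (by linarith) (by positivity)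
      calc C * ((K.arity N v : ℝ) + 1) ^ (1 - (1 - (1 - ε) / ((e : ℝ) + 1)))
          ≤ max C 0 * ((K.arity N v : ℝ) + 1) ^ (1 - (1 - (1 - ε) / ((e : ℝ) + 1))) := by
            gcongr
            exact le_max_left _ _
        _ = max C 0 * ((K.arity N v : ℝ) + 1) ^ ((1 - ε) / ((e : ℝ) + 1)) := by
            rw [sub_sub_cancel]
        _ ≤ max C 0 * (((N : ℝ) + 2) ^ (e + 1)) ^ ((1 - ε) / ((e : ℝ) + 1)) := by gcongr
        _ = max C 0 * ((N : ℝ) + 2) ^ (1 - ε) := by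
            rw [← Real.rpow_natCast, ← Real.rpow_mul (by positivity)]
            congr 2
            push_cast
            field_simp
        _ ≤ max C 0 * (2 * ((N : ℝ) + 1) ^ (1 - ε)) := by
            gcongr
            exact add_two_rpow_le (by linarith) (by linarith) N
        _ = (2 * max C 0) * ((N : ℝ) + 1) ^ (1 - ε) := by ring
        _ ≤ _ := by
            gcongr
            exact le_max_right _ _
  refine ⟨K.alg, ?_, K.alg_decides hG.mem_iff, K.J, K.runs, K.computable_runs, fun N => rfl,
    max R 0, e, le_max_right _ _, fun N => ?_⟩
  · refine memoryRegime_of h0 (e + 2 * K.J) (max 4 (2 * max C 0)) (fun N => ?_) (fun N => ?_)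
      K.one_le_capacity fun N => ?_
    · have h2 : N + 1 ≤ G.size N := hG.lt_size N
      have h3 : N + 1 ≤ K.width N :=
        h2.trans ((Nat.le_mul_of_pos_right _ (by positivity)).trans (K.le_width N))
      rw [sq]
      exact Nat.mul_le_mul h2 h3
    · rw [pow_add, pow_mul]
      exact Nat.mul_le_mul (hG.size_le N) (Nat.pow_le_pow_left (fan_le d N) _)
    · have hN : (0 : ℝ) ≤ N := Nat.cast_nonneg N
      change ((max (fan d N) _ : ℕ) : ℝ) ≤ _
      rw [Nat.cast_max]
      refine max_le ?_ (foldr_max_le (by positivity) fun a ha => ?_)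
      · refine (fan_le_rpow hd hdε (by linarith) N).trans ?_
        gcongr
        exact le_max_left _ _
      · obtain ⟨v, hv, rfl⟩ := List.mem_map.1 ha
        exact hcell N v (List.mem_range.1 hv)
  · -- some query takes the maximal number of rounds
    have hmax : ∀ l : List ℕ, l.foldr max 0 = 0 ∨ l.foldr max 0 ∈ l := by
      intro l
      induction l with
      | nil => exact Or.inl rfl
      | cons a l ih =>
        right
        rw [List.foldr_cons]
        rcases le_total a (l.foldr max 0) with h | h
        · rcases ih with h' | h'
          · rw [h'] at h ⊢
            simp
          · rw [max_eq_right h]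
            exact List.mem_cons_of_mem _ h'
        · rw [max_eq_left h]
          exact List.mem_cons_self
    have hzero : ∀ m, (0 : ℝ) ≤ max R 0 * f m := fun m =>
      mul_nonneg (le_max_right _ _) (hf m).le
    rcases hmax ((List.range (G.size N)).map (K.cellRounds N)) with h | h
    · exact ⟨0, Nat.zero_le _, by
        unfold Implementation.runs
        rw [h, Nat.cast_zero]
        exact hzero 0⟩
    · obtain ⟨v, hv, hv'⟩ := List.mem_map.1 h
      rw [List.mem_range] at hv
      refine ⟨K.arity N v, hG.length_deps_le N v hv, ?_⟩
      change ((List.foldr max 0 ((List.range (G.size N)).map (K.cellRounds N)) : ℕ) : ℝ) ≤ _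
      rw [← hv']
      unfold Implementation.cellRounds Implementation.cellAlg
      split_ifs with hk
      · simpa [localAlg] using hzero _
      · refine (hR _ _).trans ?_
        exact mul_le_mul_of_nonneg_right (le_max_left _ _) (hf _).le

/-- The algorithm that behaves as `P` or as `P'`, depending on a property of the input size. -/
def MPCAlgorithm.select (b : ℕ → Bool) (hb : Computable b) (P P' : MPCAlgorithm) :
    MPCAlgorithm where
  machines N := bif b N then P.machines N else P'.machines N
  capacity N := bif b N then P.capacity N else P'.capacity N
  rounds N := bif b N then P.rounds N else P'.rounds N
  step N r i m := bif b N then P.step N r i m else P'.step N r i m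
  answer N m := bif b N then P.answer N m else P'.answer N m
  computable_machines := by
    have := P.computable_machines
    have := P'.computable_machines
    fun_prop
  computable_capacity := by
    have := P.computable_capacity
    have := P'.computable_capacity
    fun_prop
  computable_rounds := by
    have := P.computable_rounds
    have := P'.computable_rounds
    fun_prop
  computable_step := by
    have := P.computable_step
    have := P'.computable_step
    fun_prop
  computable_answer := by
    have := P.computable_answer
    have := P'.computable_answer
    fun_prop

namespace MPCAlgorithm

variable {b : ℕ → Bool} {hb : Computable b} {P P' : MPCAlgorithm}

theorem memory_select (N : ℕ) (mem : ℕ → List ℕ) (r i : ℕ) :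
    (select b hb P P').memory N mem r i =
      bif b N then P.memory N mem r i else P'.memory N mem r i := by
  induction r generalizing i with
  | zero => cases h : b N <;> simp [memory]
  | succ r ih =>
    have : (select b hb P P').memory N mem r = fun i =>
        bif b N then P.memory N mem r i else P'.memory N mem r i := funext ih
    simp only [memory, received, this]
    cases h : b N <;> simp [select, h]

theorem Decides.select {A : Language Bool} (h : P.Decides A) (h' : P'.Decides A) :
    (select b hb P P').Decides A := by
  obtain ⟨c, hc⟩ := h
  obtain ⟨c', hc'⟩ := h'
  refine ⟨max c c', fun x mem hmem => ?_⟩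
  unfold ObeysLimits IsDistribution at *
  simp only [memory_select]
  cases hb : b x.length
  · simp only [MPCAlgorithm.select, hb, cond_false] at hmem ⊢
    exact ⟨ObeysLimits.mono (hc' x mem hmem).1 (le_max_right c c'), (hc' x mem hmem).2⟩
  · simp only [MPCAlgorithm.select, hb, cond_true] at hmem ⊢
    exact ⟨ObeysLimits.mono (hc x mem hmem).1 (le_max_left c c'), (hc x mem hmem).2⟩

theorem MemoryRegime.select {ε : ℝ} (h : P.MemoryRegime ε) (h' : P'.MemoryRegime ε) :
    (select b hb P P').MemoryRegime ε := by
  obtain ⟨h1, ⟨C, h2⟩, ⟨c, hc, h3⟩, ⟨γ, hγ, D, h4⟩⟩ := h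
  obtain ⟨h1', ⟨C', h2'⟩, ⟨c', hc', h3'⟩, ⟨γ', hγ', D', h4'⟩⟩ := h'
  have hpos : ∀ (N : ℕ) (a : ℝ), 0 ≤ ((N : ℝ) + 1) ^ a := fun N a => by positivity
  refine ⟨fun N => ?_, ⟨max C C', fun N => ?_⟩, ⟨min c c', lt_min hc hc', fun N => ?_⟩,
    ⟨max γ γ', hγ.trans (le_max_left _ _), max (max D D') 0, fun N => ?_⟩⟩
  · cases hb : b N
    · simpa [MPCAlgorithm.select, hb] using h1' N
    · simpa [MPCAlgorithm.select, hb] using h1 N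
  · cases hb : b N
    · simpa [MPCAlgorithm.select, hb] using
        (h2' N).trans (mul_le_mul_of_nonneg_right (le_max_right C C') (hpos _ _))
    · simpa [MPCAlgorithm.select, hb] using
        (h2 N).trans (mul_le_mul_of_nonneg_right (le_max_left C C') (hpos _ _))
  · cases hb : b N
    · simpa [MPCAlgorithm.select, hb] using
        (mul_le_mul_of_nonneg_right (min_le_right c c') (hpos _ _)).trans (h3' N)
    · simpa [MPCAlgorithm.select, hb] using
        (mul_le_mul_of_nonneg_right (min_le_left c c') (hpos _ _)).trans (h3 N)
  · have hN : (0 : ℝ) ≤ N := Nat.cast_nonneg N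
    have key : ∀ D₁ γ₁ : ℝ, D₁ ≤ max (max D D') 0 → γ₁ ≤ max γ γ' →
        D₁ * ((N : ℝ) + 1) ^ (1 + γ₁) ≤ max (max D D') 0 * ((N : ℝ) + 1) ^ (1 + max γ γ') := by
      intro D₁ γ₁ hD hγ
      refine (mul_le_mul_of_nonneg_right hD (hpos _ _)).trans
        (mul_le_mul_of_nonneg_left ?_ (le_max_right _ _))
      exact Real.rpow_le_rpow_of_exponent_le (by linarith) (by linarith)
    cases hb : b N
    · simpa [MPCAlgorithm.select, hb] using (h4' N).trans
        (key D' γ' ((le_max_right _ _).trans (le_max_left _ _)) (le_max_right _ _))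
    · simpa [MPCAlgorithm.select, hb] using (h4 N).trans
        (key D γ ((le_max_left _ _).trans (le_max_left _ _)) (le_max_left _ _))

end MPCAlgorithm

/-- A function which is stable under polynomial changes of the size is bounded from below. -/
theorem PolyStableBelowLog.exists_le {f : ℕ → ℝ} (hf : ∀ N, 0 < f N) (h : PolyStableBelowLog f) :
    ∃ C : ℝ, 0 ≤ C ∧ ∀ N, 1 ≤ C * f N := by
  obtain ⟨C, hC⟩ := h 0
  have hlog : ∀ N : ℕ, Real.log 2 ≤ Real.log ((N : ℝ) + 2) := fun N =>
    Real.log_le_log (by norm_num) (by linarith [(Nat.cast_nonneg N : (0 : ℝ) ≤ N)])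
  have hc : 0 < min (f 0) (Real.log 2) := lt_min (hf 0) (Real.log_pos (by norm_num))
  have h1 : ∀ N, min (f 0) (Real.log 2) ≤ C * f N := fun N =>
    (min_le_min le_rfl (hlog N)).trans (hC N 0 (Nat.zero_le _))
  refine ⟨C / min (f 0) (Real.log 2), div_nonneg ?_ hc.le, fun N => ?_⟩
  · by_contra hneg
    have := h1 0
    nlinarith [hf 0]
  · rw [div_mul_eq_mul_div, one_le_div hc]
    exact h1 N

theorem log_le_natLog (N : ℕ) : Real.log ((N : ℝ) + 2) ≤ Nat.log 2 (N + 2) + 1 := by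
  have h1 : ((N : ℝ) + 2) ≤ 2 ^ (Nat.log 2 (N + 2) + 1) := by
    exact_mod_cast (Nat.lt_pow_succ_log_self (by norm_num : 1 < 2) (N + 2)).le
  calc Real.log ((N : ℝ) + 2) ≤ Real.log (2 ^ (Nat.log 2 (N + 2) + 1)) :=
        Real.log_le_log (by positivity) h1
    _ = (Nat.log 2 (N + 2) + 1) * Real.log 2 := by rw [Real.log_pow]; push_cast; ring
    _ ≤ (Nat.log 2 (N + 2) + 1) * 1 := by
        gcongr
        linarith [Real.log_two_lt_d9]
    _ = _ := mul_one _

theorem natLog_le_log (N : ℕ) : (Nat.log 2 (N + 2) : ℝ) ≤ 2 * Real.log ((N : ℝ) + 2) := by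
  have h1 : (2 : ℝ) ^ Nat.log 2 (N + 2) ≤ (N : ℝ) + 2 := by
    exact_mod_cast Nat.pow_log_le_self 2 (by omega : N + 2 ≠ 0)
  have h2 : (Nat.log 2 (N + 2) : ℝ) * Real.log 2 ≤ Real.log ((N : ℝ) + 2) := by
    rw [← Real.log_pow]
    exact Real.log_le_log (by positivity) h1
  have h3 := Real.log_two_gt_d9
  have h4 : (0 : ℝ) ≤ Nat.log 2 (N + 2) := Nat.cast_nonneg _
  nlinarith

/-- A problem that can be solved in `O(log N)` rounds, and that has networks with a constant number
of iterations and oracles solvable in `O(f(N))` rounds, can be solved in `O(f(N))` rounds. If the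
queries take more than `log N` rounds, then `f(N)` is at least of order `log N`, and the
queries can be avoided. -/
theorem solvable_of_networks {f : ℕ → ℝ} (hf : ∀ N, 0 < f N) (hstable : PolyStableBelowLog f)
    {A : Language Bool} (hlog : SolvableInRounds (fun N => Real.log ((N : ℝ) + 2)) A)
    {O : ℕ → Language Bool} (hO : ∀ ε : ℝ, 0 < ε → ε < 1 → ∃ Q, Solves f ε O Q)
    (hnet : ∀ d, 0 < d → ∃ (G : Network) (e T : ℕ), G.Decides O d e A ∧ ∀ N, G.iters N ≤ T) :
    SolvableInRounds f A := by
  intro ε h0 h1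
  obtain ⟨d, hd, hd'⟩ := exists_one_div_le h1
  obtain ⟨G, e, T, hG, hT⟩ := hnet d hd
  obtain ⟨P, hreg, hdec, J, ρ, hρ, hrounds, C, k, hC, hm⟩ :=
    hG.exists_alg hf h0 h1 hd hd' hO
  obtain ⟨P', hreg', hdec', C', hC'⟩ := hlog ε h0 h1
  have hb : Computable fun N => decide (ρ N ≤ Nat.log 2 (N + 2)) := by fun_prop
  obtain ⟨D, hD⟩ := hstable k
  obtain ⟨B, hB0, hB⟩ := hstable.exists_le hf
  refine ⟨.select _ hb P P', hreg.select hreg', hdec.select hdec',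
    (T * (J + 2) + 1) * B + T * ((C + 2) * D) + max C' 0 * ((C + 2) * D), fun N => ?_⟩
  obtain ⟨m, hmk, hρm⟩ := hm N
  have hDN := hD N m hmk
  have hlogpos : 0 < Real.log ((N : ℝ) + 2) :=
    Real.log_pos (by linarith [(Nat.cast_nonneg N : (0 : ℝ) ≤ N)])
  have hDf : 0 ≤ D * f N := (le_min (hf m).le hlogpos.le).trans hDN
  have hBN := hB N
  have hC2 : 0 ≤ (C + 2) * (D * f N) := by positivity
  have hT0 : (0 : ℝ) ≤ T := Nat.cast_nonneg T
  have hJ0 : (0 : ℝ) ≤ J := Nat.cast_nonneg J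
  by_cases hcase : ρ N ≤ Nat.log 2 (N + 2)
  · have hr : (MPCAlgorithm.select _ hb P P').rounds N = P.rounds N := by
      simp [MPCAlgorithm.select, hcase]
    have h2 : (ρ N : ℝ) ≤ 2 * Real.log ((N : ℝ) + 2) :=
      (Nat.cast_le.2 hcase).trans (natLog_le_log N)
    have h3 : (ρ N : ℝ) ≤ (C + 2) * min (f m) (Real.log ((N : ℝ) + 2)) := by
      rcases min_cases (f m) (Real.log ((N : ℝ) + 2)) with ⟨h, -⟩ | ⟨h, -⟩
      · rw [h]
        nlinarith [hf m]
      · rw [h]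
        nlinarith
    have h4 : (ρ N : ℝ) ≤ (C + 2) * (D * f N) :=
      h3.trans (mul_le_mul_of_nonneg_left hDN (by linarith))
    have h5 : (P.rounds N : ℝ) ≤ T * (J + 2 + ρ N) + 1 := by
      rw [hrounds]
      push_cast
      have : (G.iters N : ℝ) ≤ T := by exact_mod_cast hT N
      have h6 : (0 : ℝ) ≤ ρ N := Nat.cast_nonneg _
      nlinarith
    rw [hr]
    have h7 : 0 ≤ max C' 0 * ((C + 2) * (D * f N)) := mul_nonneg (le_max_right _ _) hC2
    have h8 : (T : ℝ) * ρ N ≤ T * ((C + 2) * (D * f N)) := mul_le_mul_of_nonneg_left h4 hT0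
    have h9 : ((T : ℝ) * (J + 2) + 1) * 1 ≤ (T * (J + 2) + 1) * (B * f N) :=
      mul_le_mul_of_nonneg_left hBN (by positivity)
    nlinarith
  · have hr : (MPCAlgorithm.select _ hb P P').rounds N = P'.rounds N := by
      simp [MPCAlgorithm.select, hcase]
    have h2 : Real.log ((N : ℝ) + 2) ≤ ρ N := by
      refine (log_le_natLog N).trans ?_
      exact_mod_cast not_le.1 hcase
    have h3 : Real.log ((N : ℝ) + 2) ≤ (C + 2) * min (f m) (Real.log ((N : ℝ) + 2)) := by
      rcases min_cases (f m) (Real.log ((N : ℝ) + 2)) with ⟨h, -⟩ | ⟨h, -⟩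
      · rw [h]
        nlinarith [hf m]
      · rw [h]
        nlinarith
    have h4 : Real.log ((N : ℝ) + 2) ≤ (C + 2) * (D * f N) :=
      h3.trans (mul_le_mul_of_nonneg_left hDN (by linarith))
    have h5 : (P'.rounds N : ℝ) ≤ max C' 0 * Real.log ((N : ℝ) + 2) :=
      (hC' N).trans (mul_le_mul_of_nonneg_right (le_max_left _ _) hlogpos.le)
    have h6 := mul_le_mul_of_nonneg_left h4 (le_max_right C' 0)
    have h7 : 0 ≤ (T : ℝ) * ((C + 2) * (D * f N)) := by positivity
    have h8 : 0 ≤ ((T : ℝ) * (J + 2) + 1) * (B * f N) := by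
      have := hf N
      positivity
    rw [hr]
    nlinarith

/-! ### Disjunctions -/

/-- The strings that contain a `1`. -/
def orLanguage : Language Bool := {x | true ∈ x}

theorem mem_orLanguage {x : List Bool} : x ∈ orLanguage ↔ true ∈ x := Iff.rfl

/-- In each round, machine `i` tells machine `i / fan d N` whether it knows of a `1`. -/
def orAlg (d : ℕ) : MPCAlgorithm where
  machines N := (N + 2) ^ 2
  capacity N := fan d N
  rounds _ := d * 2
  step N _ i m := ([], if m.any (fun w => w % 2 = 1) then [(i / fan d N, 1)] else [])
  answer _ m := m.any fun w => w % 2 = 1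
  computable_machines := by fun_prop
  computable_capacity := computable_fan d
  computable_rounds := by fun_prop
  computable_step := by
    have := computable_fan d
    fun_prop
  computable_answer := by fun_prop

theorem orAlg_memory_succ (d N r : ℕ) (mem : ℕ → List ℕ) (i : ℕ) :
    (orAlg d).memory N mem (r + 1) i =
      ((List.range ((N + 2) ^ 2)).filter fun j =>
        ((orAlg d).memory N mem r j).any (fun w => w % 2 = 1) && decide (j / fan d N = i)).map
          fun _ => 1 := by
  have h : ∀ (M : ℕ → List ℕ) (l : List ℕ), (l.flatMap fun j =>
      (((orAlg d).step N r j (M j)).2.filter fun msg => msg.1 = i).map Prod.snd) =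
      (l.filter fun j => (M j).any (fun w => w % 2 = 1) && decide (j / fan d N = i)).map
        fun _ => 1 := by
    intro M l
    induction l with
    | nil => rfl
    | cons j l ih =>
      rw [List.flatMap_cons, ih]
      simp only [orAlg, List.filter_cons]
      cases (M j).any fun w => decide (w % 2 = 1) with
      | false => simp
      | true => by_cases h2 : j / fan d N = i <;> simp [h2]
  exact h _ _

theorem length_filter_div_le (n F i : ℕ) (hF : 0 < F) (b : ℕ → Bool) :
    ((List.range n).filter fun j => b j && decide (j / F = i)).length ≤ F := by
  have hsub : ((List.range n).filter fun j => b j && decide (j / F = i)) ⊆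
      (List.range F).map fun a => i * F + a := by
    intro j hj
    simp only [List.mem_filter, Bool.and_eq_true, decide_eq_true_eq] at hj
    refine List.mem_map.2 ⟨j % F, List.mem_range.2 (Nat.mod_lt _ hF), ?_⟩
    rw [← hj.2.2]
    exact Nat.div_add_mod' j F
  simpa using (List.subperm_of_subset (List.nodup_range.filter _) hsub).length_le

theorem orAlg_decides {d : ℕ} (hd : 0 < d) : (orAlg d).Decides orLanguage := by
  refine ⟨2, fun x mem hmem => ?_⟩
  set N := x.length with hN
  have hF := fan_pos d N
  have hbig : 2 * N + 2 ≤ (N + 2) ^ 2 := by nlinarith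
  -- only the first machines still know of a `1`, but some machine does if there is one
  have hinv : ∀ r, ((∃ i < (N + 2) ^ 2, ∃ w ∈ (orAlg d).memory N mem r i, w % 2 = 1) ↔ true ∈ x) ∧
      ∀ i, i < (N + 2) ^ 2 → (N + 2) ^ 2 ≤ i * fan d N ^ r → (orAlg d).memory N mem r i = [] := by
    intro r
    induction r with
    | zero =>
      refine ⟨?_, fun i hi hi' => by rw [pow_zero, mul_one] at hi'; omega⟩
      constructor
      · rintro ⟨i, hi, w, hw, hodd⟩
        have hw' : w ∈ MPCAlgorithm.inputWords x :=
          hmem.1.mem_iff.1 (List.mem_flatMap.2 ⟨i, List.mem_range.2 hi, hw⟩)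
        obtain ⟨j, hj, rfl⟩ := MPCAlgorithm.mem_inputWords.1 hw'
        rw [MPCAlgorithm.word_mod] at hodd
        have : x[j] = true := by
          rw [List.getD_eq_getElem _ _ hj] at hodd
          simpa using hodd
        exact this ▸ List.getElem_mem hj
      · intro h
        obtain ⟨j, hj, e⟩ := List.getElem_of_mem h
        have : 2 * j + (x.getD j false).toNat ∈ MPCAlgorithm.inputWords x :=
          MPCAlgorithm.mem_inputWords.2 ⟨j, hj, rfl⟩
        obtain ⟨i, hi, hw⟩ := List.mem_flatMap.1 (hmem.1.mem_iff.2 this)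
        refine ⟨i, List.mem_range.1 hi, _, hw, ?_⟩
        rw [MPCAlgorithm.word_mod, List.getD_eq_getElem _ _ hj, e]
        rfl
    | succ r ih =>
      simp only [orAlg_memory_succ]
      constructor
      · rw [← ih.1]
        constructor
        · rintro ⟨i, hi, w, hw, -⟩
          obtain ⟨j, hj, -⟩ := List.mem_map.1 hw
          simp only [List.mem_filter, List.mem_range, Bool.and_eq_true, List.any_eq_true,
            decide_eq_true_eq] at hj
          exact ⟨j, hj.1, hj.2.1⟩
        · rintro ⟨j, hj, hw⟩
          refine ⟨j / fan d N, (Nat.div_le_self _ _).trans_lt hj, 1, List.mem_map.2 ⟨j, ?_, rfl⟩,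
            rfl⟩
          simpa [hj] using hw
      · intro i hi hlarge
        rw [List.map_eq_nil_iff, List.filter_eq_nil_iff]
        intro j hj
        rw [List.mem_range] at hj
        by_cases hji : j / fan d N = i
        · have : (orAlg d).memory N mem r j = [] := by
            refine ih.2 j hj (hlarge.trans ?_)
            rw [← hji, pow_succ', ← mul_assoc]
            exact Nat.mul_le_mul_right _ (Nat.div_mul_le_self _ _)
          simp [this]
        · simp [hji]
  refine ⟨⟨fun r _ i hi => ?_, fun r _ i _ => ?_⟩, ?_⟩
  · rcases r with _ | r
    · refine ⟨hmem.2 i hi, fun w hw => ?_⟩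
      have hw' : w ∈ MPCAlgorithm.inputWords x :=
        hmem.1.mem_iff.1 (List.mem_flatMap.2 ⟨i, List.mem_range.2 hi, hw⟩)
      obtain ⟨j, hj, rfl⟩ := MPCAlgorithm.mem_inputWords.1 hw'
      have := MPCAlgorithm.toNat_le_one (x.getD j false)
      omega
    · rw [orAlg_memory_succ]
      refine ⟨?_, fun w hw => ?_⟩
      · rw [List.length_map]
        exact length_filter_div_le _ _ _ hF _
      · obtain ⟨j, -, rfl⟩ := List.mem_map.1 hw
        omega
  · have : 1 ≤ fan d N := hF
    simp only [orAlg]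
    split_ifs
    · exact this
    · exact Nat.zero_le _
  · change _ ↔ ((orAlg d).memory N mem (d * 2) 0).any (fun w => w % 2 = 1) = true
    rw [mem_orLanguage, ← (hinv (d * 2)).1, List.any_eq_true]
    constructor
    · rintro ⟨i, hi, w, hw, hodd⟩
      have hi0 : i = 0 := by
        by_contra hne
        have h1 : (N + 2) ^ 2 ≤ i * fan d N ^ (d * 2) := by
          rw [pow_mul]
          exact (Nat.pow_le_pow_left (lt_fan_pow hd N) 2).trans
            (Nat.le_mul_of_pos_left _ (Nat.pos_of_ne_zero hne))
        rw [(hinv (d * 2)).2 i hi h1] at hw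
        simp at hw
      subst hi0
      exact ⟨w, hw, by simpa using hodd⟩
    · rintro ⟨w, hw, hodd⟩
      exact ⟨0, by positivity, w, hw, by simpa using hodd⟩

/-- Disjunctions are evaluated in a constant number of rounds. -/
theorem solvable_orLanguage {f : ℕ → ℝ} {C : ℝ} (hf : ∀ N, 1 ≤ C * f N) :
    SolvableInRounds f orLanguage := by
  intro ε h0 h1
  obtain ⟨d, hd, hdε⟩ := exists_one_div_le h1
  refine ⟨orAlg d, memoryRegime_of h0 2 4 (fun N => ?_) (fun N => le_rfl) (fun N => fan_pos d N)
    (fan_le_rpow hd hdε (by linarith)), orAlg_decides hd, (d * 2 : ℕ) * C, fun N => ?_⟩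
  · exact Nat.pow_le_pow_left (by omega) 2
  · change ((d * 2 : ℕ) : ℝ) ≤ _
    rw [mul_assoc]
    exact le_mul_of_one_le_right (Nat.cast_nonneg _) (hf N)

/-! ### Configuration graphs -/

/-- A uniform family of directed graphs for the language `A`: on inputs of length `n` there are
`size n` vertices, and whether there is an edge from `u` to `v` may depend on the bit of the
input that is in position `pos n u` of the input tape. The input is in `A` if and only if some
accepting vertex can be reached from `start n`. -/
structure ConfigGraph (A : Language Bool) where
  size : ℕ → ℕ
  start : ℕ → ℕ
  accept : ℕ → ℕ → Bool
  pos : ℕ → ℕ → ℕ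
  edge : ℕ → ℕ → ℕ → Bool → Bool
  computable_size : Computable size
  computable_start : Computable start
  computable_accept : Computable fun q : ℕ × ℕ => accept q.1 q.2
  computable_pos : Computable fun q : ℕ × ℕ => pos q.1 q.2
  computable_edge : Computable fun q : ℕ × ℕ × ℕ × Bool => edge q.1 q.2.1 q.2.2.1 q.2.2.2
  exists_size_le : ∃ e, ∀ n, size n ≤ (n + 2) ^ e
  start_lt : ∀ n, start n < size n
  mem_iff : ∀ x, x ∈ A ↔ ∃ v < size x.length, accept x.length v = true ∧
    Relation.ReflTransGen (fun u v => u < size x.length ∧ v < size x.length ∧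
      edge x.length u v ((false :: x).getD (pos x.length u) false) = true) (start x.length) v

/-- All lists of length `B` with entries below `s`. -/
def words (s B : ℕ) : List (List (Fin s)) :=
  Nat.rec [[]] (fun _ l => l.flatMap fun t => (List.finRange s).map fun a => a :: t) B

theorem mem_words {s B : ℕ} {t : List (Fin s)} : t ∈ words s B ↔ t.length = B := by
  induction B generalizing t with
  | zero => simp [words, List.length_eq_zero_iff]
  | succ B ih =>
    change t ∈ (words s B).flatMap (fun t => (List.finRange s).map fun a => a :: t) ↔ _
    simp only [List.mem_flatMap, List.mem_map, List.mem_finRange, true_and]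
    constructor
    · rintro ⟨t', ht', a, rfl⟩
      rw [List.length_cons, ih.1 ht']
    · intro h
      obtain ⟨a, t', rfl⟩ := List.exists_cons_of_length_eq_add_one h
      exact ⟨t', ih.2 (by simpa using h), a, rfl⟩

theorem length_words (s B : ℕ) : (words s B).length = s ^ B := by
  induction B with
  | zero => rfl
  | succ B ih =>
    change ((words s B).flatMap (fun t => (List.finRange s).map fun a => a :: t)).length = _
    simp [List.length_flatMap, ih, pow_succ]

theorem computable_words (s : ℕ) : Computable (words s) := by
  unfold words
  fun_prop

namespace TuringMachine

/-- The symbols on the input tape, numbered. -/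
def symOf (i : Fin 4) : InSym :=
  if i = 0 then InSym.leftEnd else if i = 1 then InSym.bit false else
    if i = 2 then InSym.bit true else InSym.rightEnd

/-- The number of the symbol in cell `h` of the input tape, if the bit there is `b`. -/
def symIndex (n h : ℕ) (b : Bool) : Fin 4 :=
  if h = 0 then 0 else if n < h then 3 else if b = true then 2 else 1

theorem symOf_symIndex (x : List Bool) (h : ℕ) :
    symOf (symIndex x.length h ((false :: x).getD h false)) = inputSymbol x h := by
  unfold symIndex inputSymbol
  rcases Nat.eq_zero_or_pos h with rfl | hpos
  · rfl
  · obtain ⟨j, rfl⟩ := Nat.exists_eq_add_of_lt hpos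
    simp only [Nat.zero_add, if_neg (Nat.succ_ne_zero j)]
    by_cases hj : x.length < j + 1
    · rw [if_pos hj]
      have : x[j + 1 - 1]? = none := by
        rw [List.getElem?_eq_none_iff]
        omega
      rw [this]
      rfl
    · rw [if_neg hj]
      have hj' : j < x.length := by omega
      have : x[j + 1 - 1]? = some x[j] := by simp [hj']
      rw [this]
      have h2 : (false :: x).getD (j + 1) false = x[j] := by simp [hj']
      rw [h2]
      cases x[j] <;> rfl

/-- The head movements, numbered. -/
def moveOf (i : Fin 3) : Move :=
  if i = 0 then Move.left else if i = 1 then Move.stay else Move.right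

theorem exists_moveOf (m : Move) : ∃ i, moveOf i = m := by
  cases m
  exacts [⟨0, rfl⟩, ⟨1, rfl⟩, ⟨2, rfl⟩]

/-- The position of the input head after movement number `i`. -/
def moveIn (n : ℕ) (i : Fin 3) (h : ℕ) : ℕ :=
  if i = 0 then h - 1 else if i = 1 then h else min (h + 1) (n + 1)

/-- The position of the work head after movement number `i`. -/
def moveOn (i : Fin 3) (h : ℕ) : ℕ := if i = 0 then h - 1 else if i = 1 then h else h + 1

theorem moveInput_moveOf (n : ℕ) (i : Fin 3) (h : ℕ) :
    moveInput n (moveOf i) h = moveIn n i h := by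
  fin_cases i <;> rfl

theorem moveWork_moveOf (i : Fin 3) (h : ℕ) : moveWork (moveOf i) h = moveOn i h := by
  fin_cases i <;> rfl

theorem computable_moveIn : Computable fun q : ℕ × Fin 3 × ℕ => moveIn q.1 q.2.1 q.2.2 := by
  unfold moveIn
  fun_prop

theorem computable_moveOn : Computable fun q : Fin 3 × ℕ => moveOn q.1 q.2 := by
  unfold moveOn
  fun_prop

theorem computable_symIndex : Computable fun q : ℕ × ℕ × Bool => symIndex q.1 q.2.1 q.2.2 := by
  unfold symIndex
  fun_prop

variable (M : TuringMachine) {q s : ℕ} (eS : M.State ≃ Fin q) (eB : M.Sym ≃ Fin s)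

/-- Configurations restricted to the first cells of the work tape: state, position of the input
head, contents of the work tape, position of the work head. -/
abbrev Code (q s : ℕ) := Fin q × ℕ × List (Fin s) × ℕ

/-- The code of a configuration, with the first `B` cells of the work tape. -/
def code (B : ℕ) (k : M.Config) : Code q s :=
  (eS k.state, k.inputHead, (List.range B).map fun i => eB (k.tape i), k.workHead)

/-- All codes of configurations with input head on the input tape and work head in the
first `B` cells of the work tape. -/
def codes (q s n B : ℕ) : List (Code q s) :=
  (List.finRange q).flatMap fun st => (List.range (n + 2)).flatMap fun h =>
    (words s B).flatMap fun t => (List.range B).map fun w => (st, h, t, w)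

theorem mem_codes {q s n B : ℕ} {c : Code q s} :
    c ∈ codes q s n B ↔ c.2.1 < n + 2 ∧ c.2.2.1.length = B ∧ c.2.2.2 < B := by
  obtain ⟨st, h, t, w⟩ := c
  simp only [codes, List.mem_flatMap, List.mem_finRange, List.mem_range, mem_words, List.mem_map,
    true_and, Prod.mk.injEq]
  constructor
  · rintro ⟨_, _, h1, _, h2, _, h3, rfl, rfl, rfl, rfl⟩
    exact ⟨h1, h2, h3⟩
  · rintro ⟨h1, h2, h3⟩
    exact ⟨st, h, h1, t, h2, w, h3, rfl, rfl, rfl, rfl⟩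

theorem length_codes (q s n B : ℕ) : (codes q s n B).length = q * ((n + 2) * (s ^ B * B)) := by
  simp [codes, List.length_flatMap, length_words]

open Classical in
/-- The transition table, in terms of numbers for states, symbols and movements. -/
noncomputable def table (p : (Fin q × Fin 4 × Fin s) × Fin q × Fin s × Fin 3 × Fin 3) : Bool :=
  decide ((eS.symm p.2.1, eB.symm p.2.2.1, moveOf p.2.2.2.1, moveOf p.2.2.2.2) ∈
    M.trans (eS.symm p.1.1) (symOf p.1.2.1) (eB.symm p.1.2.2))

theorem table_eq_true (p : (Fin q × Fin 4 × Fin s) × Fin q × Fin s × Fin 3 × Fin 3) :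
    M.table eS eB p = true ↔
      (eS.symm p.2.1, eB.symm p.2.2.1, moveOf p.2.2.2.1, moveOf p.2.2.2.2) ∈
        M.trans (eS.symm p.1.1) (symOf p.1.2.1) (eB.symm p.1.2.2) := by
  simp [table]

/-- Whether the machine can go from `u` to `v` in one step on an input of length `n`, if `b` is the
input bit scanned in `u`. -/
noncomputable def codeStep (n : ℕ) (u v : Code q s) (b : Bool) : Bool :=
  (Finset.univ : Finset (Fin s × Fin 3 × Fin 3)).toList.any fun o =>
    M.table eS eB ((u.1, symIndex n u.2.1 b, u.2.2.1.getD u.2.2.2 (eB M.blank)), v.1, o) &&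
      decide (v.2 = (moveIn n o.2.1 u.2.1, u.2.2.1.set u.2.2.2 o.1,
        moveOn o.2.2 u.2.2.2))

theorem computable_codeStep : Computable fun p : ℕ × Code q s × Code q s × Bool =>
    M.codeStep eS eB p.1 p.2.1 p.2.2.1 p.2.2.2 := by
  have h1 : Computable (M.table eS eB) := (Primrec.dom_finite _).to_comp
  have h2 := computable_moveIn
  have h3 := computable_moveOn
  have h4 := computable_symIndex
  unfold codeStep
  generalize M.table eS eB = t at h1
  fun_prop

/-- As long as the work head stays in the first `B` cells, steps between codes are the steps of the
machine. -/
theorem codeStep_iff {x : List Bool} {B : ℕ} {k : M.Config} (hk : k.workHead < B) {v : Code q s} :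
    M.codeStep eS eB x.length (M.code eS eB B k) v ((false :: x).getD k.inputHead false) = true ↔
      ∃ k', M.Step x k k' ∧ M.code eS eB B k' = v := by
  have hread : ((List.range B).map fun i => eB (k.tape i)).getD k.workHead (eB M.blank) =
      eB (k.tape k.workHead) := by
    simp [hk]
  have hset : ∀ b, ((List.range B).map fun i => eB (k.tape i)).set k.workHead b =
      (List.range B).map fun i => eB (Function.update k.tape k.workHead (eB.symm b) i) := by
    intro b
    apply List.ext_getElem
    · simp
    · intro i h1 h2
      rw [List.getElem_set]
      by_cases hi : k.workHead = i
      · subst hi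
        simp
      · rw [if_neg hi]
        simp [Function.update_of_ne (Ne.symm hi)]
  unfold codeStep
  simp only [List.any_eq_true, Finset.mem_toList, Finset.mem_univ, true_and, Bool.and_eq_true,
    decide_eq_true_eq, code, hset, table_eq_true, ← moveInput_moveOf, ← moveWork_moveOf]
  rw [hread]
  simp only [symOf_symIndex, Equiv.symm_apply_apply]
  constructor
  · rintro ⟨⟨b, d, e⟩, h1, h2⟩
    refine ⟨_, ⟨_, _, _, _, h1, rfl⟩, ?_⟩
    simp only [Equiv.apply_symm_apply]
    rw [← h2]
  · rintro ⟨k', ⟨q', b, d, e, h, rfl⟩, rfl⟩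
    obtain ⟨d, rfl⟩ := exists_moveOf d
    obtain ⟨e, rfl⟩ := exists_moveOf e
    refine ⟨(eB b, d, e), ?_, ?_⟩
    · simpa using h
    · simp

/-- The configuration graph of a machine that works in logarithmic space. -/
theorem DecidesInLogSpace.nonempty_configGraph {M : TuringMachine} {A : Language Bool}
    (hM : M.DecidesInLogSpace A) : Nonempty (ConfigGraph A) := by
  obtain ⟨⟨c, hc⟩, -, hA⟩ := hM
  have := M.finite_state
  have := M.finite_sym
  obtain ⟨q, ⟨eS⟩⟩ := Finite.exists_equiv_fin M.State
  obtain ⟨s, ⟨eB⟩⟩ := Finite.exists_equiv_fin M.Sym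
  let B : ℕ → ℕ := fun n => c * Nat.log 2 (n + 2)
  let L : ℕ → List (Code q s) := fun n => codes q s n (B n)
  let init : ℕ → Code q s := fun n => (eS M.start, 0, List.replicate (B n) (eB M.blank), 0)
  have hB : Computable B := by
    change Computable fun n => c * Nat.log 2 (n + 2)
    fun_prop
  have hL : Computable L := by
    have := computable_words s
    change Computable fun n => codes q s n (B n)
    unfold codes
    fun_prop
  have hinit : Computable init := by
    change Computable fun n => (eS M.start, 0, List.replicate (B n) (eB M.blank), 0)
    fun_prop
  have hinit_eq : ∀ n, init n = M.code eS eB (B n) M.initial := by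
    intro n
    simp [init, code, initial]
  have hhead : ∀ x k, M.Reachable x k → k.inputHead < x.length + 2 := by
    intro x k hk
    induction hk with
    | refl => exact Nat.succ_pos _
    | tail _ hstep ih =>
      obtain ⟨q', b, d, e, -, rfl⟩ := hstep
      cases d <;> simp only [moveInput] <;> omega
  have hmemL : ∀ x k, M.Reachable x k → M.code eS eB (B x.length) k ∈ L x.length := by
    intro x k hk
    refine mem_codes.2 ⟨hhead x k hk, ?_, hc x k hk⟩
    simp [code]
  have hstart : ∀ n, init n ∈ L n := by
    intro n
    have := hmemL (List.replicate n true) M.initial Relation.ReflTransGen.refl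
    rw [← hinit_eq, List.length_replicate] at this
    exact this
  have hstep := M.computable_codeStep eS eB
  refine ⟨{ size := fun n => (L n).length
            start := fun n => (L n).idxOf (init n)
            accept := fun n v => decide (((L n).getD v (init n)).1 = eS M.accept)
            pos := fun n v => ((L n).getD v (init n)).2.1
            edge := fun n u v b =>
              M.codeStep eS eB n ((L n).getD u (init n)) ((L n).getD v (init n)) b
            computable_size := by fun_prop
            computable_start := by fun_prop
            computable_accept := by fun_prop
            computable_pos := by fun_prop
            computable_edge := by fun_prop
            exists_size_le := ⟨q + 1 + (c * s + c), fun n => ?_⟩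
            start_lt := fun n => List.idxOf_lt_length_of_mem (hstart n)
            mem_iff := fun x => ?_ }⟩
  · rw [length_codes]
    have h1 : q ≤ (n + 2) ^ q :=
      (Nat.lt_two_pow_self (n := q)).le.trans (Nat.pow_le_pow_left (by omega) q)
    have hlog : 2 ^ Nat.log 2 (n + 2) ≤ n + 2 := Nat.pow_log_le_self 2 (by omega)
    have h2 : s ^ B n ≤ (n + 2) ^ (c * s) := by
      calc s ^ B n ≤ (2 ^ s) ^ B n := Nat.pow_le_pow_left (Nat.lt_two_pow_self (n := s)).le _
        _ = (2 ^ Nat.log 2 (n + 2)) ^ (c * s) := by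
          rw [← pow_mul, ← pow_mul]
          congr 1
          simp only [B]
          ring
        _ ≤ (n + 2) ^ (c * s) := Nat.pow_le_pow_left hlog _
    have h3 : B n ≤ (n + 2) ^ c := by
      calc B n ≤ 2 ^ B n := (Nat.lt_two_pow_self (n := B n)).le
        _ = (2 ^ Nat.log 2 (n + 2)) ^ c := by
          rw [← pow_mul]
          congr 1
          simp only [B]
          ring
        _ ≤ (n + 2) ^ c := Nat.pow_le_pow_left hlog _
    calc q * ((n + 2) * (s ^ B n * B n))
        ≤ (n + 2) ^ q * ((n + 2) * ((n + 2) ^ (c * s) * (n + 2) ^ c)) := by gcongr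
      _ = (n + 2) ^ (q + 1 + (c * s + c)) := by ring
  · have hget : ∀ k, M.Reachable x k → ∃ v, v < (L x.length).length ∧
        (L x.length).getD v (init x.length) = M.code eS eB (B x.length) k := by
      intro k hk
      obtain ⟨v, hv, e⟩ := List.getElem_of_mem (hmemL x k hk)
      exact ⟨v, hv, by rw [List.getD_eq_getElem _ _ hv, e]⟩
    rw [hA]
    constructor
    · rintro ⟨k, hk, hacc⟩
      have key : ∃ v < (L x.length).length,
          (L x.length).getD v (init x.length) = M.code eS eB (B x.length) k ∧
          Relation.ReflTransGen (fun u v => u < (L x.length).length ∧ v < (L x.length).length ∧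
            M.codeStep eS eB x.length ((L x.length).getD u (init x.length))
              ((L x.length).getD v (init x.length))
              ((false :: x).getD ((L x.length).getD u (init x.length)).2.1 false) = true)
            ((L x.length).idxOf (init x.length)) v := by
        clear hacc
        induction hk with
        | refl =>
          have hlt := List.idxOf_lt_length_of_mem (hstart x.length)
          refine ⟨_, hlt, ?_, Relation.ReflTransGen.refl⟩
          rw [List.getD_eq_getElem _ _ hlt, List.getElem_idxOf, hinit_eq]
        | tail hk hst ih =>
          obtain ⟨u, hu, hue, hpath⟩ := ih
          obtain ⟨v, hv, hve⟩ := hget _ (Relation.ReflTransGen.tail hk hst)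
          refine ⟨v, hv, hve, hpath.tail ⟨hu, hv, ?_⟩⟩
          rw [hue, hve]
          exact (M.codeStep_iff eS eB (hc x _ hk)).2 ⟨_, hst, rfl⟩
      obtain ⟨v, hv, hve, hpath⟩ := key
      refine ⟨v, hv, ?_, hpath⟩
      rw [hve, decide_eq_true_iff, ← hacc]
      rfl
    · rintro ⟨v, hv, hacc, hpath⟩
      have key : ∃ k, M.Reachable x k ∧
          (L x.length).getD v (init x.length) = M.code eS eB (B x.length) k := by
        clear hacc hv
        induction hpath with
        | refl =>
          refine ⟨M.initial, Relation.ReflTransGen.refl, ?_⟩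
          rw [List.getD_eq_getElem _ _ (List.idxOf_lt_length_of_mem (hstart x.length)),
            List.getElem_idxOf, hinit_eq]
        | tail _ hst ih =>
          obtain ⟨k, hk, hke⟩ := ih
          have h := hst.2.2
          rw [hke] at h
          obtain ⟨k', hstep', hk'⟩ := (M.codeStep_iff eS eB (hc x _ hk)).1 h
          exact ⟨k', Relation.ReflTransGen.tail hk hstep', hk'.symm⟩
      obtain ⟨k, hk, hke⟩ := key
      refine ⟨k, hk, ?_⟩
      rw [hke, decide_eq_true_iff] at hacc
      exact eS.injective hacc

end TuringMachine

theorem InNL.nonempty_configGraph {A : Language Bool} (h : InNL A) : Nonempty (ConfigGraph A) := by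
  obtain ⟨M, hM⟩ := h
  exact hM.nonempty_configGraph

theorem InL.inNL {A : Language Bool} (h : InL A) : InNL A := by
  obtain ⟨M, -, hM⟩ := h
  exact ⟨M, hM⟩

/-! ### Networks with labelled cells -/

/-- Labels for the cells of a network. The output cell has the label `(0, 0, 0, 0)`, and the cell
of input bit `j` has the label `(1, j, 0, 0)`. -/
abbrev Label := ℕ × ℕ × ℕ × ℕ

/-- A family of networks with labelled cells: the output cell, the input cells, and the cells with
labels in `cells N`. -/
structure Layout where
  cells : ℕ → List Label
  deps : ℕ → Label → List Label
  kind : ℕ → Label → ℕ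
  loc : ℕ → Label → List Bool → Bool
  iters : ℕ → ℕ
  computable_cells : Computable cells
  computable_deps : Computable fun q : ℕ × Label => deps q.1 q.2
  computable_kind : Computable fun q : ℕ × Label => kind q.1 q.2
  computable_loc : Computable fun q : ℕ × Label × List Bool => loc q.1 q.2.1 q.2.2
  computable_iters : Computable iters

namespace Layout

variable (L : Layout)

/-- The labels of all cells. -/
def labels (N : ℕ) : List Label :=
  (0, 0, 0, 0) :: ((List.range N).map (fun j => (1, j, 0, 0)) ++ L.cells N)

theorem mem_labels {N : ℕ} {l : Label} :
    l ∈ L.labels N ↔ l = (0, 0, 0, 0) ∨ (∃ j < N, l = (1, j, 0, 0)) ∨ l ∈ L.cells N := by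
  simp [labels, eq_comm]

open Classical in
/-- The value of the cell with label `l` after `t` iterations on input `x`. -/
noncomputable def val (O : ℕ → Language Bool) (x : List Bool) : ℕ → Label → Bool
  | 0, l => if l.1 = 1 then x.getD l.2.1 false else false
  | t + 1, l =>
    if l.1 = 1 then x.getD l.2.1 false
    else if L.kind x.length l = 0 then
      L.loc x.length l ((L.deps x.length l).map (val O x t))
    else decide ((L.deps x.length l).map (val O x t) ∈ O (L.kind x.length l - 1))

theorem val_input (O : ℕ → Language Bool) (x : List Bool) (t j : ℕ) :
    L.val O x t (1, j, 0, 0) = x.getD j false := by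
  cases t <;> simp [val]

theorem val_zero (O : ℕ → Language Bool) (x : List Bool) {l : Label} (hl : l.1 ≠ 1) :
    L.val O x 0 l = false := by
  simp [val, hl]

theorem val_succ_local (O : ℕ → Language Bool) (x : List Bool) (t : ℕ) {l : Label} (hl : l.1 ≠ 1)
    (hk : L.kind x.length l = 0) : L.val O x (t + 1) l =
      L.loc x.length l ((L.deps x.length l).map (L.val O x t)) := by
  simp [val, hl, hk]

theorem val_succ_oracle (O : ℕ → Language Bool) (x : List Bool) (t k : ℕ) {l : Label}
    (hl : l.1 ≠ 1) (hk : L.kind x.length l = k + 1) : L.val O x (t + 1) l = true ↔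
      (L.deps x.length l).map (L.val O x t) ∈ O k := by
  simp [val, hl, hk]

theorem computable_labels : Computable L.labels := by
  have := L.computable_cells
  unfold labels
  fun_prop

/-- The network without the labels. -/
def network : Network where
  size N := (L.labels N).length
  deps N v := if 1 ≤ v ∧ v ≤ N then [v] else
    (L.deps N ((L.labels N).getD v (0, 0, 0, 0))).map fun l => (L.labels N).idxOf l
  kind N v := if 1 ≤ v ∧ v ≤ N then 0 else L.kind N ((L.labels N).getD v (0, 0, 0, 0))
  loc N v bits := if 1 ≤ v ∧ v ≤ N then bits.headD false else
    L.loc N ((L.labels N).getD v (0, 0, 0, 0)) bits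
  iters := L.iters
  computable_size := by
    have := L.computable_labels
    fun_prop
  computable_deps := by
    have h1 := L.computable_labels
    have h2 := L.computable_deps
    fun_prop
  computable_kind := by
    have h1 := L.computable_labels
    have h2 := L.computable_kind
    fun_prop
  computable_loc := by
    have h1 := L.computable_labels
    have h2 := L.computable_loc
    fun_prop
  computable_iters := L.computable_iters

theorem idxOf_input {N j : ℕ} (hj : j < N) : (L.labels N).idxOf (1, j, 0, 0) = j + 1 := by
  have h1 : ((1, j, 0, 0) : Label) ∈ (List.range N).map fun j => ((1, j, 0, 0) : Label) :=
    List.mem_map.2 ⟨j, List.mem_range.2 hj, rfl⟩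
  have hnd : ((List.range N).map fun j => ((1, j, 0, 0) : Label)).Nodup :=
    List.nodup_range.map fun a b h => by simpa using h
  unfold labels
  rw [List.idxOf_cons_ne _ (by simp), List.idxOf_append_of_mem h1]
  congr 1
  have h2 := hnd.idxOf_getElem j (by simpa using hj)
  simpa using h2

theorem idxOf_cell {N : ℕ} {l : Label} (h0 : l ≠ (0, 0, 0, 0)) (h1 : l.1 ≠ 1) :
    N < (L.labels N).idxOf l := by
  unfold labels
  rw [List.idxOf_cons_ne _ (Ne.symm h0), List.idxOf_append_of_notMem]
  · simp
  · simp only [List.mem_map, not_exists, not_and]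
    rintro j - rfl
    exact h1 rfl

theorem idxOf_output (N : ℕ) : (L.labels N).idxOf (0, 0, 0, 0) = 0 := by
  unfold labels
  exact List.idxOf_cons_self

/-- Removing the labels does not change the values. -/
theorem network_val (h2 : ∀ N, ∀ l ∈ L.cells N, 2 ≤ l.1)
    (hdeps : ∀ N, ∀ l ∈ L.labels N, l.1 ≠ 1 → ∀ l' ∈ L.deps N l, l' ∈ L.labels N)
    (O : ℕ → Language Bool) (x : List Bool) (t : ℕ) {l : Label} (hl : l ∈ L.labels x.length) :
    L.network.val O x t ((L.labels x.length).idxOf l) = L.val O x t l := by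
  induction t generalizing l with
  | zero =>
    rcases L.mem_labels.1 hl with rfl | ⟨j, hj, rfl⟩ | hc
    · rw [idxOf_output]
      simp [Network.val, val]
    · rw [idxOf_input L hj]
      simp [Network.val, val]
    · have h3 := h2 _ _ hc
      have := L.idxOf_cell (N := x.length) (l := l) (by rintro rfl; simp at h3) (by omega)
      rw [val_zero _ _ _ (by omega)]
      simp only [Network.val]
      rw [List.getD_eq_default]
      simpa using this
  | succ t ih =>
    have hget : (L.labels x.length).getD ((L.labels x.length).idxOf l) (0, 0, 0, 0) = l := by
      rw [List.getD_eq_getElem _ _ (List.idxOf_lt_length_of_mem hl), List.getElem_idxOf]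
    rcases L.mem_labels.1 hl with hc | ⟨j, hj, rfl⟩ | hc
    rotate_left
    · have h3 := ih hl
      rw [idxOf_input L hj] at h3 ⊢
      rw [val_input] at h3 ⊢
      rw [← h3]
      have h4 : 1 ≤ j + 1 ∧ j + 1 ≤ x.length := ⟨by omega, hj⟩
      simp [Network.val, Network.cell, network, h4]
    all_goals
      have hne : ¬ (1 ≤ (L.labels x.length).idxOf l ∧
          (L.labels x.length).idxOf l ≤ x.length) := by
        first
        | rw [hc, idxOf_output]
          omega
        | have h3 := h2 _ _ hc
          have := L.idxOf_cell (N := x.length) (l := l) (by rintro rfl; simp at h3) (by omega)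
          omega
      have hl1 : l.1 ≠ 1 := by
        first
        | rw [hc]
          simp
        | have h3 := h2 _ _ hc
          omega
      have hmap : (L.deps x.length l).map
          (fun l' => L.network.val O x t ((L.labels x.length).idxOf l')) =
          (L.deps x.length l).map (L.val O x t) :=
        List.map_congr_left fun l' hl' => ih (hdeps _ _ hl hl1 _ hl')
      have h5 : L.network.val O x (t + 1) ((L.labels x.length).idxOf l) =
          L.network.cell O x.length ((L.labels x.length).idxOf l)
            ((L.deps x.length l).map (L.val O x t)) := by
        rw [← hmap]
        simp only [Network.val]
        congr 1
        simp only [network, if_neg hne, hget, List.map_map]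
        rfl
      have h6 : L.network.kind x.length ((L.labels x.length).idxOf l) = L.kind x.length l := by
        simp only [network, if_neg hne, hget]
      have h7 : ∀ bits, L.network.loc x.length ((L.labels x.length).idxOf l) bits =
          L.loc x.length l bits := by
        intro bits
        simp only [network, if_neg hne, hget]
      rw [h5]
      simp only [Network.cell, val, if_neg hl1]
      rw [h6, h7]

/-- Requirements on a layout under which it gives rise to an MPC algorithm for `A`. -/
theorem exists_decides {O : ℕ → Language Bool} {d e : ℕ} {A : Language Bool}
    (h2 : ∀ N, ∀ l ∈ L.cells N, 2 ≤ l.1)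
    (hdeps : ∀ N, ∀ l ∈ L.labels N, l.1 ≠ 1 → ∀ l' ∈ L.deps N l, l' ∈ L.labels N)
    (hcells : ∀ N, (L.cells N).length ≤ (N + 2) ^ e)
    (hfan : ∀ N, ∀ l ∈ L.labels N, l.1 ≠ 1 → L.kind N l = 0 → (L.deps N l).length ≤ fan d N)
    (hlen : ∀ N, ∀ l ∈ L.labels N, l.1 ≠ 1 → (L.deps N l).length ≤ (N + 2) ^ e)
    (hA : ∀ x, x ∈ A ↔ L.val O x (L.iters x.length) (0, 0, 0, 0) = true) :
    L.network.Decides O d (e + 2) A := by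
  have hget : ∀ N v, v < (L.labels N).length → ¬ (1 ≤ v ∧ v ≤ N) →
      (L.labels N).getD v (0, 0, 0, 0) ∈ L.labels N ∧
      ((L.labels N).getD v (0, 0, 0, 0)).1 ≠ 1 := by
    intro N v hv hne
    rw [List.getD_eq_getElem _ _ hv]
    refine ⟨List.getElem_mem hv, ?_⟩
    rcases v with _ | v
    · simp [labels]
    · have hvN : N ≤ v := by omega
      have hmem : (L.labels N)[v + 1] ∈ L.cells N := by
        simp only [labels, List.getElem_cons_succ]
        rw [List.getElem_append_right (by simpa using hvN)]
        exact List.getElem_mem _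
      have := h2 _ _ hmem
      omega
  have hpow : ∀ N, (N + 2) ^ e ≤ (N + 2) ^ (e + 2) := fun N =>
    Nat.pow_le_pow_right (by omega) (by omega)
  refine ⟨fun N => ?_, fun N => ?_, fun N v hv u hu => ?_, fun N v hv hk => ?_,
    fun N v hv => ?_, fun x => ?_⟩
  · simp [network, labels]
  · simp only [network, labels, List.length_cons, List.length_append, List.length_map,
      List.length_range]
    have h3 := hcells N
    have h4 : 1 ≤ (N + 2) ^ e := Nat.one_le_pow _ _ (by omega)
    have h5 : (N + 2) ^ e * (N + 2) ≤ (N + 2) ^ (e + 2) := by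
      rw [← pow_succ]
      exact Nat.pow_le_pow_right (by omega) (by omega)
    have h6 := Nat.mul_le_mul_right (N + 1) h4
    have h7 : (N + 2) ^ e * (N + 2) = (N + 2) ^ e * (N + 1) + (N + 2) ^ e := by ring
    omega
  · simp only [network] at hv hu ⊢
    split_ifs at hu with h
    · rw [List.mem_singleton] at hu
      rwa [hu]
    · obtain ⟨l, hl, rfl⟩ := List.mem_map.1 hu
      exact List.idxOf_lt_length_of_mem (hdeps N _ (hget N v hv h).1 (hget N v hv h).2 _ hl)
  · simp only [network] at hv hk ⊢
    split_ifs at hk ⊢ with h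
    · exact fan_pos d N
    · rw [List.length_map]
      exact hfan N _ (hget N v hv h).1 (hget N v hv h).2 hk
  · simp only [network] at hv ⊢
    split_ifs with h
    · exact Nat.one_le_pow _ _ (by omega)
    · rw [List.length_map]
      exact (hlen N _ (hget N v hv h).1 (hget N v hv h).2).trans (hpow N)
  · rw [hA, ← network_val L h2 hdeps O x _ (l := (0, 0, 0, 0)) (by simp [labels]), idxOf_output]
    rfl

end Layout

/-! ### Reachability in logarithmically many rounds -/

/-- If there is a walk from `u` to `v` in a graph on the vertices below `V`, then there is one with
fewer than `V` steps. -/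
theorem exists_walk_lt {R : ℕ → ℕ → Prop} {V : ℕ} (hR : ∀ a b, R a b → b < V) {u v : ℕ}
    (hu : u < V) (h : Relation.ReflTransGen R u v) :
    ∃ n < V, ∃ w : ℕ → ℕ, w 0 = u ∧ w n = v ∧ ∀ i < n, R (w i) (w (i + 1)) := by
  have hex : ∃ n, ∃ w : ℕ → ℕ, w 0 = u ∧ w n = v ∧ ∀ i < n, R (w i) (w (i + 1)) := by
    induction h with
    | refl => exact ⟨0, fun _ => u, rfl, rfl, fun i hi => absurd hi (Nat.not_lt_zero i)⟩
    | @tail b c _ hbc ih =>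
      obtain ⟨n, w, h0, hn, hw⟩ := ih
      refine ⟨n + 1, fun i => if i ≤ n then w i else c, by simp [h0], by simp, fun i hi => ?_⟩
      rcases Nat.lt_succ_iff_lt_or_eq.1 hi with h | rfl
      · simpa [h.le, Nat.succ_le_of_lt h] using hw i h
      · simpa [hn] using hbc
  classical
  obtain ⟨w, h0, hn, hw⟩ := Nat.find_spec hex
  refine ⟨Nat.find hex, ?_, w, h0, hn, hw⟩
  by_contra hlarge
  have hwV : ∀ i ∈ Finset.range (V + 1), w i ∈ Finset.range V := by
    intro i hi
    rw [Finset.mem_range] at hi ⊢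
    rcases i with _ | i
    · rwa [h0]
    · exact hR _ _ (hw i (by omega))
  obtain ⟨i, hi, j, hj, hij, hwij⟩ := Finset.exists_ne_map_eq_of_card_lt_of_maps_to
    (by simp) hwV
  rw [Finset.mem_range] at hi hj
  -- a walk of minimal length visits no vertex twice
  have key : ∀ i j, i < j → j < V + 1 → w i = w j → False := by
    intro i j hij hj hwij
    refine Nat.find_min hex (m := Nat.find hex - (j - i)) (by omega)
      ⟨fun k => if k ≤ i then w k else w (k + (j - i)), by simp [h0], ?_, fun k hk => ?_⟩
    · simp only
      split_ifs with hle
      · have h1 : Nat.find hex = j := by omega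
        have h2 : Nat.find hex - (j - i) = i := by omega
        rw [h2, hwij, ← h1, hn]
      · rw [Nat.sub_add_cancel (by omega), hn]
    · simp only
      rcases lt_trichotomy k i with h | rfl | h
      · rw [if_pos h.le, if_pos (Nat.succ_le_of_lt h)]
        exact hw k (by omega)
      · rw [if_pos le_rfl, if_neg (by omega), hwij]
        have := hw j (by omega)
        rwa [show k + 1 + (j - k) = j + 1 by omega]
      · rw [if_neg (by omega), if_neg (by omega), show k + 1 + (j - i) = k + (j - i) + 1 by omega]
        exact hw _ (by omega)
  rcases lt_or_gt_of_ne hij with h | h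
  · exact key i j h hj hwij
  · exact key j i h hi hwij.symm

namespace ConfigGraph

variable {A : Language Bool} (G : ConfigGraph A)

/-- Cell `(4, u, w, 0)` finds out whether `w` can be reached from `u`, by repeated squaring: cell
`(2, u, w, p)` checks whether this is possible via `p`, and cell `(3, u, w, 0)` asks for the
disjunction over all `p`. The output is the disjunction over all accepting vertices. -/
def layout : Layout where
  cells N := (List.range (G.size N)).flatMap fun u => (List.range (G.size N)).flatMap fun w =>
    (3, u, w, 0) :: (4, u, w, 0) :: (List.range (G.size N)).map fun p => (2, u, w, p)
  deps N l :=
    if l.1 = 0 then ((List.range (G.size N)).filter fun v => G.accept N v).map fun v =>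
      (4, G.start N, v, 0)
    else if l.1 = 2 then [(4, l.2.1, l.2.2.2, 0), (4, l.2.2.2, l.2.2.1, 0)]
    else if l.1 = 3 then (List.range (G.size N)).map fun p => (2, l.2.1, l.2.2.1, p)
    else (3, l.2.1, l.2.2.1, 0) :: if 1 ≤ G.pos N l.2.1 ∧ G.pos N l.2.1 ≤ N then
      [(1, G.pos N l.2.1 - 1, 0, 0)] else []
  kind _ l := if l.1 = 0 ∨ l.1 = 3 then 1 else 0
  loc N l bits := if l.1 = 2 then bits.getD 0 false && bits.getD 1 false else
    (decide (l.2.1 = l.2.2.1) || G.edge N l.2.1 l.2.2.1 (bits.getD 1 false)) || bits.getD 0 false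
  iters N := 3 * Nat.clog 2 (G.size N) + 2
  computable_cells := by
    have := G.computable_size
    fun_prop
  computable_deps := by
    have h1 := G.computable_size
    have h2 := G.computable_accept
    have h3 := G.computable_start
    have h4 := G.computable_pos
    fun_prop
  computable_kind := by fun_prop
  computable_loc := by
    have := G.computable_edge
    fun_prop
  computable_iters := by
    have := G.computable_size
    fun_prop

theorem mem_cells {N : ℕ} {l : Label} : l ∈ G.layout.cells N ↔
    ∃ u < G.size N, ∃ w < G.size N, l = (3, u, w, 0) ∨ l = (4, u, w, 0) ∨
      ∃ p < G.size N, l = (2, u, w, p) := by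
  simp [layout, eq_comm]

/-- The adjacency relation on input `x`. -/
def Adj (x : List Bool) (u v : ℕ) : Prop :=
  u < G.size x.length ∧ v < G.size x.length ∧
    G.edge x.length u v ((false :: x).getD (G.pos x.length u) false) = true

variable (O : ℕ → Language Bool)

theorem val_leaf (x : List Bool) (t u w p : ℕ) :
    G.layout.val O x (t + 1) (2, u, w, p) =
      (G.layout.val O x t (4, u, p, 0) && G.layout.val O x t (4, p, w, 0)) := by
  rw [Layout.val_succ_local _ _ _ _ (by simp) (by simp [layout])]
  simp [layout]

theorem val_or (hO : O 0 = orLanguage) (x : List Bool) (t u w : ℕ) :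
    G.layout.val O x (t + 1) (3, u, w, 0) = true ↔
      ∃ p < G.size x.length, G.layout.val O x t (2, u, w, p) = true := by
  rw [Layout.val_succ_oracle _ _ _ _ 0 (by simp) (by simp [layout]), hO, mem_orLanguage]
  simp [layout]

theorem val_output (hO : O 0 = orLanguage) (x : List Bool) (t : ℕ) :
    G.layout.val O x (t + 1) (0, 0, 0, 0) = true ↔
      ∃ v < G.size x.length, G.accept x.length v = true ∧
        G.layout.val O x t (4, G.start x.length, v, 0) = true := by
  rw [Layout.val_succ_oracle _ _ _ _ 0 (by simp) (by simp [layout]), hO, mem_orLanguage]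
  simp [layout, and_assoc]

theorem val_reach (x : List Bool) (t : ℕ) {u w : ℕ} (hu : u < G.size x.length)
    (hw : w < G.size x.length) :
    G.layout.val O x (t + 1) (4, u, w, 0) = true ↔
      u = w ∨ G.Adj x u w ∨ G.layout.val O x t (3, u, w, 0) = true := by
  rw [Layout.val_succ_local _ _ _ _ (by simp) (by simp [layout])]
  have hbit : (List.map (G.layout.val O x t) (G.layout.deps x.length (4, u, w, 0))).getD 1 false =
      (false :: x).getD (G.pos x.length u) false := by
    generalize hp : G.pos x.length u = p
    rcases p with _ | p
    · simp [layout, hp]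
    · by_cases hlt : p < x.length
      · simp [layout, hp, hlt, Layout.val_input, Nat.succ_le_of_lt hlt]
      · have : ¬ p + 1 ≤ x.length := by omega
        simp [layout, hp, this]
  have h0 : (List.map (G.layout.val O x t) (G.layout.deps x.length (4, u, w, 0))).getD 0 false =
      G.layout.val O x t (3, u, w, 0) := by
    simp [layout]
  generalize List.map (G.layout.val O x t) (G.layout.deps x.length (4, u, w, 0)) = l at hbit h0
  generalize G.layout.val O x t (3, u, w, 0) = c at h0
  simp only [layout, hbit, h0]
  simp [Adj, hu, hw, or_assoc]

theorem reach_of_val (hO : O 0 = orLanguage) (x : List Bool) (t : ℕ) {u w : ℕ}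
    (hu : u < G.size x.length) (hw : w < G.size x.length)
    (h : G.layout.val O x t (4, u, w, 0) = true) : Relation.ReflTransGen (G.Adj x) u w := by
  induction t using Nat.strong_induction_on generalizing u w with
  | _ t ih =>
    rcases t with _ | t
    · rw [Layout.val_zero _ _ _ (by simp)] at h
      exact absurd h (by simp)
    rcases (G.val_reach O x t hu hw).1 h with rfl | h | h
    · exact Relation.ReflTransGen.refl
    · exact Relation.ReflTransGen.single h
    rcases t with _ | t
    · rw [Layout.val_zero _ _ _ (by simp)] at h
      exact absurd h (by simp)
    obtain ⟨p, hp, h⟩ := (G.val_or O hO x t u w).1 h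
    rcases t with _ | t
    · rw [Layout.val_zero _ _ _ (by simp)] at h
      exact absurd h (by simp)
    rw [val_leaf, Bool.and_eq_true] at h
    exact (ih t (by omega) hu hp h.1).trans (ih t (by omega) hp hw h.2)

/-- Each squaring takes three iterations: a walk of length at most `2 ^ k` is found after
`3 * k + 1` iterations, whatever the number of iterations that follow. -/
theorem val_of_walk (hO : O 0 = orLanguage) (x : List Bool) (k : ℕ) {t n : ℕ} {w : ℕ → ℕ}
    (hn : n ≤ 2 ^ k) (ht : 3 * k + 1 ≤ t) (h0 : w 0 < G.size x.length)
    (hw : ∀ i < n, G.Adj x (w i) (w (i + 1))) :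
    G.layout.val O x t (4, w 0, w n, 0) = true := by
  have hV : ∀ (w : ℕ → ℕ) (n : ℕ), w 0 < G.size x.length →
      (∀ i < n, G.Adj x (w i) (w (i + 1))) → ∀ i ≤ n, w i < G.size x.length := by
    intro w n h0 hw i hi
    rcases i with _ | i
    · exact h0
    · exact (hw i (by omega)).2.1
  induction k generalizing t n w with
  | zero =>
    obtain ⟨t, rfl⟩ := Nat.exists_eq_add_of_le' ht
    refine (G.val_reach O x _ h0 (hV w n h0 hw n le_rfl)).2 ?_
    rcases (by simpa using hn : n ≤ 1).lt_or_eq with h | rfl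
    · left
      rw [Nat.lt_one_iff.1 h]
    · exact Or.inr (Or.inl (hw 0 one_pos))
  | succ k ih =>
    obtain ⟨s, rfl⟩ := Nat.exists_eq_add_of_le' (show 3 ≤ t by omega)
    have hm : min n (2 ^ k) ≤ n := min_le_left _ _
    have hmV := hV w n h0 hw _ hm
    refine (G.val_reach O x (s + 2) h0 (hV w n h0 hw n le_rfl)).2 (Or.inr (Or.inr ?_))
    refine (G.val_or O hO x (s + 1) _ _).2 ⟨w (min n (2 ^ k)), hmV, ?_⟩
    rw [val_leaf, Bool.and_eq_true]
    refine ⟨ih (min_le_right _ _) (by omega) h0 fun i hi => hw i (by omega), ?_⟩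
    have h2 := ih (t := s) (n := n - min n (2 ^ k)) (w := fun i => w (min n (2 ^ k) + i))
      (by rw [pow_succ] at hn; omega) (by omega) hmV
      (fun i hi => hw (min n (2 ^ k) + i) (by omega))
    simpa [Nat.add_sub_cancel' hm] using h2

theorem exists_layout_decides (d : ℕ) :
    ∃ e, G.layout.network.Decides (fun _ => orLanguage) d e A := by
  obtain ⟨e, he⟩ := G.exists_size_le
  have h1 : ∀ N, 1 ≤ (N + 2) ^ e := fun N => Nat.one_le_pow _ _ (by omega)
  have hpow : ∀ N a, a ≤ 3 * e + 2 → (N + 2) ^ a ≤ (N + 2) ^ (3 * e + 2) := fun N a ha =>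
    Nat.pow_le_pow_right (by omega) ha
  refine ⟨3 * e + 2 + 2, G.layout.exists_decides (e := 3 * e + 2) (fun N l hl => ?_)
    (fun N l hl hne l' hl' => ?_) (fun N => ?_) (fun N l hl hne hk => ?_)
    (fun N l hl hne => ?_) (fun x => ?_)⟩
  · obtain ⟨u, -, w, -, rfl | rfl | ⟨p, -, rfl⟩⟩ := G.mem_cells.1 hl <;> simp
  · rw [Layout.mem_labels]
    rcases (G.layout.mem_labels).1 hl with rfl | ⟨j, -, rfl⟩ | hl
    · simp only [layout, if_true, List.mem_map, List.mem_filter, List.mem_range] at hl'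
      obtain ⟨v, ⟨hv, -⟩, rfl⟩ := hl'
      exact Or.inr (Or.inr (G.mem_cells.2 ⟨_, G.start_lt N, v, hv, Or.inr (Or.inl rfl)⟩))
    · exact absurd rfl hne
    · obtain ⟨u, hu, w, hw, rfl | rfl | ⟨p, hp, rfl⟩⟩ := G.mem_cells.1 hl
      · simp [layout] at hl'
        obtain ⟨p, hp, rfl⟩ := hl'
        exact Or.inr (Or.inr (G.mem_cells.2 ⟨u, hu, w, hw, Or.inr (Or.inr ⟨p, hp, rfl⟩)⟩))
      · simp [layout] at hl'
        rcases hl' with rfl | hl'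
        · exact Or.inr (Or.inr (G.mem_cells.2 ⟨u, hu, w, hw, Or.inl rfl⟩))
        · exact Or.inr (Or.inl ⟨_, by omega, hl'.2⟩)
      · simp [layout] at hl'
        rcases hl' with rfl | rfl
        · exact Or.inr (Or.inr (G.mem_cells.2 ⟨u, hu, p, hp, Or.inr (Or.inl rfl)⟩))
        · exact Or.inr (Or.inr (G.mem_cells.2 ⟨p, hp, w, hw, Or.inr (Or.inl rfl)⟩))
  · have h2 : (G.layout.cells N).length = G.size N * (G.size N * (G.size N + 2)) := by
      simp [layout, List.length_flatMap]
    rw [h2]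
    calc G.size N * (G.size N * (G.size N + 2))
        ≤ (N + 2) ^ e * ((N + 2) ^ e * ((N + 2) ^ e * (N + 2) ^ 2)) := by
          have h3 := he N
          have h5 : G.size N + 2 ≤ (N + 2) ^ e * (N + 2) ^ 2 := by
            have h4 := h1 N
            have h5 : (N + 2) ^ e * 4 ≤ (N + 2) ^ e * (N + 2) ^ 2 :=
              Nat.mul_le_mul_left _ (Nat.pow_le_pow_left (by omega : 2 ≤ N + 2) 2)
            omega
          gcongr
      _ = (N + 2) ^ (3 * e + 2) := by ring
  · have h2 : 2 ≤ fan d N := by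
      unfold fan
      rw [pow_succ]
      have : 1 ≤ 2 ^ (Nat.log 2 (N + 2) / d) := Nat.one_le_two_pow
      omega
    refine le_trans ?_ h2
    simp only [layout] at hk ⊢
    split_ifs at hk ⊢ <;> simp_all
  · have h2 : (G.layout.deps N l).length ≤ max (G.size N) 2 := by
      simp only [layout]
      split_ifs
      · rw [List.length_map]
        refine (List.length_filter_le _ _).trans ?_
        simp
      all_goals simp
    refine h2.trans (max_le ((he N).trans (hpow N e (by omega))) ?_)
    exact le_trans (by simp) (hpow N 1 (by omega))
  · rw [G.mem_iff]
    change _ ↔ G.layout.val _ x (3 * Nat.clog 2 (G.size x.length) + 1 + 1) _ = true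
    rw [G.val_output _ rfl]
    refine exists_congr fun v => and_congr_right fun hv => and_congr_right fun _ => ?_
    constructor
    · intro hpath
      obtain ⟨n, hn, w, h0, rfl, hw⟩ :=
        exists_walk_lt (R := G.Adj x) (fun a b h => h.2.1) (G.start_lt _) hpath
      have := G.val_of_walk (fun _ => orLanguage) rfl x (Nat.clog 2 (G.size x.length)) (w := w)
        (hn.le.trans (Nat.le_pow_clog (by norm_num) _)) le_rfl (h0 ▸ G.start_lt _) hw
      rwa [h0] at this
    · exact G.reach_of_val _ rfl x _ (G.start_lt _) hv

end ConfigGraph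

/-- Problems in `NL` can be solved in a logarithmic number of rounds. -/
theorem InNL.solvable_log {A : Language Bool} (h : InNL A) :
    SolvableInRounds (fun N => Real.log ((N : ℝ) + 2)) A := by
  obtain ⟨G⟩ := h.nonempty_configGraph
  intro ε h0 h1
  obtain ⟨d, hd, hdε⟩ := exists_one_div_le h1
  obtain ⟨e, he⟩ := G.exists_layout_decides d
  obtain ⟨P, hreg, hdec, J, ρ, -, hrounds, C, k, hC, hρ⟩ :=
    he.exists_alg (f := fun _ => 1) (fun _ => one_pos) h0 h1 hd hdε fun ε' h0' h1' =>
      (solvable_orLanguage (C := 1) (fun _ => by norm_num)).solves h0' h1'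
  obtain ⟨a, ha⟩ := G.exists_size_le
  refine ⟨P, hreg, hdec, (3 * a * 4 + 4) * (J + 2 + C) + 2, fun N => ?_⟩
  have hlog2 : (1 : ℝ) / 2 ≤ Real.log ((N : ℝ) + 2) := by
    have h2 := Real.log_two_gt_d9
    have h3 : Real.log 2 ≤ Real.log ((N : ℝ) + 2) :=
      Real.log_le_log (by norm_num) (by linarith [(Nat.cast_nonneg N : (0 : ℝ) ≤ N)])
    linarith
  have hclog : Nat.clog 2 (G.size N) ≤ a * (Nat.log 2 (N + 2) + 1) := by
    refine Nat.clog_le_of_le_pow ((ha N).trans ?_)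
    rw [mul_comm, pow_mul]
    exact Nat.pow_le_pow_left (Nat.lt_pow_succ_log_self (by norm_num) _).le _
  have hiters : (G.layout.network.iters N : ℝ) ≤ (3 * a * 4 + 4) * Real.log ((N : ℝ) + 2) := by
    have h2 : (G.layout.network.iters N : ℝ) ≤ 3 * (a * (Nat.log 2 (N + 2) + 1)) + 2 := by
      change ((3 * Nat.clog 2 (G.size N) + 2 : ℕ) : ℝ) ≤ _
      push_cast
      have : (Nat.clog 2 (G.size N) : ℝ) ≤ a * (Nat.log 2 (N + 2) + 1) := by exact_mod_cast hclog
      linarith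
    have h3 := natLog_le_log N
    have h4 : (0 : ℝ) ≤ a := Nat.cast_nonneg a
    have h5 : (Nat.log 2 (N + 2) : ℝ) + 1 ≤ 4 * Real.log ((N : ℝ) + 2) := by linarith
    have h6 := mul_le_mul_of_nonneg_left h5 h4
    linarith
  obtain ⟨m, -, hm⟩ := hρ N
  have hJ : (0 : ℝ) ≤ J := Nat.cast_nonneg J
  rw [hrounds]
  push_cast
  have h2 : (G.layout.network.iters N : ℝ) * (J + 1 + ρ N + 1) ≤
      (3 * a * 4 + 4) * Real.log ((N : ℝ) + 2) * (J + 2 + C) := by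
    refine mul_le_mul hiters (by linarith) (by positivity) ?_
    have : (0 : ℝ) ≤ a := Nat.cast_nonneg a
    exact mul_nonneg (by positivity) (by linarith)
  linarith

/-! ### Computability of log-space functions and of uniform circuits -/

theorem SolvableInRounds.exists_computable {f : ℕ → ℝ} {A : Language Bool}
    (h : SolvableInRounds f A) :
    ∃ dec : List Bool → Bool, Computable dec ∧ ∀ x, x ∈ A ↔ dec x = true := by
  obtain ⟨P, hreg, hdec, -⟩ := h (1 / 2) (by norm_num) (by norm_num)
  exact hdec.exists_computable (fun N => (hreg.1 N).2) hreg.capacity_pos fun N => (hreg.1 N).1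

theorem pairIndex_inj {x x' : List Bool} {i i' : ℕ} (h : pairIndex x i = pairIndex x' i') :
    x = x' ∧ i = i' := by
  unfold pairIndex at h
  induction i generalizing i' with
  | zero =>
    rcases i' with _ | i'
    · exact ⟨by simpa using h, rfl⟩
    · simp [List.replicate_succ] at h
  | succ i ih =>
    rcases i' with _ | i'
    · simp [List.replicate_succ] at h
    · simp only [List.replicate_succ, List.cons_append, List.cons.injEq, true_and] at h
      exact ⟨(ih h).1, congrArg _ (ih h).2⟩

theorem computable_pairIndex : Computable fun q : List Bool × ℕ => pairIndex q.1 q.2 := by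
  unfold pairIndex
  fun_prop

theorem pairIndex_mem {p : List Bool → ℕ → Prop} {x : List Bool} {i : ℕ} :
    pairIndex x i ∈ ({y | ∃ x i, y = pairIndex x i ∧ p x i} : Language Bool) ↔ p x i := by
  constructor
  · rintro ⟨x', i', h, hp⟩
    obtain ⟨rfl, rfl⟩ := pairIndex_inj h
    exact hp
  · exact fun hp => ⟨x, i, rfl, hp⟩

/-- The value of a log-space computable function can be found by search, because it can be checked
with decision procedures for the two languages that describe the function. -/
theorem LogSpaceComputable.computable {g : List Bool → List Bool} (hg : LogSpaceComputable g) :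
    Computable g := by
  obtain ⟨-, h1, h2⟩ := hg
  obtain ⟨d₁, hd₁, h1⟩ := h1.inNL.solvable_log.exists_computable
  obtain ⟨d₂, hd₂, h2⟩ := h2.inNL.solvable_log.exists_computable
  have h1' : ∀ x i, d₁ (pairIndex x i) = true ↔ i < (g x).length := fun x i =>
    (h1 _).symm.trans pairIndex_mem
  have h2' : ∀ x i, d₂ (pairIndex x i) = true ↔ (g x)[i]? = some true := fun x i =>
    (h2 _).symm.trans pairIndex_mem
  have hp := computable_pairIndex
  refine computable_of_graph (c := fun x b => !(d₁ (pairIndex x b.length)) &&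
    !((List.range b.length).any fun i => !(d₁ (pairIndex x i)) ||
      !(decide (d₂ (pairIndex x i) = b.getD i false)))) (by fun_prop) fun x b => ?_
  have hlen : ∀ m, (¬ m < (g x).length ∧ ∀ i < m, i < (g x).length) ↔ m = (g x).length := by
    intro m
    constructor
    · rintro ⟨h, h'⟩
      refine le_antisymm (le_of_not_gt fun hlt => ?_) (not_lt.1 h)
      exact lt_irrefl _ (h' _ hlt)
    · rintro rfl
      exact ⟨lt_irrefl _, fun i hi => hi⟩
  have hbit : ∀ i, i < (g x).length → d₂ (pairIndex x i) = (g x).getD i false := by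
    intro i hi
    rw [Bool.eq_iff_iff, h2']
    simp [hi]
  simp only [Bool.and_eq_true, Bool.not_eq_true', List.any_eq_false, List.mem_range,
    Bool.or_eq_true, not_or, Bool.not_eq_false, decide_eq_false_iff_not, not_not]
  rw [← Bool.not_eq_true, h1']
  constructor
  · rintro ⟨h, h'⟩
    have hl := (hlen _).1 ⟨h, fun i hi => (h1' x i).1 (h' i hi).1⟩
    refine List.ext_getElem hl fun i hi hi' => ?_
    have := (h' i hi).2
    rw [hbit i hi', List.getD_eq_getElem _ _ hi, List.getD_eq_getElem _ _ hi'] at this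
    exact this.symm
  · rintro rfl
    exact ⟨lt_irrefl _, fun i hi => ⟨(h1' x i).2 hi, hbit i hi⟩⟩

/-- A gate as a number for its type and a list of natural numbers. -/
def Gate.code : Gate → ℕ × List ℕ
  | input i => (0, [i])
  | const b => (1, [b.toNat])
  | not j => (2, [j])
  | and j k => (3, [j, k])
  | or j k => (4, [j, k])
  | oracle js => (5, js)

/-- The natural numbers that the bit string for a gate encodes. -/
def codeNats (c : ℕ × List ℕ) : List ℕ := if c.1 = 5 then 5 :: c.2.length :: c.2 else c.1 :: c.2

/-- Whether the second component of a code has the length that the first one requires. -/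
def validCode (c : ℕ × List ℕ) : Bool :=
  decide (c.1 = 5) || decide (c.2.length = if c.1 < 3 then 1 else 2)

theorem Gate.validCode_code (g : Gate) : validCode g.code = true := by
  cases g <;> simp [Gate.code, validCode]

theorem Gate.encode_eq (g : Gate) : g.encode = (codeNats g.code).flatMap encodeNat := by
  cases g <;> simp [Gate.code, Gate.encode, codeNats]

theorem flatMap_encodeNat_injective : Function.Injective fun l : List ℕ =>
    l.flatMap Gate.encodeNat := by
  intro l
  induction l with
  | nil =>
    intro l' h
    cases l' with
    | nil => rfl
    | cons n l' => simp [Gate.encodeNat] at h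
  | cons m l ih =>
    intro l' h
    cases l' with
    | nil => simp [Gate.encodeNat] at h
    | cons n l' =>
      simp only [List.flatMap_cons, Gate.encodeNat, List.append_assoc, List.singleton_append] at h
      obtain ⟨h1, rfl⟩ := pairIndex_inj h
      rw [ih h1]

/-- The code of a circuit as a sequence of natural numbers is uniquely decodable. -/
theorem eq_of_flatMap_codeNats {l l' : List (ℕ × List ℕ)} (hl : ∀ c ∈ l, validCode c = true)
    (hl' : ∀ c ∈ l', validCode c = true) (h : l.flatMap codeNats = l'.flatMap codeNats) :
    l = l' := by
  have hne : ∀ c, codeNats c ≠ [] := by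
    intro c
    unfold codeNats
    split_ifs <;> simp
  induction l generalizing l' with
  | nil =>
    cases l' with
    | nil => rfl
    | cons n l' =>
      exact absurd (List.append_eq_nil_iff.1 h.symm).1 (hne n)
  | cons m l ih =>
    cases l' with
    | nil => exact absurd (List.append_eq_nil_iff.1 h).1 (hne m)
    | cons n l' =>
      obtain ⟨hm, hlm⟩ := List.forall_mem_cons.1 hl
      obtain ⟨hn, hln⟩ := List.forall_mem_cons.1 hl'
      obtain ⟨k, a⟩ := m
      obtain ⟨k', a'⟩ := n
      have hk : k = k' := by
        have h2 := congrArg List.head? h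
        simp only [List.flatMap_cons, codeNats] at h2
        split_ifs at h2 <;> simp_all
      subst hk
      have hlen : a.length = a'.length := by
        simp only [validCode, Bool.or_eq_true, decide_eq_true_eq] at hm hn
        by_cases h5 : k = 5
        · simp only [List.flatMap_cons, codeNats, h5, if_true, List.cons_append,
            List.cons.injEq] at h
          exact h.2.1
        · rw [hm.resolve_left h5, hn.resolve_left h5]
      have h3 : a ++ l.flatMap codeNats = a' ++ l'.flatMap codeNats := by
        simp only [List.flatMap_cons, codeNats] at h
        split_ifs at h <;> simp_all
      obtain ⟨rfl, h4⟩ := List.append_inj h3 hlen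
      rw [ih hlm hln h4]

/-- The codes of the gates of a log-space uniform family of circuits can be computed. -/
theorem computable_circuit_codes {C : ℕ → Circuit} {g : List Bool → List Bool}
    (hg : LogSpaceComputable g) (h : ∀ n, g (List.replicate n true) = (C n).encode) :
    Computable fun n => (C n).map Gate.code := by
  have h1 := hg.computable
  have h2 : Computable Gate.encodeNat := by
    unfold Gate.encodeNat
    fun_prop
  have h3 : Computable codeNats := by
    unfold codeNats
    fun_prop
  have h4 : Computable validCode := by
    unfold validCode
    fun_prop
  refine computable_of_graph (c := fun n s => !(s.any fun c => !(validCode c)) &&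
    decide ((s.flatMap codeNats).flatMap Gate.encodeNat = g (List.replicate n true)))
    (by fun_prop) fun n s => ?_
  have henc : (C n).encode = (((C n).map Gate.code).flatMap codeNats).flatMap Gate.encodeNat := by
    unfold Circuit.encode
    rw [List.flatMap_map, List.flatMap_assoc]
    exact congrArg (fun F => List.flatMap F (C n)) (funext fun g => g.encode_eq)
  have hvalid : ∀ c ∈ (C n).map Gate.code, validCode c = true := by
    intro c hc
    obtain ⟨g, -, rfl⟩ := List.mem_map.1 hc
    exact g.validCode_code
  rw [Bool.and_eq_true, decide_eq_true_eq, h, henc, Bool.not_eq_true', List.any_eq_false]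
  simp only [Bool.not_eq_true', Bool.not_eq_false]
  constructor
  · rintro ⟨hs, he⟩
    exact eq_of_flatMap_codeNats hs hvalid (flatMap_encodeNat_injective he)
  · rintro rfl
    exact ⟨hvalid, rfl⟩

/-! ### Circuits of logarithmic depth -/

/-- The list whose entries are computed from left to right, each from the previous ones and the
corresponding entry of `l`. -/
def scan {σ γ : Type*} (step : List σ → γ → σ) (l : List γ) : List σ :=
  l.foldl (fun acc c => acc ++ [step acc c]) []

section Scan

variable {σ γ : Type*} (step : List σ → γ → σ)

theorem scan_concat (l : List γ) (c : γ) :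
    scan step (l ++ [c]) = scan step l ++ [step (scan step l) c] := by
  simp [scan]

theorem length_scan (l : List γ) : (scan step l).length = l.length := by
  induction l using List.reverseRecOn with
  | nil => rfl
  | append_singleton l c ih => simp [scan_concat, ih]

theorem scan_take (l : List γ) (t : ℕ) : scan step (l.take t) = (scan step l).take t := by
  induction l using List.reverseRecOn with
  | nil => simp [scan]
  | append_singleton l c ih =>
    rw [scan_concat]
    rcases Nat.lt_or_ge l.length t with h | h
    · rw [List.take_of_length_le (by simpa using h), scan_concat, List.take_of_length_le]
      simpa [length_scan] using h
    · rw [List.take_append_of_le_length h, List.take_append_of_le_length (by rwa [length_scan]), ih]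

theorem scan_getD (l : List γ) {t : ℕ} (ht : t < l.length) (a : σ) :
    (scan step l).getD t a = step ((scan step l).take t) l[t] := by
  have h : scan step (l.take (t + 1)) =
      scan step (l.take t) ++ [step (scan step (l.take t)) l[t]] := by
    rw [List.take_succ_eq_append_getElem ht, scan_concat]
  rw [scan_take, scan_take] at h
  have h2 := congrArg (fun l => l.getD t a) h
  have hl : ((scan step l).take t).length = t := by simp [length_scan, ht.le]
  have h3 : ((scan step l).take t ++ [step ((scan step l).take t) l[t]]).getD t a =
      step ((scan step l).take t) l[t] := by
    rw [List.getD_append_right _ _ _ _ hl.le, hl]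
    simp
  have h4 : ((scan step l).take (t + 1)).getD t a = (scan step l).getD t a := by
    simp
  rw [← h4, ← h3]
  exact h2

theorem getD_take {l : List σ} {t j : ℕ} (hj : j < t) (a : σ) :
    (l.take t).getD j a = l.getD j a := by
  simp [hj]

end Scan

theorem computable_scan {α σ γ : Type*} [Primcodable α] [Primcodable σ] [Primcodable γ]
    {step : α → List σ → γ → σ} {l : α → List γ}
    (hs : Computable fun q : α × List σ × γ => step q.1 q.2.1 q.2.2) (hl : Computable l) :
    Computable fun a => scan (step a) (l a) := by
  unfold scan
  fun_prop

/-- The arguments of a gate, in terms of its code. -/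
def codeArgs (c : ℕ × List ℕ) : List ℕ := if c.1 < 2 then [] else c.2

/-- The weight of a gate, in terms of its code. -/
def codeWeight (c : ℕ × List ℕ) : ℕ :=
  if c.1 < 2 then 0 else if c.1 < 5 then 1 else Nat.clog 2 (c.2.length + 1)

/-- The value of a gate that is not an input gate, in terms of its code and of a decision procedure
for the oracle. -/
def codeEval (dec : List Bool → Bool) (vals : List Bool) (c : ℕ × List ℕ) : Bool :=
  if c.1 = 1 then decide (c.2.headD 0 = 1)
  else if c.1 = 2 then !(vals.getD (c.2.getD 0 0) false)
  else if c.1 = 3 then vals.getD (c.2.getD 0 0) false && vals.getD (c.2.getD 1 0) false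
  else if c.1 = 4 then vals.getD (c.2.getD 0 0) false || vals.getD (c.2.getD 1 0) false
  else dec (c.2.map fun j => vals.getD j false)

theorem computable_codeEval {dec : List Bool → Bool} (h : Computable dec) :
    Computable fun q : List Bool × ℕ × List ℕ => codeEval dec q.1 q.2 := by
  unfold codeEval
  fun_prop

theorem Gate.codeArgs_code (g : Gate) : codeArgs g.code = g.args := by cases g <;> rfl

theorem Gate.codeWeight_code (g : Gate) : codeWeight g.code = g.weight := by cases g <;> rfl

theorem Gate.codeEval_code {B : Language Bool} {dec : List Bool → Bool}
    (h : ∀ x, x ∈ B ↔ dec x = true) (x : List Bool) {vals vals' : List Bool} {g : Gate}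
    (hg : g.code.1 ≠ 0) (hv : ∀ j ∈ g.args, vals.getD j false = vals'.getD j false) :
    codeEval dec vals g.code = g.eval B x vals' := by
  cases g with
  | input i => simp [Gate.code] at hg
  | const b => cases b <;> rfl
  | not j =>
    change (!(vals.getD j false)) = !(vals'.getD j false)
    rw [hv j (by simp [args])]
  | and j k =>
    change (vals.getD j false && vals.getD k false) = (vals'.getD j false && vals'.getD k false)
    rw [hv j (by simp [args]), hv k (by simp [args])]
  | or j k =>
    change (vals.getD j false || vals.getD k false) = (vals'.getD j false || vals'.getD k false)
    rw [hv j (by simp [args]), hv k (by simp [args])]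
  | oracle js =>
    have : (js.map fun j => vals.getD j false) = js.map fun j => vals'.getD j false :=
      List.map_congr_left hv
    rw [Bool.eq_iff_iff]
    simp only [codeEval, code, eval, decide_eq_true_eq, this, h]
    simp

theorem Gate.length_args_le (g : Gate) : g.args.length ≤ 2 ^ g.weight := by
  cases g with
  | oracle js => exact (Nat.le_succ _).trans (Nat.le_pow_clog (by norm_num) _)
  | _ => simp [args, weight]

/-- The depths of the gates of a circuit given by the list `cs` of codes. -/
def depthList (cs : List (ℕ × List ℕ)) : List ℕ :=
  scan (fun ds c => codeWeight c + ((codeArgs c).map fun j => ds.getD j 0).foldr max 0) cs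

theorem depthList_map_code (C : Circuit) : depthList (C.map Gate.code) = C.depths := by
  unfold depthList scan Circuit.depths
  rw [List.foldl_map]
  congr 1
  funext ds g
  simp only [g.codeWeight_code, g.codeArgs_code]
  rfl

/-- The depth of gate `t`. -/
def depthOf (cs : List (ℕ × List ℕ)) (t : ℕ) : ℕ := (depthList cs).getD t 0

/-- Gates are grouped into blocks according to their depth; each block comprises `h` consecutive
depths. -/
def block (cs : List (ℕ × List ℕ)) (h t : ℕ) : ℕ := depthOf cs t / h

/-- The inputs, and the oracle gates all of whose arguments are in lower blocks. Such an oracle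
gate is evaluated by a query. -/
def isCut (cs : List (ℕ × List ℕ)) (h t : ℕ) : Bool :=
  decide ((cs.getD t (0, [])).1 = 0) || (decide ((cs.getD t (0, [])).1 = 5) &&
    !((codeArgs (cs.getD t (0, []))).any fun j => decide (block cs h t ≤ block cs h j)))

/-- Whether `j` is a gate whose value is available when gate `t` is evaluated. -/
def isLeaf (cs : List (ℕ × List ℕ)) (h t j : ℕ) : Bool :=
  isCut cs h j || decide (block cs h j < block cs h t)

/-- For each gate, the gates at which a search for its arguments stops that proceeds backwards
and stops as soon as it reaches an available value. -/
def frontierList (cs : List (ℕ × List ℕ)) (h : ℕ) : List (List ℕ) :=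
  scan (fun fs c => (codeArgs c).flatMap fun j =>
    if isLeaf cs h fs.length j = true then [j] else fs.getD j []) cs

/-- The gates whose values determine the value of gate `t`. -/
def frontier (cs : List (ℕ × List ℕ)) (h t : ℕ) : List ℕ := (frontierList cs h).getD t []

/-- Evaluation of the circuit, except that the gates in `F` have the values `bits`. -/
def evalList (dec : List Bool → Bool) (cs : List (ℕ × List ℕ)) (F : List ℕ) (bits : List Bool) :
    List Bool :=
  scan (fun vals c => if vals.length ∈ F then bits.getD (F.idxOf vals.length) false
    else codeEval dec vals c) cs

theorem computable_codeArgs : Computable codeArgs := by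
  unfold codeArgs
  fun_prop

theorem computable_block : Computable fun q : List (ℕ × List ℕ) × ℕ × ℕ =>
    block q.1 q.2.1 q.2.2 := by
  have h1 := computable_codeArgs
  have h2 : Computable codeWeight := by
    unfold codeWeight
    fun_prop
  have h3 : Computable depthList := computable_scan (l := fun cs => cs)
    (step := fun _ ds c => codeWeight c + ((codeArgs c).map fun j => ds.getD j 0).foldr max 0)
    (by fun_prop) (by fun_prop)
  unfold block depthOf
  fun_prop

theorem computable_isCut : Computable fun q : List (ℕ × List ℕ) × ℕ × ℕ =>
    isCut q.1 q.2.1 q.2.2 := by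
  have h1 := computable_codeArgs
  have h2 := computable_block
  unfold isCut
  fun_prop

theorem computable_frontier : Computable fun q : List (ℕ × List ℕ) × ℕ × ℕ =>
    frontier q.1 q.2.1 q.2.2 := by
  have h1 := computable_codeArgs
  have h2 := computable_block
  have h3 := computable_isCut
  have h4 : Computable fun q : List (ℕ × List ℕ) × ℕ × ℕ × ℕ =>
      isLeaf q.1 q.2.1 q.2.2.1 q.2.2.2 := by
    unfold isLeaf
    fun_prop
  have h5 : Computable fun q : (List (ℕ × List ℕ) × ℕ) × List (List ℕ) × ℕ × List ℕ =>
      (codeArgs q.2.2).flatMap fun j =>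
        if isLeaf q.1.1 q.1.2 q.2.1.length j = true then [j] else q.2.1.getD j [] := by
    fun_prop
  have h6 : Computable fun q : List (ℕ × List ℕ) × ℕ => frontierList q.1 q.2 := by
    unfold frontierList
    exact computable_scan h5 (by fun_prop)
  unfold frontier
  fun_prop

theorem computable_evalList {dec : List Bool → Bool} (hdec : Computable dec) :
    Computable fun q : List (ℕ × List ℕ) × List ℕ × List Bool =>
      evalList dec q.1 q.2.1 q.2.2 := by
  have h1 := computable_codeEval hdec
  have h2 : Computable fun q : (List (ℕ × List ℕ) × List ℕ × List Bool) × List Bool × ℕ × List ℕ =>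
      if q.2.1.length ∈ q.1.2.1 then q.1.2.2.getD (q.1.2.1.idxOf q.2.1.length) false
      else codeEval dec q.2.1 q.2.2 := by
    fun_prop
  unfold evalList
  exact computable_scan h2 (by fun_prop)

namespace Circuit

/-- The codes of the gates. -/
abbrev codes (C : Circuit) : List (ℕ × List ℕ) := C.map Gate.code

variable {C : Circuit} {n : ℕ}

theorem getD_codes {t : ℕ} (ht : t < C.length) : C.codes.getD t (0, []) = C[t].code := by
  rw [List.getD_eq_getElem _ _ (by simpa using ht), List.getElem_map]

theorem WellFormed.lt (hC : C.WellFormed n) {t : ℕ} (ht : t < C.length) {j : ℕ}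
    (hj : j ∈ C[t].args) : j < t :=
  hC.2.2 t _ (List.getElem?_eq_getElem ht) j hj

theorem depthOf_arg_le (hC : C.WellFormed n) {t : ℕ} (ht : t < C.length) {j : ℕ}
    (hj : j ∈ C[t].args) : depthOf C.codes j + C[t].weight ≤ depthOf C.codes t := by
  have h2 : t < C.codes.length := by simpa using ht
  have h1 : depthOf C.codes t = C[t].weight +
      (C[t].args.map fun j => ((depthList C.codes).take t).getD j 0).foldr max 0 := by
    unfold depthOf
    rw [← C[t].codeWeight_code, ← C[t].codeArgs_code]
    have := scan_getD (fun ds c => codeWeight c +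
      ((codeArgs c).map fun j => ds.getD j 0).foldr max 0) C.codes h2 0
    rw [List.getElem_map] at this
    exact this
  rw [h1, add_comm]
  refine Nat.add_le_add_left (le_foldr_max (List.mem_map.2 ⟨j, hj, ?_⟩)) _
  exact getD_take (hC.lt ht hj) 0

theorem weight_le_depthOf {t : ℕ} (ht : t < C.length) : C[t].weight ≤ depthOf C.codes t := by
  have h2 : t < C.codes.length := by simpa using ht
  unfold depthOf
  rw [← C[t].codeWeight_code]
  have := scan_getD (fun ds c => codeWeight c +
    ((codeArgs c).map fun j => ds.getD j 0).foldr max 0) C.codes h2 0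
  rw [List.getElem_map] at this
  exact (Nat.le_add_right _ _).trans this.ge

theorem block_arg_le (hC : C.WellFormed n) (h : ℕ) {t : ℕ} (ht : t < C.length) {j : ℕ}
    (hj : j ∈ C[t].args) : block C.codes h j ≤ block C.codes h t :=
  Nat.div_le_div_right ((Nat.le_add_right _ _).trans (depthOf_arg_le hC ht hj))

theorem frontier_eq (hC : C.WellFormed n) (h : ℕ) {t : ℕ} (ht : t < C.length) :
    frontier C.codes h t = C[t].args.flatMap fun j =>
      if isLeaf C.codes h t j = true then [j] else frontier C.codes h j := by
  have h2 : t < C.codes.length := by simpa using ht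
  have h1 := scan_getD (fun fs c => (codeArgs c).flatMap fun j =>
    if isLeaf C.codes h fs.length j = true then [j] else fs.getD j []) C.codes h2 []
  have h3 : ((scan (fun fs c => (codeArgs c).flatMap fun j =>
      if isLeaf C.codes h fs.length j = true then [j] else fs.getD j []) C.codes).take t).length
      = t := by
    simp [length_scan, ht.le]
  rw [List.getElem_map, C[t].codeArgs_code, h3] at h1
  refine h1.trans ?_
  rw [List.flatMap_def, List.flatMap_def]
  refine congrArg _ (List.map_congr_left fun j hj => ?_)
  rw [getD_take (hC.lt ht hj)]
  rfl

/-- The values of the frontier of a gate are available when the gate is evaluated. -/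
theorem mem_frontier (hC : C.WellFormed n) (h : ℕ) {t : ℕ} (ht : t < C.length) {j : ℕ}
    (hj : j ∈ frontier C.codes h t) :
    j < t ∧ isLeaf C.codes h t j = true ∧ block C.codes h j ≤ block C.codes h t := by
  induction t using Nat.strong_induction_on with
  | _ t ih =>
    rw [frontier_eq hC h ht, List.mem_flatMap] at hj
    obtain ⟨i, hi, hj⟩ := hj
    have hit := hC.lt ht hi
    have hle := block_arg_le hC h ht hi
    split_ifs at hj with hleaf
    · rw [List.mem_singleton] at hj
      subst hj
      exact ⟨hit, hleaf, hle⟩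
    · obtain ⟨h1, h2, h3⟩ := ih i hit (hit.trans ht) hj
      have heq : block C.codes h i = block C.codes h t := by
        simp only [isLeaf, Bool.or_eq_true, decide_eq_true_eq, not_or, not_lt] at hleaf
        exact le_antisymm hle hleaf.2
      refine ⟨h1.trans hit, ?_, h3.trans hle⟩
      unfold isLeaf at h2 ⊢
      rwa [← heq]

theorem code_eq_of_isCut {h t : ℕ} (ht : t < C.length) (hcut : isCut C.codes h t = false) :
    C[t].code.1 ≠ 0 ∧ (C[t].code.1 = 5 →
      ∃ j ∈ C[t].args, block C.codes h t ≤ block C.codes h j) := by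
  unfold isCut at hcut
  rw [getD_codes ht, C[t].codeArgs_code] at hcut
  simpa using hcut

/-- The value of a gate that needs no query depends on few values: the number of paths in the
circuit is at most exponential in the height of a block, since the fan-in of an oracle
gate is at most exponential in its weight. -/
theorem length_frontier_le (hC : C.WellFormed n) {h t : ℕ} (ht : t < C.length)
    (hcut : isCut C.codes h t = false) :
    (frontier C.codes h t).length ≤ 2 ^ (depthOf C.codes t % h + 1) := by
  induction t using Nat.strong_induction_on with
  | _ t ih =>
    obtain ⟨-, h5⟩ := code_eq_of_isCut ht hcut
    have hmod : ∀ j ∈ C[t].args, block C.codes h t ≤ block C.codes h j →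
        depthOf C.codes j % h + C[t].weight ≤ depthOf C.codes t % h := by
      intro j hj hb
      have h1 : block C.codes h j = block C.codes h t := le_antisymm (block_arg_le hC h ht hj) hb
      have h2 := Nat.div_add_mod (depthOf C.codes j) h
      have h3 := Nat.div_add_mod (depthOf C.codes t) h
      have h4 := depthOf_arg_le hC ht hj
      unfold block at h1
      rw [h1] at h2
      omega
    have hw : C[t].weight ≤ depthOf C.codes t % h + 1 := by
      by_cases h6 : C[t].code.1 = 5
      · obtain ⟨j, hj, hb⟩ := h5 h6
        have := hmod j hj hb
        omega
      · have : C[t].weight ≤ 1 := by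
          revert h6
          cases C[t] <;> simp [Gate.code, Gate.weight]
        omega
    have hpiece : ∀ j ∈ C[t].args,
        (if isLeaf C.codes h t j = true then [j] else frontier C.codes h j).length ≤
          2 ^ (depthOf C.codes t % h + 1 - C[t].weight) := by
      intro j hj
      split_ifs with hleaf
      · exact Nat.one_le_two_pow
      · simp only [isLeaf, Bool.or_eq_true, decide_eq_true_eq, not_or, not_lt,
          Bool.not_eq_true] at hleaf
        have hjt := hC.lt ht hj
        refine (ih j hjt (hjt.trans ht) hleaf.1).trans (Nat.pow_le_pow_right (by norm_num) ?_)
        have := hmod j hj hleaf.2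
        omega
    rw [frontier_eq hC h ht, List.length_flatMap]
    calc (C[t].args.map fun j =>
          (if isLeaf C.codes h t j = true then [j] else frontier C.codes h j).length).sum
        ≤ C[t].args.length * 2 ^ (depthOf C.codes t % h + 1 - C[t].weight) := by
          refine (List.sum_le_card_nsmul _ _ fun a ha => ?_).trans_eq (by
            rw [List.length_map, smul_eq_mul])
          obtain ⟨j, hj, rfl⟩ := List.mem_map.1 ha
          exact hpiece j hj
      _ ≤ 2 ^ C[t].weight * 2 ^ (depthOf C.codes t % h + 1 - C[t].weight) :=
          Nat.mul_le_mul_right _ C[t].length_args_le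
      _ = 2 ^ (depthOf C.codes t % h + 1) := by
          rw [← pow_add, Nat.add_sub_cancel' hw]

theorem values_getD (B : Language Bool) (x : List Bool) {t : ℕ} (ht : t < C.length) :
    (C.values B x).getD t false = C[t].eval B x ((C.values B x).take t) :=
  scan_getD (fun vals (g : Gate) => g.eval B x vals) C ht false

theorem length_values (B : Language Bool) (x : List Bool) : (C.values B x).length = C.length :=
  length_scan (fun vals (g : Gate) => g.eval B x vals) C

/-- The values of the frontier of a gate determine its value. -/
theorem evalList_getD (hC : C.WellFormed n) (h : ℕ) {B : Language Bool} {dec : List Bool → Bool}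
    (hdec : ∀ x, x ∈ B ↔ dec x = true) (x : List Bool) (F : List ℕ) {s : ℕ} (hs : s < C.length)
    (hsF : s ∈ F ∨ isCut C.codes h s = false ∧ ∀ j ∈ frontier C.codes h s, j ∈ F) :
    (evalList dec C.codes F (F.map fun j => (C.values B x).getD j false)).getD s false =
      (C.values B x).getD s false := by
  induction s using Nat.strong_induction_on with
  | _ s ih =>
    set E := evalList dec C.codes F (F.map fun j => (C.values B x).getD j false) with hE
    have h2 : s < C.codes.length := by simpa using hs
    have h1 : E.getD s false = if s ∈ F then
        (F.map fun j => (C.values B x).getD j false).getD (F.idxOf s) false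
        else codeEval dec (E.take s) C[s].code := by
      have h1 := scan_getD (fun vals c => if vals.length ∈ F then
        (F.map fun j => (C.values B x).getD j false).getD (F.idxOf vals.length) false
        else codeEval dec vals c) C.codes h2 false
      have h3 : ((scan (fun vals c => if vals.length ∈ F then
          (F.map fun j => (C.values B x).getD j false).getD (F.idxOf vals.length) false
          else codeEval dec vals c) C.codes).take s).length = s := by
        simp [length_scan, hs.le]
      rw [List.getElem_map, h3] at h1
      exact h1
    rw [h1]
    split_ifs with hmem
    · have hlt := List.idxOf_lt_length_of_mem hmem
      rw [List.getD_eq_getElem _ _ (by simpa using hlt), List.getElem_map, List.getElem_idxOf]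
    · obtain ⟨hcut, hsub⟩ := hsF.resolve_left hmem
      rw [values_getD B x hs]
      refine Gate.codeEval_code hdec x (code_eq_of_isCut hs hcut).1 fun j hj => ?_
      have hjs := hC.lt hs hj
      rw [getD_take hjs, getD_take hjs]
      rw [frontier_eq hC h hs] at hsub
      refine ih j hjs (hjs.trans hs) ?_
      by_cases hleaf : isLeaf C.codes h s j = true
      · exact Or.inl (hsub j (List.mem_flatMap.2 ⟨j, hj, by simp [hleaf]⟩))
      · refine Or.inr ⟨?_, fun i hi =>
          hsub i (List.mem_flatMap.2 ⟨j, hj, by simpa [hleaf] using hi⟩)⟩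
        simp only [isLeaf, Bool.or_eq_true, not_or, Bool.not_eq_true] at hleaf
        exact hleaf.1

end Circuit

/-! ### Networks from circuits -/

/-- The height of the blocks, such that `fan d N = 2 ^ height d N`. -/
def height (d N : ℕ) : ℕ := Nat.log 2 (N + 2) / d + 1

/-- Cell `(2, t, 0, 0)` computes the value of gate `t` of the circuit with the list of codes `cs N`,
with a query or from the frontier of the gate. -/
def circuitLayout {cs : ℕ → List (ℕ × List ℕ)} (hcs : Computable cs) {dec : List Bool → Bool}
    (hdec : Computable dec) (d T : ℕ) : Layout where
  cells N := (List.range (cs N).length).map fun t => (2, t, 0, 0)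
  deps N l :=
    if l.1 = 0 then [(2, (cs N).length - 1, 0, 0)]
    else if ((cs N).getD l.2.1 (0, [])).1 = 0 then
      [(1, ((cs N).getD l.2.1 (0, [])).2.headD 0, 0, 0)]
    else (if isCut (cs N) (height d N) l.2.1 = true then codeArgs ((cs N).getD l.2.1 (0, []))
      else frontier (cs N) (height d N) l.2.1).map fun j => (2, j, 0, 0)
  kind N l := if l.1 = 0 then 0 else
    if ((cs N).getD l.2.1 (0, [])).1 = 5 ∧ isCut (cs N) (height d N) l.2.1 = true then 1 else 0
  loc N l bits := if l.1 = 0 ∨ ((cs N).getD l.2.1 (0, [])).1 = 0 then bits.headD false else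
    (evalList dec (cs N) (frontier (cs N) (height d N) l.2.1) bits).getD l.2.1 false
  iters _ := T
  computable_cells := by fun_prop
  computable_deps := by
    have h1 := computable_codeArgs
    have h2 := computable_isCut
    have h3 := computable_frontier
    unfold height
    fun_prop
  computable_kind := by
    have h2 := computable_isCut
    unfold height
    fun_prop
  computable_loc := by
    have h2 := computable_frontier
    have h3 := computable_evalList hdec
    unfold height
    fun_prop
  computable_iters := by fun_prop

section

variable {C : ℕ → Circuit} (hC : ∀ n, (C n).WellFormed n)
  (hcs : Computable fun n => (C n).codes) {dec : List Bool → Bool} (hdec : Computable dec)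
  {B : Language Bool} (hB : ∀ x, x ∈ B ↔ dec x = true) (d T : ℕ)

theorem isCut_oracle {C : Circuit} {h t : ℕ} (ht : t < C.length)
    (hcut : isCut C.codes h t = true) (h0 : C[t].code.1 ≠ 0) :
    C[t].code.1 = 5 ∧ ∀ j ∈ C[t].args, block C.codes h j < block C.codes h t := by
  unfold isCut at hcut
  rw [Circuit.getD_codes ht, C[t].codeArgs_code] at hcut
  simpa [h0] using hcut

theorem circuitLayout_kind {N t : ℕ} (ht : t < (C N).length) :
    (circuitLayout hcs hdec d T).kind N (2, t, 0, 0) =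
      if (C N)[t].code.1 = 5 ∧ isCut (C N).codes (height d N) t = true then 1 else 0 := by
  simp only [circuitLayout, Circuit.getD_codes ht]
  rfl

theorem circuitLayout_deps {N t : ℕ} (ht : t < (C N).length) :
    (circuitLayout hcs hdec d T).deps N (2, t, 0, 0) =
      if (C N)[t].code.1 = 0 then [(1, (C N)[t].code.2.headD 0, 0, 0)]
      else (if isCut (C N).codes (height d N) t = true then (C N)[t].args
        else frontier (C N).codes (height d N) t).map fun j => (2, j, 0, 0) := by
  simp only [circuitLayout, Circuit.getD_codes ht, Gate.codeArgs_code]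
  rfl

theorem circuitLayout_loc {N t : ℕ} (ht : t < (C N).length) (bits : List Bool) :
    (circuitLayout hcs hdec d T).loc N (2, t, 0, 0) bits =
      if (C N)[t].code.1 = 0 then bits.headD false
      else (evalList dec (C N).codes (frontier (C N).codes (height d N) t) bits).getD t false := by
  simp only [circuitLayout, Circuit.getD_codes ht, OfNat.ofNat_ne_zero, false_or]

include hC hB in
/-- The number of iterations after which a gate has got its value depends on its block only. -/
theorem val_circuitLayout (x : List Bool) {t : ℕ} (ht : t < (C x.length).length) {k : ℕ}
    (hk : 2 * block (C x.length).codes (height d x.length) t +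
      (if isCut (C x.length).codes (height d x.length) t = true then 2 else 3) ≤ k) :
    (circuitLayout hcs hdec d T).val (fun _ => B) x k (2, t, 0, 0) =
      ((C x.length).values B x).getD t false := by
  induction t using Nat.strong_induction_on generalizing k with
  | _ t ih =>
    obtain ⟨k, rfl⟩ : ∃ k', k = k' + 1 := ⟨k - 1, by split_ifs at hk <;> omega⟩
    rw [Circuit.values_getD B x ht]
    by_cases h0 : (C x.length)[t].code.1 = 0
    · rw [Layout.val_succ_local _ _ _ _ (by simp)
        (by simp [circuitLayout_kind hcs hdec d T ht, h0])]
      have hdeps : (circuitLayout hcs hdec d T).deps x.length (2, t, 0, 0) =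
          [(1, (C x.length)[t].code.2.headD 0, 0, 0)] := by
        rw [circuitLayout_deps hcs hdec d T ht, if_pos h0]
      have hloc : ∀ bits, (circuitLayout hcs hdec d T).loc x.length (2, t, 0, 0) bits =
          bits.headD false := fun bits => by
        rw [circuitLayout_loc hcs hdec d T ht, if_pos h0]
      rw [hdeps, hloc, List.map_singleton, Layout.val_input]
      revert h0
      cases (C x.length)[t] <;> simp [Gate.code, Gate.eval]
    by_cases hcut : isCut (C x.length).codes (height d x.length) t = true
    · obtain ⟨h5, hargs⟩ := isCut_oracle ht hcut h0
      rw [if_pos hcut] at hk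
      have hkind : (circuitLayout hcs hdec d T).kind x.length (2, t, 0, 0) = 0 + 1 := by
        rw [circuitLayout_kind hcs hdec d T ht, if_pos ⟨h5, hcut⟩]
      have hdeps : (circuitLayout hcs hdec d T).deps x.length (2, t, 0, 0) =
          (C x.length)[t].args.map fun j => (2, j, 0, 0) := by
        rw [circuitLayout_deps hcs hdec d T ht, if_neg h0, if_pos hcut]
      rw [Bool.eq_iff_iff, Layout.val_succ_oracle _ _ _ _ 0 (by simp) hkind, hdeps, List.map_map]
      have hmap : ((C x.length)[t].args.map
          ((circuitLayout hcs hdec d T).val (fun _ => B) x k ∘ fun j => (2, j, 0, 0))) =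
          (C x.length)[t].args.map fun j =>
            (((C x.length).values B x).take t).getD j false := by
        refine List.map_congr_left fun j hj => ?_
        have hjt := (hC _).lt ht hj
        rw [getD_take hjt]
        refine ih j hjt (hjt.trans ht) ?_
        have := hargs j hj
        split_ifs <;> omega
      rw [hmap]
      revert h5
      cases (C x.length)[t] <;> simp [Gate.code, Gate.eval, Gate.args]
    · rw [if_neg hcut] at hk
      rw [Bool.not_eq_true] at hcut
      have hkind : (circuitLayout hcs hdec d T).kind x.length (2, t, 0, 0) = 0 := by
        simp [circuitLayout_kind hcs hdec d T ht, hcut]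
      have hdeps : (circuitLayout hcs hdec d T).deps x.length (2, t, 0, 0) =
          (frontier (C x.length).codes (height d x.length) t).map fun j => (2, j, 0, 0) := by
        simp [circuitLayout_deps hcs hdec d T ht, h0, hcut]
      have hloc : ∀ bits, (circuitLayout hcs hdec d T).loc x.length (2, t, 0, 0) bits =
          (evalList dec (C x.length).codes (frontier (C x.length).codes (height d x.length) t)
            bits).getD t false := fun bits => by
        rw [circuitLayout_loc hcs hdec d T ht, if_neg h0]
      rw [Layout.val_succ_local _ _ _ _ (by simp) hkind, hdeps, hloc, List.map_map,
        ← Circuit.values_getD B x ht]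
      have hmap : ((frontier (C x.length).codes (height d x.length) t).map
          ((circuitLayout hcs hdec d T).val (fun _ => B) x k ∘ fun j => (2, j, 0, 0))) =
          (frontier (C x.length).codes (height d x.length) t).map fun j =>
            ((C x.length).values B x).getD j false := by
        refine List.map_congr_left fun j hj => ?_
        obtain ⟨hjt, hleaf, hle⟩ := Circuit.mem_frontier (hC _) _ ht hj
        refine ih j hjt (hjt.trans ht) ?_
        simp only [isLeaf, Bool.or_eq_true, decide_eq_true_eq] at hleaf
        split_ifs with hc
        · omega
        · have := hleaf.resolve_left hc
          omega
      rw [hmap]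
      exact Circuit.evalList_getD (hC _) _ hB x _ ht (Or.inr ⟨hcut, fun j hj => hj⟩)

end

theorem fan_eq (d N : ℕ) : fan d N = 2 ^ height d N := rfl

/-- Circuits of logarithmic depth give rise to networks with a constant number of iterations. -/
theorem exists_circuitLayout_decides {C : ℕ → Circuit} (hC : ∀ n, (C n).WellFormed n)
    (hcs : Computable fun n => (C n).codes) {dec : List Bool → Bool} (hdec : Computable dec)
    {A B : Language Bool} (hB : ∀ x, x ∈ B ↔ dec x = true) {c₁ c₂ : ℕ}
    (h₁ : ∀ n, (C n).length ≤ (n + 2) ^ c₁)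
    (h₂ : ∀ n, ∀ a ∈ (C n).depths, a ≤ c₂ * Nat.log 2 (n + 2))
    (hA : ∀ x, x ∈ A ↔ (C x.length).output B x = true) {d : ℕ} (hd : 0 < d) :
    ∃ (G : Network) (e T : ℕ), G.Decides (fun _ => B) d e A ∧ ∀ N, G.iters N ≤ T := by
  have hdepth : ∀ N t, t < (C N).length → depthOf (C N).codes t ≤ c₂ * Nat.log 2 (N + 2) := by
    intro N t ht
    refine h₂ N _ ?_
    have ht' : t < (C N).depths.length := by
      rw [← depthList_map_code, depthList, length_scan]
      simpa using ht
    unfold depthOf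
    rw [depthList_map_code, List.getD_eq_getElem _ _ ht']
    exact List.getElem_mem _
  have hlog : ∀ N, Nat.log 2 (N + 2) ≤ d * height d N := fun N =>
    (Nat.lt_mul_div_succ _ hd).le
  have hblock : ∀ N t, t < (C N).length → block (C N).codes (height d N) t ≤ c₂ * d := by
    intro N t ht
    refine Nat.div_le_of_le_mul ((hdepth N t ht).trans ?_)
    calc c₂ * Nat.log 2 (N + 2) ≤ c₂ * (d * height d N) := Nat.mul_le_mul_left _ (hlog N)
      _ = height d N * (c₂ * d) := by ring
  have hpos : ∀ N, 0 < (C N).length := fun N => List.length_pos_iff.2 (hC N).1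
  have hargs : ∀ N t (ht : t < (C N).length), (C N)[t].args.length ≤ (N + 2) ^ (c₂ + 1) := by
    intro N t ht
    refine (Gate.length_args_le _).trans ?_
    calc 2 ^ (C N)[t].weight ≤ 2 ^ (c₂ * Nat.log 2 (N + 2)) :=
          Nat.pow_le_pow_right (by norm_num) ((Circuit.weight_le_depthOf ht).trans (hdepth N t ht))
      _ = (2 ^ Nat.log 2 (N + 2)) ^ c₂ := by rw [← pow_mul, mul_comm]
      _ ≤ (N + 2) ^ c₂ := Nat.pow_le_pow_left (Nat.pow_log_le_self 2 (by omega)) _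
      _ ≤ (N + 2) ^ (c₂ + 1) := Nat.pow_le_pow_right (by omega) (by omega)
  have hfr : ∀ N t, t < (C N).length → isCut (C N).codes (height d N) t = false →
      (frontier (C N).codes (height d N) t).length ≤ fan d N := by
    intro N t ht hcut
    refine (Circuit.length_frontier_le (hC N) ht hcut).trans ?_
    rw [fan_eq]
    refine Nat.pow_le_pow_right (by norm_num) ?_
    exact Nat.mod_lt _ (Nat.succ_pos _)
  have hfan : ∀ N, fan d N ≤ (N + 2) ^ 2 := by
    intro N
    rw [fan_eq, height, pow_succ]
    calc 2 ^ (Nat.log 2 (N + 2) / d) * 2 ≤ 2 ^ Nat.log 2 (N + 2) * 2 :=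
          Nat.mul_le_mul_right _ (Nat.pow_le_pow_right (by norm_num) (Nat.div_le_self _ _))
      _ ≤ (N + 2) * (N + 2) :=
          Nat.mul_le_mul (Nat.pow_log_le_self 2 (by omega)) (by omega)
      _ = (N + 2) ^ 2 := by ring
  have hone : ∀ N e, 1 ≤ (N + 2) ^ e := fun N e => Nat.one_le_pow _ _ (by omega)
  let L := circuitLayout hcs hdec d (2 * (c₂ * d) + 4)
  have hmem : ∀ {N l}, l ∈ L.cells N ↔ ∃ t < (C N).length, l = (2, t, 0, 0) := by
    intro N l
    change l ∈ (List.range (C N).codes.length).map _ ↔ _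
    simp [eq_comm]
  -- the arguments of a cell, according to its type
  have hdeps : ∀ N t (ht : t < (C N).length),
      (∃ i, i < N ∧ L.kind N (2, t, 0, 0) = 0 ∧ L.deps N (2, t, 0, 0) = [(1, i, 0, 0)]) ∨
      (L.kind N (2, t, 0, 0) ≠ 0 ∧
        L.deps N (2, t, 0, 0) = (C N)[t].args.map fun j => (2, j, 0, 0)) ∨
      (isCut (C N).codes (height d N) t = false ∧
        L.deps N (2, t, 0, 0) =
          (frontier (C N).codes (height d N) t).map fun j => (2, j, 0, 0)) := by
    intro N t ht
    have hk := circuitLayout_kind hcs hdec d (2 * (c₂ * d) + 4) ht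
    have hD := circuitLayout_deps hcs hdec d (2 * (c₂ * d) + 4) ht
    by_cases h0 : (C N)[t].code.1 = 0
    · left
      obtain ⟨i, hi⟩ : ∃ i, (C N)[t] = Gate.input i := by
        revert h0
        cases (C N)[t] <;> simp [Gate.code]
      refine ⟨i, (hC N).2.1 i (hi ▸ List.getElem_mem ht), ?_, ?_⟩
      · exact hk.trans (by simp [h0])
      · refine hD.trans ?_
        simp [hi, Gate.code]
    · right
      by_cases hcut : isCut (C N).codes (height d N) t = true
      · left
        obtain ⟨h5, -⟩ := isCut_oracle ht hcut h0
        exact ⟨by rw [hk]; simp [h5, hcut], hD.trans (by simp [h5, hcut])⟩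
      · right
        rw [Bool.not_eq_true] at hcut
        exact ⟨hcut, hD.trans (by simp [h0, hcut])⟩
  have hout : ∀ N, L.deps N (0, 0, 0, 0) = [(2, (C N).length - 1, 0, 0)] := by
    intro N
    simp [L, circuitLayout]
  refine ⟨L.network, c₁ + c₂ + 2 + 2, 2 * (c₂ * d) + 4,
    L.exists_decides (e := c₁ + c₂ + 2) (fun N l hl => ?_)
    (fun N l hl hne l' hl' => ?_) (fun N => ?_) (fun N l hl hne hk => ?_)
    (fun N l hl hne => ?_) (fun x => ?_), fun N => le_rfl⟩
  · obtain ⟨t, -, rfl⟩ := hmem.1 hl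
    exact le_rfl
  · rw [Layout.mem_labels]
    rcases L.mem_labels.1 hl with rfl | ⟨j, -, rfl⟩ | hl
    · rw [hout, List.mem_singleton] at hl'
      exact Or.inr (Or.inr (hmem.2 ⟨_, Nat.sub_lt (hpos N) one_pos, hl'⟩))
    · exact absurd rfl hne
    · obtain ⟨t, ht, rfl⟩ := hmem.1 hl
      rcases hdeps N t ht with ⟨i, hi, -, h⟩ | ⟨-, h⟩ | ⟨-, h⟩
      · rw [h, List.mem_singleton] at hl'
        exact Or.inr (Or.inl ⟨i, hi, hl'⟩)
      · rw [h, List.mem_map] at hl'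
        obtain ⟨j, hj, rfl⟩ := hl'
        exact Or.inr (Or.inr (hmem.2 ⟨j, ((hC N).lt ht hj).trans ht, rfl⟩))
      · rw [h, List.mem_map] at hl'
        obtain ⟨j, hj, rfl⟩ := hl'
        exact Or.inr (Or.inr
          (hmem.2 ⟨j, (Circuit.mem_frontier (hC N) _ ht hj).1.trans ht, rfl⟩))
  · have : (L.cells N).length = (C N).length := by simp [L, circuitLayout]
    rw [this]
    exact (h₁ N).trans (Nat.pow_le_pow_right (by omega) (by omega))
  · rcases L.mem_labels.1 hl with rfl | ⟨j, -, rfl⟩ | hl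
    · rw [hout]
      exact fan_pos d N
    · exact absurd rfl hne
    · obtain ⟨t, ht, rfl⟩ := hmem.1 hl
      rcases hdeps N t ht with ⟨i, -, -, h⟩ | ⟨h, -⟩ | ⟨hcut, h⟩
      · rw [h]
        exact fan_pos d N
      · exact absurd hk h
      · rw [h, List.length_map]
        exact hfr N t ht hcut
  · rcases L.mem_labels.1 hl with rfl | ⟨j, -, rfl⟩ | hl
    · rw [hout]
      exact hone N _
    · exact absurd rfl hne
    · obtain ⟨t, ht, rfl⟩ := hmem.1 hl
      rcases hdeps N t ht with ⟨i, -, -, h⟩ | ⟨-, h⟩ | ⟨hcut, h⟩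
      · rw [h]
        exact hone N _
      · rw [h, List.length_map]
        exact (hargs N t ht).trans (Nat.pow_le_pow_right (by omega) (by omega))
      · rw [h, List.length_map]
        exact ((hfr N t ht hcut).trans (hfan N)).trans
          (Nat.pow_le_pow_right (by omega) (by omega))
  · have hlast : (C x.length).length - 1 < (C x.length).length :=
      Nat.sub_lt (hpos x.length) one_pos
    have hval : L.val (fun _ => B) x (2 * (c₂ * d) + 3 + 1) (0, 0, 0, 0) =
        L.val (fun _ => B) x (2 * (c₂ * d) + 3) (2, (C x.length).length - 1, 0, 0) := by
      rw [Layout.val_succ_local _ _ _ _ (by simp) (by simp [L, circuitLayout]), hout]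
      simp [L, circuitLayout]
    have hgate := val_circuitLayout hC hcs hdec hB d (2 * (c₂ * d) + 4) x hlast
      (k := 2 * (c₂ * d) + 3) (by
        have := hblock x.length _ hlast
        split_ifs <;> omega)
    change _ ↔ L.val (fun _ => B) x (2 * (c₂ * d) + 3 + 1) _ = true
    rw [hA, hval, hgate, Circuit.output, List.getLastD_eq_getLast?, List.getLast?_eq_getElem?,
      Circuit.length_values, List.getD_eq_getElem?_getD]

/-- A problem in `L` that is reducible to a problem that can be solved in `O(f(N))` rounds can be
solved in `O(f(N))` rounds. -/
theorem NC1Reducible.solvable {f : ℕ → ℝ} (hf : ∀ N, 0 < f N) (hstable : PolyStableBelowLog f)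
    {A B : Language Bool} (hA : InL A) (h : NC1Reducible A B) (hB : SolvableInRounds f B) :
    SolvableInRounds f A := by
  obtain ⟨C, hC, ⟨g, hg, hgC⟩, ⟨c₁, h₁⟩, ⟨c₂, h₂⟩, hCA⟩ := h
  obtain ⟨dec, hdec, hdecB⟩ := hB.exists_computable
  exact solvable_of_networks hf hstable hA.inNL.solvable_log (fun _ h0 h1 => hB.solves h0 h1)
    fun d hd => exists_circuitLayout_decides hC (computable_circuit_codes hg hgC) hdec hdecB
      h₁ h₂ hCA hd

/-! ### Reductions -/

/-- The language of the pairs `⟨x, i⟩` with `i < |g x|`. -/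
def lengthLanguage (g : List Bool → List Bool) : Language Bool :=
  {y | ∃ x i, y = pairIndex x i ∧ i < (g x).length}

/-- The language of the pairs `⟨x, i⟩` for which the `i`-th bit of `g x` is `1`. -/
def bitLanguage (g : List Bool → List Bool) : Language Bool :=
  {y | ∃ x i, y = pairIndex x i ∧ (g x)[i]? = some true}

/-- Cells `(6, 0, 0, 0)` and `(7, 0, 0, 0)` are constants. For `m ≤ (N + 2) ^ c`, cell
`(2, m, 0, 0)` asks whether `m < |g x|`, cell `(3, m, 0, 0)` asks for bit `m` of `g x`, cell
`(8, m, 0, 0)` checks whether `m = |g x|`, and cell `(4, m, 0, 0)` asks whether the first `m` bits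
of `g x` form an element of the language to which `g` reduces; the answer is relevant if
`m = |g x|`, which is taken into account by cell `(5, m, 0, 0)`. -/
def reductionLayout (c : ℕ) : Layout where
  cells N := (6, 0, 0, 0) :: (7, 0, 0, 0) :: (List.range ((N + 2) ^ c + 1)).flatMap fun m =>
    [(2, m, 0, 0), (3, m, 0, 0), (4, m, 0, 0), (5, m, 0, 0), (8, m, 0, 0)]
  deps N l :=
    if l.1 = 0 then (List.range ((N + 2) ^ c + 1)).map fun m => (5, m, 0, 0)
    else if l.1 = 2 ∨ l.1 = 3 then List.replicate l.2.1 (6, 0, 0, 0) ++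
      (7, 0, 0, 0) :: (List.range N).map fun j => (1, j, 0, 0)
    else if l.1 = 4 then (List.range l.2.1).map fun i => (3, i, 0, 0)
    else if l.1 = 5 then [(4, l.2.1, 0, 0), (8, l.2.1, 0, 0)]
    else if l.1 = 8 then (2, l.2.1, 0, 0) :: if l.2.1 = 0 then [] else [(2, l.2.1 - 1, 0, 0)]
    else []
  kind _ l := if l.1 = 0 then 4 else if l.1 = 2 then 1 else if l.1 = 3 then 2 else
    if l.1 = 4 then 3 else 0
  loc _ l bits := if l.1 = 6 then true else if l.1 = 7 then false else
    if l.1 = 5 then bits.getD 0 false && bits.getD 1 false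
    else !(bits.getD 0 false) && (decide (l.2.1 = 0) || bits.getD 1 false)
  iters _ := 5
  computable_cells := by fun_prop
  computable_deps := by fun_prop
  computable_kind := by fun_prop
  computable_loc := by fun_prop
  computable_iters := by fun_prop

/-- The oracles for the cells of `reductionLayout`. -/
def reductionOracles (g : List Bool → List Bool) (B : Language Bool) : ℕ → Language Bool :=
  consSeq (lengthLanguage g) (consSeq (bitLanguage g) (consSeq B fun _ => orLanguage))

section

variable (g : List Bool → List Bool) (B : Language Bool) (c : ℕ) (x : List Bool)

theorem mem_cells_reductionLayout {N : ℕ} {l : Label} : l ∈ (reductionLayout c).cells N ↔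
    l = (6, 0, 0, 0) ∨ l = (7, 0, 0, 0) ∨ ∃ m < (N + 2) ^ c + 1, l = (2, m, 0, 0) ∨
      l = (3, m, 0, 0) ∨ l = (4, m, 0, 0) ∨ l = (5, m, 0, 0) ∨ l = (8, m, 0, 0) := by
  simp only [reductionLayout, List.mem_cons, List.mem_flatMap, List.mem_range, List.not_mem_nil,
    or_false]

/-- The arguments of the queries for lengths and bits form a pair `⟨x, m⟩` after one iteration. -/
theorem reduction_pair (m : ℕ) : ((List.replicate m ((6, 0, 0, 0) : Label) ++
    (7, 0, 0, 0) :: (List.range x.length).map fun j => (1, j, 0, 0)).map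
      ((reductionLayout c).val (reductionOracles g B) x 1)) = pairIndex x m := by
  have h6 : (reductionLayout c).val (reductionOracles g B) x 1 (6, 0, 0, 0) = true := by
    rw [Layout.val_succ_local _ _ _ _ (by simp) (by simp [reductionLayout])]
    simp [reductionLayout]
  have h7 : (reductionLayout c).val (reductionOracles g B) x 1 (7, 0, 0, 0) = false := by
    rw [Layout.val_succ_local _ _ _ _ (by simp) (by simp [reductionLayout])]
    simp [reductionLayout]
  have hx : ((List.range x.length).map fun j => ((1, j, 0, 0) : Label)).map
      ((reductionLayout c).val (reductionOracles g B) x 1) = x := by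
    rw [List.map_map]
    refine List.ext_getElem (by simp) fun j h1 h2 => ?_
    simp [Layout.val_input, h2]
  rw [List.map_append, List.map_cons, List.map_replicate, h6, h7, hx]
  rfl

theorem reduction_length (m : ℕ) :
    (reductionLayout c).val (reductionOracles g B) x 2 (2, m, 0, 0) = true ↔
      m < (g x).length := by
  rw [Layout.val_succ_oracle _ _ _ _ 0 (by simp) (by simp [reductionLayout])]
  have : (reductionLayout c).deps x.length (2, m, 0, 0) = List.replicate m (6, 0, 0, 0) ++
      (7, 0, 0, 0) :: (List.range x.length).map fun j => (1, j, 0, 0) := by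
    simp [reductionLayout]
  rw [this, reduction_pair]
  exact pairIndex_mem

theorem reduction_bit (m : ℕ) :
    (reductionLayout c).val (reductionOracles g B) x 2 (3, m, 0, 0) = true ↔
      (g x)[m]? = some true := by
  rw [Layout.val_succ_oracle _ _ _ _ 1 (by simp) (by simp [reductionLayout])]
  have : (reductionLayout c).deps x.length (3, m, 0, 0) = List.replicate m (6, 0, 0, 0) ++
      (7, 0, 0, 0) :: (List.range x.length).map fun j => (1, j, 0, 0) := by
    simp [reductionLayout]
  rw [this, reduction_pair]
  exact pairIndex_mem (p := fun x i => (g x)[i]? = some true)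

theorem reduction_end (m : ℕ) :
    (reductionLayout c).val (reductionOracles g B) x 3 (8, m, 0, 0) = true ↔
      m = (g x).length := by
  have h : ∀ m, (reductionLayout c).val (reductionOracles g B) x 2 (2, m, 0, 0) =
      decide (m < (g x).length) := fun m => by
    rw [Bool.eq_iff_iff, reduction_length, decide_eq_true_iff]
  have hloc : ∀ bits, (reductionLayout c).loc x.length (8, m, 0, 0) bits =
      (!(bits.getD 0 false) && (decide (m = 0) || bits.getD 1 false)) := fun _ => rfl
  have hdeps : (reductionLayout c).deps x.length (8, m, 0, 0) =
      (2, m, 0, 0) :: if m = 0 then [] else [(2, m - 1, 0, 0)] := rfl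
  rw [Layout.val_succ_local _ _ _ _ (by simp) (by simp [reductionLayout]), hloc, hdeps]
  generalize (g x).length = a at h
  rcases m with _ | m
  · simp [h]
    omega
  · simp [h]
    omega

theorem reduction_query :
    (reductionLayout c).val (reductionOracles g B) x 3 (4, (g x).length, 0, 0) = true ↔
      g x ∈ B := by
  rw [Layout.val_succ_oracle _ _ _ _ 2 (by simp) (by simp [reductionLayout])]
  have : (reductionLayout c).deps x.length (4, (g x).length, 0, 0) =
      (List.range (g x).length).map fun i => (3, i, 0, 0) := by
    simp [reductionLayout]
  have h2 : ((List.range (g x).length).map fun i => ((3, i, 0, 0) : Label)).map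
      ((reductionLayout c).val (reductionOracles g B) x 2) = g x := by
    rw [List.map_map]
    refine List.ext_getElem (by simp) fun j h1 h2 => ?_
    rw [Bool.eq_iff_iff, List.getElem_map, List.getElem_range, Function.comp_apply, reduction_bit]
    simp [h2]
  rw [this, h2]
  rfl

theorem reduction_output (hc : (g x).length ≤ (x.length + 2) ^ c) :
    (reductionLayout c).val (reductionOracles g B) x 5 (0, 0, 0, 0) = true ↔ g x ∈ B := by
  have hsel : ∀ m, (reductionLayout c).val (reductionOracles g B) x 4 (5, m, 0, 0) =
      ((reductionLayout c).val (reductionOracles g B) x 3 (4, m, 0, 0) &&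
        (reductionLayout c).val (reductionOracles g B) x 3 (8, m, 0, 0)) := by
    intro m
    rw [Layout.val_succ_local _ _ _ _ (by simp) (by simp [reductionLayout])]
    simp [reductionLayout]
  have hdeps : (reductionLayout c).deps x.length (0, 0, 0, 0) =
      (List.range ((x.length + 2) ^ c + 1)).map fun m => (5, m, 0, 0) := by
    simp [reductionLayout]
  rw [Layout.val_succ_oracle _ _ _ _ 3 (by simp) (by simp [reductionLayout]), hdeps,
    show reductionOracles g B 3 = orLanguage from rfl, mem_orLanguage, List.map_map, List.mem_map]
  simp only [Function.comp_apply, hsel, Bool.and_eq_true, reduction_end, List.mem_range]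
  constructor
  · rintro ⟨m, -, h, rfl⟩
    exact (reduction_query g B c x).1 h
  · exact fun h => ⟨_, Nat.lt_succ_of_le hc, (reduction_query g B c x).2 h, rfl⟩

end

theorem reductionLayout_decides {A B : Language Bool} {g : List Bool → List Bool} {c : ℕ}
    (hc : ∀ x, (g x).length ≤ (x.length + 2) ^ (c + 1)) (hg : ∀ x, x ∈ A ↔ g x ∈ B) (d : ℕ) :
    (reductionLayout (c + 1)).network.Decides (reductionOracles g B) d (c + 5 + 2) A := by
  have hM : ∀ N, N + 2 ≤ (N + 2) ^ (c + 1) := fun N => Nat.le_self_pow (by omega) _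
  have hM' : ∀ N, 16 * (N + 2) ^ (c + 1) ≤ (N + 2) ^ (c + 5) := by
    intro N
    rw [show c + 5 = 4 + (c + 1) by omega, pow_add _ 4]
    exact Nat.mul_le_mul_right _ (Nat.pow_le_pow_left (by omega : 2 ≤ N + 2) 4)
  have hcells := fun {N : ℕ} {l : Label} => mem_cells_reductionLayout (c + 1) (N := N) (l := l)
  have h2 : ∀ N, 2 ≤ fan d N := by
    intro N
    unfold fan
    rw [pow_succ]
    have : 1 ≤ 2 ^ (Nat.log 2 (N + 2) / d) := Nat.one_le_two_pow
    omega
  refine (reductionLayout (c + 1)).exists_decides (fun N l hl => ?_)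
    (fun N l hl hne l' hl' => ?_) (fun N => ?_) (fun N l hl hne hk => ?_)
    (fun N l hl hne => ?_) (fun x => ?_)
  · rcases hcells.1 hl with rfl | rfl | ⟨m, -, rfl | rfl | rfl | rfl | rfl⟩ <;> simp
  · have hpair : ∀ m, l' ∈ List.replicate m ((6, 0, 0, 0) : Label) ++
        (7, 0, 0, 0) :: (List.range N).map (fun j => (1, j, 0, 0)) →
        l' ∈ (reductionLayout (c + 1)).labels N := by
      intro m h
      rw [Layout.mem_labels, hcells]
      simp only [List.mem_append, List.mem_replicate, List.mem_cons, List.mem_map,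
        List.mem_range] at h
      rcases h with ⟨-, rfl⟩ | rfl | ⟨j, hj, rfl⟩ <;> simp_all
    rcases Layout.mem_labels _ |>.1 hl with rfl | ⟨j, -, rfl⟩ | hl
    · rw [Layout.mem_labels, hcells]
      simp only [reductionLayout, if_true, List.mem_map, List.mem_range] at hl'
      obtain ⟨m, hm, rfl⟩ := hl'
      exact Or.inr (Or.inr (Or.inr (Or.inr ⟨m, hm, by simp⟩)))
    · exact absurd rfl hne
    · rcases hcells.1 hl with rfl | rfl | ⟨m, hm, rfl | rfl | rfl | rfl | rfl⟩
      · simp [reductionLayout] at hl'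
      · simp [reductionLayout] at hl'
      · exact hpair m hl'
      · exact hpair m hl'
      · rw [Layout.mem_labels, hcells]
        simp only [reductionLayout] at hl'
        simp at hl'
        obtain ⟨i, hi, rfl⟩ := hl'
        exact Or.inr (Or.inr (Or.inr (Or.inr ⟨i, by omega, by simp⟩)))
      · rw [Layout.mem_labels, hcells]
        simp [reductionLayout] at hl'
        rcases hl' with rfl | rfl <;> exact Or.inr (Or.inr (Or.inr (Or.inr ⟨m, hm, by simp⟩)))
      · rw [Layout.mem_labels, hcells]
        simp [reductionLayout] at hl'
        rcases hl' with rfl | ⟨-, rfl⟩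
        · exact Or.inr (Or.inr (Or.inr (Or.inr ⟨m, hm, by simp⟩)))
        · exact Or.inr (Or.inr (Or.inr (Or.inr ⟨m - 1, by omega, by simp⟩)))
  · have h3 : ((reductionLayout (c + 1)).cells N).length = 2 + ((N + 2) ^ (c + 1) + 1) * 5 := by
      simp [reductionLayout, List.length_flatMap]
      omega
    have h4 := hM N
    have h5 := hM' N
    omega
  · refine le_trans ?_ (h2 N)
    simp only [reductionLayout] at hk ⊢
    split_ifs at hk ⊢ <;> simp_all
  · have h3 := hM N
    have h4 := hM' N
    have h5 : l.2.1 ≤ (N + 2) ^ (c + 1) := by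
      rcases Layout.mem_labels _ |>.1 hl with rfl | ⟨j, -, rfl⟩ | hl
      · simp
      · exact absurd rfl hne
      · rcases hcells.1 hl with rfl | rfl | ⟨m, hm, rfl | rfl | rfl | rfl | rfl⟩
        · simp
        · simp
        all_goals exact Nat.lt_succ_iff.1 hm
    simp only [reductionLayout]
    split_ifs <;> simp only [List.length_map, List.length_range, List.length_append,
      List.length_replicate, List.length_cons, List.length_nil] <;> omega
  · rw [hg]
    exact (reduction_output g B (c + 1) x (hc x)).symm

/-- If some `L`-hard problem can be solved in `O(f(N))` rounds, then this carries over from any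
problem to the problems in `NL` that are reducible to it. -/
theorem LogSpaceReducible.solvable {f : ℕ → ℝ} (hf : ∀ N, 0 < f N)
    (hstable : PolyStableBelowLog f) {H A B : Language Bool} (hH : LHard H)
    (hHf : SolvableInRounds f H) (hA : InNL A) (hAB : LogSpaceReducible A B)
    (hB : SolvableInRounds f B) : SolvableInRounds f A := by
  obtain ⟨g, ⟨⟨c, hc⟩, hlen, hbit⟩, hg⟩ := hAB
  obtain ⟨C, -, hC⟩ := hstable.exists_le hf
  have hlen' : SolvableInRounds f (lengthLanguage g) :=
    (hH _ hlen).solvable hf hstable hlen hHf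
  have hbit' : SolvableInRounds f (bitLanguage g) :=
    (hH _ hbit).solvable hf hstable hbit hHf
  refine solvable_of_networks hf hstable hA.solvable_log (O := reductionOracles g B)
    (fun ε h0 h1 => ?_) fun d _ => ⟨_, _, 5, reductionLayout_decides (c := c)
      (fun x => (hc x).trans (Nat.pow_le_pow_right (by omega) (by omega))) hg d, fun N => le_rfl⟩
  obtain ⟨Q₁, h₁⟩ := hlen'.solves h0 h1
  obtain ⟨Q₂, h₂⟩ := hbit'.solves h0 h1
  obtain ⟨Q₃, h₃⟩ := hB.solves h0 h1
  obtain ⟨Q₄, h₄⟩ := (solvable_orLanguage hC).solves h0 h1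
  exact ⟨_, ((h₄.cons hf h₃).cons hf h₂).cons hf h₁⟩

end MPCSpace

theorem mainTheorem2 (f : ℕ → ℝ) (hf : ∀ N, 0 < f N)
    (hstable : MPCSpace.PolyStableBelowLog f)
    (hL : ∃ A : Language Bool, MPCSpace.LHard A ∧ MPCSpace.SolvableInRounds f A) :
    ((∀ B : Language Bool, MPCSpace.NLComplete B → MPCSpace.SolvableInRounds f B) ∨
      (∀ B : Language Bool, MPCSpace.NLComplete B → ¬ MPCSpace.SolvableInRounds f B)) ∧
    ((∃ B : Language Bool, MPCSpace.NLHard B ∧ MPCSpace.SolvableInRounds f B) →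
      ∀ B : Language Bool, MPCSpace.InNL B → MPCSpace.SolvableInRounds f B) := by
  obtain ⟨H, hH, hHf⟩ := hL
  have hNL : (∃ B : Language Bool, MPCSpace.NLHard B ∧ MPCSpace.SolvableInRounds f B) →
      ∀ B : Language Bool, MPCSpace.InNL B → MPCSpace.SolvableInRounds f B := by
    rintro ⟨B, hB, hBf⟩ A hA
    exact (hB A hA).solvable hf hstable hH hHf hA hBf
  refine ⟨?_, hNL⟩
  by_cases h : ∃ B : Language Bool, MPCSpace.NLComplete B ∧ MPCSpace.SolvableInRounds f B
  · obtain ⟨B, hB, hBf⟩ := h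
    exact Or.inl fun A hA => hNL ⟨B, hB.2, hBf⟩ A hA.1
  · exact Or.inr fun B hB hBf => h ⟨B, hB, hBf⟩
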